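/- Let $n\ge 1$, $1<r_0,r_1<\infty$, $0<s_0,s_1<\infty$ with $r_0s_0>n$ and $r_1s_1>n$. Let $\Psi$ be a Schwartz function on $\mathbb R^n$ whose Fourier transform $\widehat\Psi$ (with $\widehat f(\xi)=\int_{\mathbb R^n} f(x)e^{-2\pi i x\cdot\xi}\,dx$) is supported in the annulus $\{1/2\le|\xi|\le 2\}$ and satisfies $\sum_{j\in\mathbb Z}\widehat\Psi(2^{-j}\xi)=1$ for all $\xi\ne 0$. For a bounded measurable function $\sigma$ on $\mathbb R^n$ and $f\in\mathscr C_0^\infty(\mathbb R^n)$ put $T_\sigma f(x)=\int_{\mathbb R^n}\widehat f(\xi)\sigma(\xi)e^{2\pi i x\cdot\xi}\,d\xi$, and let $\|h\|_{L^r_s}=\|(I-\Delta)^{s/2}h\|_{L^r}$, where $(I-\Delta)^{s/2}$ acts on tempered distributions as the Fourier multiplier $(1+4\pi^2|\xi|^2)^{s/2}$ (the norm is $\infty$ if $(I-\Delta)^{s/2}h$ is not an $L^r$ function). Then there is a constant $C_*$, depending only on $n,r_0,r_1,s_0,s_1$ and $\Psi$, with the following property. Let $0<p_0,p_1<\infty$,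 $1<q_0,q_1<\infty$ and $K_0,K_1\ge 0$ be such that for $k=0,1$ $$\|T_\sigma f\|_{L^{q_k}}\le K_k\,\sup_{j\in\mathbb Z}\big\|\sigma(2^j\cdot)\widehat\Psi\big\|_{L^{r_k}_{s_k}}\,\|f\|_{L^{p_k}}$$ for all $f\in\mathscr C_0^\infty(\mathbb R^n)$ and all bounded measurable $\sigma$ for which the supremum on the right is finite. Let $0<\theta<1$ and $$\frac1p=\frac{1-\theta}{p_0}+\frac{\theta}{p_1},\quad \frac1q=\frac{1-\theta}{q_0}+\frac{\theta}{q_1},\quad \frac1r=\frac{1-\theta}{r_0}+\frac{\theta}{r_1},\quad s=(1-\theta)s_0+\theta s_1 .$$ Then $$\|T_\sigma f\|_{L^{q}}\le C_*\,K_0^{1-\theta}K_1^{\theta}\,\sup_{j\in\mathbb Z}\big\|\sigma(2^j\cdot)\widehat\Psi\big\|_{L^{r}_{s}}\,\|f\|_{L^{p}}$$ for all $f\in\mathscr C_0^\infty(\mathbb R^n)$ and all bounded measurable $\sigma$ for which the supremum on the right is finite. -/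

import Mathlib

open MeasureTheory FourierTransform Complex
open scoped ENNReal NNReal SchwartzMap ContDiff

noncomputable section

/-- The symbol `(1 + 4π²|ξ|²)^{s/2}` of the operator `(I - Δ)^{s/2}` on `ℝⁿ`. -/
def besselSymbol (n : ℕ) (s : ℝ) (ξ : EuclideanSpace ℝ (Fin n)) : ℂ :=
  ((1 + 4 * Real.pi ^ 2 * ‖ξ‖ ^ 2) ^ (s / 2) : ℝ)

/-- The symbol has temperate growth, so that multiplication by it is a genuine operation on
tempered distributions. -/
theorem besselSymbol_hasTemperateGrowth (n : ℕ) (s : ℝ) :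
    (besselSymbol n s).HasTemperateGrowth := by
  have h1 : (fun ξ : EuclideanSpace ℝ (Fin n) ↦
      (((1 + ‖ξ‖ ^ 2) ^ (s / 2) : ℝ) : ℂ)).HasTemperateGrowth := by fun_prop
  have h2 : (fun ξ : EuclideanSpace ℝ (Fin n) ↦ (2 * Real.pi) • ξ).HasTemperateGrowth :=
    ((2 * Real.pi) • ContinuousLinearMap.id ℝ (EuclideanSpace ℝ (Fin n))).hasTemperateGrowth
  have h3 := h1.comp h2
  convert h3 using 1
  ext ξ
  simp only [besselSymbol, Function.comp, norm_smul, mul_pow, norm_mul]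
  norm_num [abs_of_pos Real.pi_pos]

/-- The operator `(I - Δ)^{s/2}` on tempered distributions on `ℝⁿ`. -/
def besselOp (n : ℕ) (s : ℝ) :
    𝓢'(EuclideanSpace ℝ (Fin n), ℂ) →L[ℂ] 𝓢'(EuclideanSpace ℝ (Fin n), ℂ) :=
  TemperedDistribution.fourierMultiplierCLM ℂ (besselSymbol n s)

/-- The tempered distribution `T` is given by integration against the function `h`. -/
def IsGivenBy {n : ℕ} (T : 𝓢'(EuclideanSpace ℝ (Fin n), ℂ))
    (h : EuclideanSpace ℝ (Fin n) → ℂ) : Prop :=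
  ∀ φ : 𝓢(EuclideanSpace ℝ (Fin n), ℂ),
    Integrable (fun x ↦ φ x * h x) ∧ T φ = ∫ x, φ x * h x

/-- The Sobolev norm `‖h‖_{L^r_s} = ‖(I - Δ)^{s/2} h‖_{L^r}` of a function `h` on `ℝⁿ`, where
`(I - Δ)^{s/2} h` is taken in the sense of tempered distributions. The function `g` below is unique
up to null sets if it exists; if there is none, then the norm is `∞`. -/
def sobolevENorm {n : ℕ} (r s : ℝ) (h : EuclideanSpace ℝ (Fin n) → ℂ) : ℝ≥0∞ :=
  ⨅ (T : 𝓢'(EuclideanSpace ℝ (Fin n), ℂ)) (g : EuclideanSpace ℝ (Fin n) → ℂ)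
    (_ : IsGivenBy T h) (_ : MemLp g (ENNReal.ofReal r)) (_ : IsGivenBy (besselOp n s T) g),
    eLpNorm g (ENNReal.ofReal r)

/-- The quantity `sup_{j ∈ ℤ} ‖σ(2^j ·) Ψ̂‖_{L^r_s}`. -/
def hormanderENorm {n : ℕ} (Ψ : 𝓢(EuclideanSpace ℝ (Fin n), ℂ)) (r s : ℝ)
    (σ : EuclideanSpace ℝ (Fin n) → ℂ) : ℝ≥0∞ :=
  ⨆ j : ℤ, sobolevENorm r s (fun ξ ↦ σ ((2 : ℝ) ^ j • ξ) * (𝓕 Ψ) ξ)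

/-- `Ψ̂` is supported in `1/2 ≤ |ξ| ≤ 2`, and `∑_{j ∈ ℤ} Ψ̂(2^{-j} ξ) = 1` for `ξ ≠ 0`. -/
structure IsDyadicPartition {n : ℕ} (Ψ : 𝓢(EuclideanSpace ℝ (Fin n), ℂ)) : Prop where
  support_subset : ∀ ξ, (𝓕 Ψ) ξ ≠ 0 → 1 / 2 ≤ ‖ξ‖ ∧ ‖ξ‖ ≤ 2
  hasSum_one : ∀ ξ : EuclideanSpace ℝ (Fin n), ξ ≠ 0 →
    HasSum (fun j : ℤ ↦ (𝓕 Ψ) ((2 : ℝ) ^ (-j) • ξ)) 1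

/-- The multiplier operator `T_σ f(x) = ∫ f̂(ξ) σ(ξ) e^{2πi x·ξ} dξ`. -/
def multiplierOp {n : ℕ} (σ f : EuclideanSpace ℝ (Fin n) → ℂ) :
    EuclideanSpace ℝ (Fin n) → ℂ :=
  fun x ↦ ∫ ξ, 𝓕 f ξ * σ ξ * Complex.exp (2 * Real.pi * Complex.I * (inner ℝ x ξ : ℝ))

/-- The estimate `‖T_σ f‖_{L^q} ≤ A · sup_j ‖σ(2^j ·) Ψ̂‖_{L^r_s} · ‖f‖_{L^p}` holds for all
`f ∈ C_0^∞(ℝⁿ)` and all bounded functions `σ` for which the supremum is finite. -/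
def MultiplierBound {n : ℕ} (Ψ : 𝓢(EuclideanSpace ℝ (Fin n), ℂ)) (p q r s : ℝ) (A : ℝ≥0) :
    Prop :=
  ∀ σ : EuclideanSpace ℝ (Fin n) → ℂ, MemLp σ (⊤ : ℝ≥0∞) → hormanderENorm Ψ r s σ < (⊤ : ℝ≥0∞) →
    ∀ f : EuclideanSpace ℝ (Fin n) → ℂ, ContDiff ℝ ∞ f → HasCompactSupport f →
      eLpNorm (multiplierOp σ f) (ENNReal.ofReal q) ≤
        A * hormanderENorm Ψ r s σ * eLpNorm f (ENNReal.ofReal p)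

end

/-! The proof is complex interpolation for the form `symbolForm`, in which the symbol and both
functions vary analytically. Each localized piece `σ(2^k ·) Ψ̂` is `(I - Δ)^{-s/2} v_k` with `v_k`
in `L^r` and norms uniform in `k`. Since `fatBump` is `1` where `Ψ̂` lives, `σ` is recovered from
the functions `(fatBump · (I - Δ)^{-s/2} v_k)(2^{-k} ·)`. Replace `s` by `(1 - z) s₀ + z s₁` and
raise the moduli of `v_k`, `f` and `g` to powers affine in `z`. The original form sits at `z = θ`,
the two assumed estimates apply on the lines `Re z = 0, 1`, and the three lines theorem does the
rest (`exists_norm_symbolForm_interp_le`). Duality, approximation by bumps and finite sums over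
scales reduce the theorem to this case.

On a boundary line the Hörmander norm of the varied symbol must be bounded with moderate growth in
`Im z` (`exists_hormanderENorm_le`). Neighbouring scales overlap, so this requires multiplication by
a Schwartz function, followed by `(I - Δ)^{s/2}`, to be controlled after `(I - Δ)^{-s/2 + iτ}` and a
dyadic dilation (`exists_lpNormReal_mul_dilate_le`). Two facts about `L^p` multipliers, both proved
by heat flow, give it.

Imaginary powers (`isMult_imaginaryPower`): up to a unimodular factor, `Γ(1 - iτ) λ^{iτ}` is the
integral of `t^{-iτ}` against `-d(e^{-2tλ})`, so it suffices to bound the total variation in time of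
the pairing of two heat flows. A function `B` for which both `B ± xy` are convex makes `∫ B(u_t,
v_t)` decrease at least as fast as `∫ u_t v_t` varies.

Multiplication (`exists_lpNormReal_mul_le`): expanding the factor into characters shifts one symbol
by `η`. The logarithm of the quotient of the shifted and unshifted symbols is, by Frullani's
formula, a superposition of Gaussian symbols; its multiplier norm is `O(1 + log(1 + |η|))`.
Exponentiating costs a power of `1 + |η|`, which is integrable against a Schwartz function. -/

/-! ### Convexity of a Bellman function. -/

/-- The Bellman function `A x^p + A y^q + x² (y + x^{p-1})^{2-q}` with `A = 10 (p - 1)`. -/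
noncomputable def bellman (p q : ℝ) (z : ℝ × ℝ) : ℝ :=
  10 * (p - 1) * z.1 ^ p + 10 * (p - 1) * z.2 ^ q + z.1 ^ 2 * (z.2 + z.1 ^ (p - 1)) ^ (2 - q)

theorem continuous_bellman {p q : ℝ} (hp : 2 ≤ p) (hq : 1 < q) (hq2 : q ≤ 2) :
    Continuous (bellman p q) := by
  unfold bellman
  have h1 : Continuous fun z : ℝ × ℝ ↦ z.1 ^ p :=
    continuous_fst.rpow_const fun _ ↦ Or.inr (by linarith)
  have h2 : Continuous fun z : ℝ × ℝ ↦ z.2 ^ q :=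
    continuous_snd.rpow_const fun _ ↦ Or.inr (by linarith)
  have h3 : Continuous fun z : ℝ × ℝ ↦ z.1 ^ (p - 1) :=
    continuous_fst.rpow_const fun _ ↦ Or.inr (by linarith)
  have h4 : Continuous fun z : ℝ × ℝ ↦ (z.2 + z.1 ^ (p - 1)) ^ (2 - q) :=
    (continuous_snd.add h3).rpow_const fun _ ↦ Or.inr (by linarith)
  fun_prop

theorem bellman_nonneg {p q : ℝ} (hp : 2 ≤ p) {z : ℝ × ℝ} (h1 : 0 ≤ z.1) (h2 : 0 ≤ z.2) :
    0 ≤ bellman p q z := by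
  unfold bellman
  have : 0 ≤ p - 1 := by linarith
  positivity

/-- The exponents `p - 1` and `q - 1` are reciprocal, so `w ≥ x^{p-1}` gives `w^{q-1} ≥ x`. This
scaling relation controls the mixed terms of the Hessian. -/
theorem mul_rpow_sub_one_le {p q x w : ℝ} (hp : 2 ≤ p) (hpq : (p - 1) * (q - 1) = 1)
    (hx : 0 < x) (hw : x ^ (p - 1) ≤ w) : x * w ^ (1 - q) ≤ 1 := by
  have hw0 : 0 < w := lt_of_lt_of_le (Real.rpow_pos_of_pos hx _) hw
  have hq : 0 < q - 1 := by
    by_contra h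
    nlinarith
  have h1 : x ≤ w ^ (q - 1) := by
    calc x = (x ^ (p - 1)) ^ (q - 1) := by rw [← Real.rpow_mul hx.le, hpq, Real.rpow_one]
      _ ≤ w ^ (q - 1) := Real.rpow_le_rpow (by positivity) hw hq.le
  calc x * w ^ (1 - q) ≤ w ^ (q - 1) * w ^ (1 - q) := by gcongr
    _ = 1 := by rw [← Real.rpow_add hw0]; simp

-- The expression is the Hessian of `bellman + σ x y` in the direction `(a, b)`. The coefficients
-- `w^{2-q}` of `a²` and `y^{q-2}` of `b²` have product at least `1`, so together they dominate a
-- multiple of `|ab|`; this absorbs both the `σ` term and the mixed derivative. The negative term,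
-- from the second derivative of `w^{2-q}`, is absorbed by the pure powers, whose factor `10 (p -
-- 1)` is chosen for that.
set_option maxHeartbeats 1000000 in
theorem bellman_hessian_nonneg {p q x y a b σ : ℝ} (hp : 2 ≤ p) (hq2 : q ≤ 2)
    (hpq : (p - 1) * (q - 1) = 1) (hx : 0 < x) (hy : 0 < y) (hσ : |σ| ≤ 1) :
    0 ≤ 10 * (p - 1) * (p * (p - 1) * x ^ (p - 2)) * a ^ 2
      + 10 * (p - 1) * (q * (q - 1) * y ^ (q - 2)) * b ^ 2
      + 2 * a ^ 2 * (y + x ^ (p - 1)) ^ (2 - q)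
      + 4 * x * a * (2 - q) * (y + x ^ (p - 1)) ^ (1 - q) * (b + (p - 1) * x ^ (p - 2) * a)
      + x ^ 2 * (2 - q) * ((1 - q) * (y + x ^ (p - 1)) ^ (-q) *
          (b + (p - 1) * x ^ (p - 2) * a) ^ 2
        + (y + x ^ (p - 1)) ^ (1 - q) * ((p - 1) * (p - 2) * x ^ (p - 3)) * a ^ 2)
      + 2 * σ * a * b := by
  have hq1 : 0 < q - 1 := by
    by_contra h
    nlinarith
  set w := y + x ^ (p - 1) with hw
  have hxp : 0 < x ^ (p - 1) := Real.rpow_pos_of_pos hx _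
  have hw0 : 0 < w := by positivity
  have hxw : x ^ (p - 1) ≤ w := by linarith
  have hyw : y ≤ w := by linarith
  set T := x * w ^ (1 - q) with hT
  have hT1 : T ≤ 1 := mul_rpow_sub_one_le hp hpq hx hxw
  have hT0 : 0 < T := by positivity
  set X := x ^ (p - 2) with hX
  have hX0 : 0 < X := Real.rpow_pos_of_pos hx _
  have hXx : x * X = x ^ (p - 1) := by
    rw [hX, ← Real.rpow_one_add' hx.le (by linarith)]; congr 1; ring
  set U := w ^ (2 - q) with hU
  have hU0 : 0 < U := Real.rpow_pos_of_pos hw0 _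
  set V := y ^ (q - 2) with hV
  have hV0 : 0 < V := Real.rpow_pos_of_pos hy _
  have hWV : w ^ (q - 2) ≤ V := Real.rpow_le_rpow_of_nonpos hy hyw (by linarith)
  have hUW : U * w ^ (q - 2) = 1 := by rw [hU, ← Real.rpow_add hw0]; simp
  have hUV : 1 ≤ U * V := by rw [← hUW]; gcongr
  have hT2 : x ^ 2 * w ^ (-q) = T ^ 2 * w ^ (q - 2) := by
    rw [hT, mul_pow, mul_assoc, ← Real.rpow_natCast (w ^ (1 - q)), ← Real.rpow_mul hw0.le,
      ← Real.rpow_add hw0]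
    congr 2; push_cast; ring
  have hR1 : x ^ 2 * w ^ (-q) ≤ V := by
    rw [hT2]
    calc T ^ 2 * w ^ (q - 2) ≤ 1 * V := by
          gcongr
          exact pow_le_one₀ hT0.le hT1
      _ = V := one_mul V
  have hR2 : x ^ 2 * w ^ (-q) * X ^ 2 ≤ X := by
    have h1 : x * w ^ (-q) * x ^ (p - 1) ≤ 1 := by
      calc x * w ^ (-q) * x ^ (p - 1) ≤ x * w ^ (-q) * w := by gcongr
        _ = T := by
          rw [hT, mul_assoc, ← Real.rpow_add_one hw0.ne']; congr 2; ring
        _ ≤ 1 := hT1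
    calc x ^ 2 * w ^ (-q) * X ^ 2 = (x * w ^ (-q) * (x * X)) * X := by ring
      _ ≤ 1 * X := by rw [hXx]; gcongr
      _ = X := one_mul X
  have hR0 : 0 ≤ x ^ 2 * w ^ (-q) := by positivity
  set R := x ^ 2 * w ^ (-q) with hR
  have hZ : 0 ≤ x ^ 2 * (2 - q) * (w ^ (1 - q) * ((p - 1) * (p - 2) * x ^ (p - 3)) * a ^ 2) := by
    have : 0 ≤ 2 - q := by linarith
    have : 0 ≤ p - 1 := by linarith
    have : 0 ≤ p - 2 := by linarith
    positivity
  have e1 : 0 ≤ 4 * (2 - q) * T * ((p - 1) * X) * a ^ 2 := by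
    have : 0 ≤ 2 - q := by linarith
    have : 0 ≤ p - 1 := by linarith
    positivity
  have e2 : -(4 * |a * b|) ≤ 4 * (2 - q) * T * (a * b) := by
    have h1 : |(2 - q) * T| ≤ 1 := by
      rw [abs_of_nonneg (mul_nonneg (by linarith) hT0.le)]
      exact mul_le_one₀ (by linarith) hT0.le hT1
    have h2 : |(2 - q) * T * (a * b)| ≤ |a * b| := by
      rw [abs_mul]; exact mul_le_of_le_one_left (abs_nonneg _) h1
    linarith [neg_abs_le ((2 - q) * T * (a * b))]
  have e3 : -(2 * |a * b|) ≤ 2 * σ * a * b := by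
    have h2 : |σ * (a * b)| ≤ |a * b| := by
      rw [abs_mul]; exact mul_le_of_le_one_left (abs_nonneg _) hσ
    linarith [neg_abs_le (σ * (a * b))]
  have e4 : (2 - q) * (q - 1) * (R * (b + (p - 1) * X * a) ^ 2)
      ≤ 2 * V * b ^ 2 + 2 * (p - 1) ^ 2 * X * a ^ 2 := by
    have h0 : (2 - q) * (q - 1) ≤ 1 := by nlinarith
    have h1 : R * (b + (p - 1) * X * a) ^ 2 ≤ 2 * (R * b ^ 2) + 2 * (p - 1) ^ 2 * (R * X ^ 2) * a ^ 2 := by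
      have : 0 ≤ R * (b - (p - 1) * X * a) ^ 2 := by positivity
      nlinarith
    have h2 : R * b ^ 2 ≤ V * b ^ 2 := by gcongr
    have h3 : 2 * (p - 1) ^ 2 * (R * X ^ 2) * a ^ 2 ≤ 2 * (p - 1) ^ 2 * X * a ^ 2 := by gcongr
    calc _ ≤ 1 * (R * (b + (p - 1) * X * a) ^ 2) := by gcongr
      _ ≤ _ := by linarith
  -- After multiplication by `U` this is the square `(|a| U - 2|b|)² ≥ 0`, with `U V ≥ 1` used to
  -- compare the `b²` terms.
  have e5 : 8 * |a * b| ≤ 2 * a ^ 2 * U + 8 * V * b ^ 2 := by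
    have h1 : b ^ 2 ≤ U * V * b ^ 2 := le_mul_of_one_le_left (sq_nonneg b) hUV
    have h2 : U * (8 * |a * b|) ≤ U * (2 * a ^ 2 * U + 8 * V * b ^ 2) := by
      rw [abs_mul]
      have h3 : 0 ≤ 2 * (|a| * U - 2 * |b|) ^ 2 := by positivity
      have h4 : 2 * (|a| * U - 2 * |b|) ^ 2 = 2 * a ^ 2 * U ^ 2 + 8 * b ^ 2 - U * (8 * (|a| * |b|)) := by
        linear_combination (2 * U ^ 2) * sq_abs a + 8 * sq_abs b
      linarith
    exact le_of_mul_le_mul_left h2 hU0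
  -- The factor `p - 1` cancels `q - 1`. Of the resulting `10 V b²`, `e4` consumes `2` and `e5`
  -- consumes `8`.
  have e6 : 10 * V * b ^ 2 ≤ 10 * (p - 1) * (q * (q - 1) * V) * b ^ 2 := by
    have : 10 * (p - 1) * (q * (q - 1) * V) * b ^ 2 = q * (10 * V * b ^ 2) := by
      linear_combination (10 * q * V * b ^ 2) * hpq
    rw [this]
    exact le_mul_of_one_le_left (by positivity) (by linarith)
  have e7 : 2 * (p - 1) ^ 2 * X * a ^ 2 ≤ 10 * (p - 1) * (p * (p - 1) * X) * a ^ 2 := by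
    have : 10 * (p - 1) * (p * (p - 1) * X) * a ^ 2 = (5 * p) * (2 * (p - 1) ^ 2 * X * a ^ 2) := by
      ring
    rw [this]
    exact le_mul_of_one_le_left (by positivity) (by linarith)
  have key : 10 * (p - 1) * (p * (p - 1) * X) * a ^ 2
      + 10 * (p - 1) * (q * (q - 1) * V) * b ^ 2
      + 2 * a ^ 2 * U
      + 4 * x * a * (2 - q) * w ^ (1 - q) * (b + (p - 1) * X * a)
      + x ^ 2 * (2 - q) * ((1 - q) * w ^ (-q) * (b + (p - 1) * X * a) ^ 2
        + w ^ (1 - q) * ((p - 1) * (p - 2) * x ^ (p - 3)) * a ^ 2)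
      + 2 * σ * a * b
    = 10 * (p - 1) * (p * (p - 1) * X) * a ^ 2 + 10 * (p - 1) * (q * (q - 1) * V) * b ^ 2
      + 2 * a ^ 2 * U + (4 * (2 - q) * T * ((p - 1) * X) * a ^ 2 + 4 * (2 - q) * T * (a * b))
      - (2 - q) * (q - 1) * (R * (b + (p - 1) * X * a) ^ 2)
      + x ^ 2 * (2 - q) * (w ^ (1 - q) * ((p - 1) * (p - 2) * x ^ (p - 3)) * a ^ 2)
      + 2 * σ * a * b := by
    rw [hT, hR]; ring
  rw [key]
  linarith [abs_nonneg (a * b)]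

/-- With `M = max (x^{p-1}) y` one has `x ≤ M^{q-1}` and `w ≤ 2M`. Hence the mixed term is at most
`4 M^{2(q-1) + (2-q)} = 4 M^q`, and `M^q` is one of `x^p`, `y^q`. -/
theorem bellman_le {p q : ℝ} (hp : 2 ≤ p) (hq2 : q ≤ 2) (hpq : (p - 1) * (q - 1) = 1)
    {z : ℝ × ℝ} (h1 : 0 ≤ z.1) (h2 : 0 ≤ z.2) :
    bellman p q z ≤ (10 * (p - 1) + 4) * (z.1 ^ p + z.2 ^ q) := by
  obtain ⟨x, y⟩ := z
  simp only at h1 h2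
  have hq1 : 0 < q - 1 := by
    by_contra h
    nlinarith
  have hxp : 0 ≤ x ^ p := by positivity
  have hyq : 0 ≤ y ^ q := by positivity
  have hpq' : p = q * (p - 1) := by linear_combination -hpq
  set M := max (x ^ (p - 1)) y with hM
  have hM0 : 0 ≤ M := le_max_of_le_right h2
  have hMq : M ^ q ≤ x ^ p + y ^ q := by
    rcases max_choice (x ^ (p - 1)) y with h | h
    · rw [hM, h, ← Real.rpow_mul h1, mul_comm, ← hpq']; linarith
    · rw [hM, h]; linarith
  have hxM : x ≤ M ^ (q - 1) := by
    calc x = (x ^ (p - 1)) ^ (q - 1) := by rw [← Real.rpow_mul h1, hpq, Real.rpow_one]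
      _ ≤ M ^ (q - 1) := Real.rpow_le_rpow (by positivity) (le_max_left _ _) hq1.le
  have hw : y + x ^ (p - 1) ≤ 2 * M := by
    linarith [le_max_left (x ^ (p - 1)) y, le_max_right (x ^ (p - 1)) y]
  have h3 : (y + x ^ (p - 1)) ^ (2 - q) ≤ 4 * M ^ (2 - q) := by
    calc (y + x ^ (p - 1)) ^ (2 - q) ≤ (2 * M) ^ (2 - q) :=
          Real.rpow_le_rpow (by positivity) hw (by linarith)
      _ = 2 ^ (2 - q) * M ^ (2 - q) := Real.mul_rpow (by norm_num) hM0
      _ ≤ 2 ^ (2 : ℝ) * M ^ (2 - q) := by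
          gcongr
          · norm_num
          · linarith
      _ = 4 * M ^ (2 - q) := by norm_num
  have h4 : x ^ 2 * (y + x ^ (p - 1)) ^ (2 - q) ≤ 4 * M ^ q := by
    rcases hM0.eq_or_lt with h0 | h0
    · have hx0 : x ≤ 0 := by
        rw [← h0, Real.zero_rpow hq1.ne'] at hxM; exact hxM
      have : x = 0 := le_antisymm hx0 h1
      subst this
      have : 0 ≤ M ^ q := by positivity
      simp; positivity
    calc x ^ 2 * (y + x ^ (p - 1)) ^ (2 - q) ≤ (M ^ (q - 1)) ^ 2 * (4 * M ^ (2 - q)) := by gcongr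
      _ = 4 * (M ^ (q - 1) * M ^ (q - 1) * M ^ (2 - q)) := by ring
      _ = 4 * M ^ q := by
        rw [← Real.rpow_add h0, ← Real.rpow_add h0]; congr 2; ring
  simp only [bellman]
  linarith

theorem hasDerivAt_rpow_affine {x a r t : ℝ} (h : 0 < x + t * a) :
    HasDerivAt (fun t ↦ (x + t * a) ^ r) (r * (x + t * a) ^ (r - 1) * a) t := by
  have h1 : HasDerivAt (fun t : ℝ ↦ x + t * a) a t := by
    simpa using ((hasDerivAt_id t).mul_const a).const_add x
  convert h1.rpow_const (p := r) (Or.inl h.ne') using 1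
  ring

-- Convexity is tested along segments, where the second derivative is the quadratic form of
-- `bellman_hessian_nonneg`. The segment must stay in the open quadrant, since some of the powers
-- are singular on the axes.
set_option maxHeartbeats 1000000 in
theorem convexOn_bellman_line {p q x y a b σ : ℝ} (hp : 2 ≤ p) (hq2 : q ≤ 2)
    (hpq : (p - 1) * (q - 1) = 1) (hσ : |σ| ≤ 1)
    (hx : ∀ t ∈ Set.Icc (0 : ℝ) 1, 0 < x + t * a) (hy : ∀ t ∈ Set.Icc (0 : ℝ) 1, 0 < y + t * b) :
    ConvexOn ℝ (Set.Icc (0 : ℝ) 1) fun t ↦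
      bellman p q (x + t * a, y + t * b) + σ * ((x + t * a) * (y + t * b)) := by
  have hq1 : 0 < q - 1 := by
    by_contra h
    nlinarith
  have hd : ∀ t : ℝ, HasDerivAt (fun t : ℝ ↦ x + t * a) a t := fun t ↦ by
    simpa using ((hasDerivAt_id t).mul_const a).const_add x
  have hd' : ∀ t : ℝ, HasDerivAt (fun t : ℝ ↦ y + t * b) b t := fun t ↦ by
    simpa using ((hasDerivAt_id t).mul_const b).const_add y
  have hw : ∀ t ∈ Set.Icc (0 : ℝ) 1, ∀ r : ℝ,
      HasDerivAt (fun t ↦ (y + t * b + (x + t * a) ^ (p - 1)) ^ r)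
        (r * (y + t * b + (x + t * a) ^ (p - 1)) ^ (r - 1) *
          (b + (p - 1) * (x + t * a) ^ (p - 2) * a)) t := fun t ht r ↦ by
    have h0 : 0 < y + t * b + (x + t * a) ^ (p - 1) := by
      have := hx t ht
      have := hy t ht
      positivity
    convert ((hd' t).fun_add (hasDerivAt_rpow_affine (r := p - 1) (hx t ht))).rpow_const (p := r)
      (Or.inl h0.ne') using 1
    rw [show p - 1 - 1 = p - 2 by ring]
    ring
  have hI : interior (Set.Icc (0 : ℝ) 1) ⊆ Set.Icc 0 1 := interior_subset
  refine convexOn_of_hasDerivWithinAt2_nonneg (convex_Icc 0 1)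
    (f' := fun t ↦ 10 * (p - 1) * (p * (x + t * a) ^ (p - 1) * a)
      + 10 * (p - 1) * (q * (y + t * b) ^ (q - 1) * b)
      + (2 * (x + t * a) * a * (y + t * b + (x + t * a) ^ (p - 1)) ^ (2 - q)
        + (x + t * a) ^ 2 * ((2 - q) * (y + t * b + (x + t * a) ^ (p - 1)) ^ (1 - q) *
          (b + (p - 1) * (x + t * a) ^ (p - 2) * a)))
      + σ * (a * (y + t * b) + (x + t * a) * b))
    (f'' := fun t ↦ 10 * (p - 1) * (p * (p - 1) * (x + t * a) ^ (p - 2)) * a ^ 2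
      + 10 * (p - 1) * (q * (q - 1) * (y + t * b) ^ (q - 2)) * b ^ 2
      + 2 * a ^ 2 * (y + t * b + (x + t * a) ^ (p - 1)) ^ (2 - q)
      + 4 * (x + t * a) * a * (2 - q) * (y + t * b + (x + t * a) ^ (p - 1)) ^ (1 - q)
        * (b + (p - 1) * (x + t * a) ^ (p - 2) * a)
      + (x + t * a) ^ 2 * (2 - q) * ((1 - q) * (y + t * b + (x + t * a) ^ (p - 1)) ^ (-q) *
          (b + (p - 1) * (x + t * a) ^ (p - 2) * a) ^ 2
        + (y + t * b + (x + t * a) ^ (p - 1)) ^ (1 - q)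
          * ((p - 1) * (p - 2) * (x + t * a) ^ (p - 3)) * a ^ 2)
      + 2 * σ * a * b) ?_ ?_ ?_ ?_
  · have := continuous_bellman hp (by linarith) hq2
    fun_prop
  · intro t ht
    have ht := hI ht
    refine HasDerivAt.hasDerivWithinAt ?_
    convert ((((hasDerivAt_rpow_affine (r := p) (hx t ht)).const_mul (10 * (p - 1))).add
      ((hasDerivAt_rpow_affine (r := q) (hy t ht)).const_mul (10 * (p - 1)))).add
      (((hd t).pow 2).mul (hw t ht (2 - q)))).add (((hd t).mul (hd' t)).const_mul σ) using 1
    · rfl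
    rw [show 2 - q - 1 = 1 - q by ring]
    simp only [Pi.pow_apply]
    push_cast
    ring
  · intro t ht
    have ht := hI ht
    refine HasDerivAt.hasDerivWithinAt ?_
    have h1 := (((hasDerivAt_rpow_affine (r := p - 1) (hx t ht)).const_mul p).mul_const a).const_mul
      (10 * (p - 1))
    have h2 := (((hasDerivAt_rpow_affine (r := q - 1) (hy t ht)).const_mul q).mul_const b).const_mul
      (10 * (p - 1))
    have h3 := ((((hd t).const_mul 2).mul_const a)).mul (hw t ht (2 - q))
    have h4 := ((((hasDerivAt_rpow_affine (r := p - 2) (hx t ht)).const_mul (p - 1)).mul_const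
      a).const_add b)
    have h5 := ((hd t).pow 2).mul (((hw t ht (1 - q)).const_mul (2 - q)).mul h4)
    have h6 := ((((hd' t).const_mul a)).add ((hd t).mul_const b)).const_mul σ
    convert ((h1.add h2).add (h3.add h5)).add h6 using 1
    · rfl
    rw [show 2 - q - 1 = 1 - q by ring, show 1 - q - 1 = -q by ring,
      show p - 1 - 1 = p - 2 by ring, show q - 1 - 1 = q - 2 by ring,
      show p - 2 - 1 = p - 3 by ring]
    simp only [Pi.pow_apply, Pi.mul_apply]
    push_cast
    ring
  · intro t ht
    have ht := hI ht
    exact bellman_hessian_nonneg hp hq2 hpq (hx t ht) (hy t ht) hσ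

/-- `B ± xy` is convex on the closed quadrant. -/
theorem convexOn_bellman {p q σ : ℝ} (hp : 2 ≤ p) (hq2 : q ≤ 2)
    (hpq : (p - 1) * (q - 1) = 1) (hσ : |σ| ≤ 1) :
    ConvexOn ℝ (Set.Ici (0 : ℝ) ×ˢ Set.Ici (0 : ℝ)) fun z ↦ bellman p q z + σ * (z.1 * z.2) := by
  have hq1 : 0 < q - 1 := by
    by_contra h
    nlinarith
  set F : ℝ × ℝ → ℝ := fun z ↦ bellman p q z + σ * (z.1 * z.2) with hF
  have hFc : Continuous F := by
    have := continuous_bellman hp (by linarith) hq2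
    fun_prop
  have key : ∀ z z' : ℝ × ℝ, 0 < z.1 → 0 < z.2 → 0 < z'.1 → 0 < z'.2 → ∀ a b : ℝ, 0 ≤ a → 0 ≤ b →
      a + b = 1 → F (a • z + b • z') ≤ a • F z + b • F z' := by
    intro z z' h1 h2 h3 h4 a b ha hb hab
    have hpos : ∀ u v : ℝ, 0 < u → 0 < v → ∀ t ∈ Set.Icc (0 : ℝ) 1, 0 < u + t * (v - u) := by
      intro u v hu hv t ht
      have h : u + t * (v - u) = (1 - t) * u + t * v := by ring
      rw [h]
      rcases ht.1.eq_or_lt with h0 | h0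
      · simp [← h0, hu]
      · have : 0 ≤ (1 - t) * u := mul_nonneg (by linarith [ht.2]) hu.le
        positivity
    have h := (convexOn_bellman_line hp hq2 hpq hσ (hpos z.1 z'.1 h1 h3)
      (hpos z.2 z'.2 h2 h4)).2 (Set.left_mem_Icc.2 zero_le_one)
      (Set.right_mem_Icc.2 zero_le_one) ha hb hab
    obtain rfl : a = 1 - b := by linarith
    simp only [smul_eq_mul, mul_zero, zero_add, mul_one, zero_mul, add_zero, one_mul,
      add_sub_cancel] at h
    simp only [hF, smul_eq_mul, Prod.fst_add, Prod.snd_add, Prod.smul_fst, Prod.smul_snd]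
    have e1 : (1 - b) * z.1 + b * z'.1 = z.1 + b * (z'.1 - z.1) := by ring
    have e2 : (1 - b) * z.2 + b * z'.2 = z.2 + b * (z'.2 - z.2) := by ring
    have e3 : (1 - b) • z + b • z' = (z.1 + b * (z'.1 - z.1), z.2 + b * (z'.2 - z.2)) := by
      ext <;> simp [e1, e2]
    rw [e1, e2, e3]
    exact h
  refine ⟨(convex_Ici 0).prod (convex_Ici 0), ?_⟩
  intro z hz z' hz' a b ha hb hab
  -- The axes are reached by continuity, after shifting both endpoints by `(ε, ε)` into the open
  -- quadrant.
  have hl : Filter.Tendsto (fun ε : ℝ ↦ F (a • (z + (ε, ε)) + b • (z' + (ε, ε))))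
      (nhdsWithin 0 (Set.Ioi 0)) (nhds (F (a • z + b • z'))) := by
    have : Continuous fun ε : ℝ ↦ F (a • (z + (ε, ε)) + b • (z' + (ε, ε))) := by fun_prop
    have h := this.tendsto 0
    simp only [Prod.mk_zero_zero, add_zero] at h
    exact h.mono_left nhdsWithin_le_nhds
  have hr : Filter.Tendsto (fun ε : ℝ ↦ a • F (z + (ε, ε)) + b • F (z' + (ε, ε)))
      (nhdsWithin 0 (Set.Ioi 0)) (nhds (a • F z + b • F z')) := by
    have : Continuous fun ε : ℝ ↦ a • F (z + (ε, ε)) + b • F (z' + (ε, ε)) := by fun_prop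
    have h := this.tendsto 0
    simp only [Prod.mk_zero_zero, add_zero] at h
    exact h.mono_left nhdsWithin_le_nhds
  refine le_of_tendsto_of_tendsto hl hr ?_
  filter_upwards [self_mem_nhdsWithin] with ε hε
  have hε : 0 < ε := hε
  have h1 : 0 ≤ z.1 := hz.1
  have h2 : 0 ≤ z.2 := hz.2
  have h3 : 0 ≤ z'.1 := hz'.1
  have h4 : 0 ≤ z'.2 := hz'.2
  exact key _ _ (by simp; linarith) (by simp; linarith) (by simp; linarith) (by simp; linarith)
    a b ha hb hab

/-! ### Averages of translates and the monotonicity of Bellman integrals. -/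

section Averaging

variable {E : Type*} [NormedAddCommGroup E] [InnerProductSpace ℝ E] [FiniteDimensional ℝ E]
  [MeasurableSpace E] [BorelSpace E]

/-- The average `x ↦ ∫ u(x + y) dγ(y)` of the translates of `u`. -/
noncomputable def avg {F : Type*} [NormedAddCommGroup F] [NormedSpace ℝ F] (γ : Measure E)
    (u : E → F) (x : E) : F :=
  ∫ y, u (x + y) ∂γ

/-- Nonnegative, bounded, continuous and integrable functions. -/
structure IsDensity (u : E → ℝ) : Prop where
  cont : Continuous u
  nonneg : ∀ x, 0 ≤ u x
  bdd : ∃ M, ∀ x, u x ≤ M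
  integrable : Integrable u

theorem integrable_translate {F : Type*} [NormedAddCommGroup F] [NormedSpace ℝ F] (γ : Measure E)
    [IsProbabilityMeasure γ] {u : E → F} (hu : Continuous u) {M : ℝ} (hM : ∀ x, ‖u x‖ ≤ M) (x : E) :
    Integrable (fun y ↦ u (x + y)) γ := by
  refine Integrable.of_bound (C := M) ?_ (.of_forall fun y ↦ hM _)
  exact (by fun_prop : Continuous fun y ↦ u (x + y)).aestronglyMeasurable

theorem continuous_avg {F : Type*} [NormedAddCommGroup F] [NormedSpace ℝ F] (γ : Measure E)
    [IsProbabilityMeasure γ] {u : E → F} (hu : Continuous u) {M : ℝ} (hM : ∀ x, ‖u x‖ ≤ M) :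
    Continuous (avg γ u) := by
  refine continuous_of_dominated (bound := fun _ ↦ M) (fun x ↦ ?_) (fun x ↦ .of_forall fun y ↦ hM _)
    (integrable_const M) (.of_forall fun y ↦ by fun_prop)
  exact (by fun_prop : Continuous fun y ↦ u (x + y)).aestronglyMeasurable

theorem integrable_prod_translate {F : Type*} [NormedAddCommGroup F] [NormedSpace ℝ F]
    (γ : Measure E) [IsProbabilityMeasure γ] {u : E → F} (hu : Continuous u)
    (hi : Integrable u) :
    Integrable (fun z : E × E ↦ u (z.1 + z.2)) ((volume : Measure E).prod γ) := by
  have hm : AEStronglyMeasurable (fun z : E × E ↦ u (z.1 + z.2)) ((volume : Measure E).prod γ) :=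
    (by fun_prop : Continuous fun z : E × E ↦ u (z.1 + z.2)).aestronglyMeasurable
  rw [integrable_prod_iff' hm]
  refine ⟨.of_forall fun y ↦ hi.comp_add_right y, ?_⟩
  have : (fun y : E ↦ ∫ x, ‖u ((x, y).1 + (x, y).2)‖) = fun _ ↦ ∫ x, ‖u x‖ := by
    ext y
    exact integral_add_right_eq_self (fun x ↦ ‖u x‖) y
  rw [this]
  exact integrable_const _

theorem integrable_avg {F : Type*} [NormedAddCommGroup F] [NormedSpace ℝ F] (γ : Measure E)
    [IsProbabilityMeasure γ] {u : E → F} (hu : Continuous u) (hi : Integrable u) :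
    Integrable (avg γ u) :=
  (integrable_prod_translate γ hu hi).integral_prod_left

theorem integral_avg {F : Type*} [NormedAddCommGroup F] [NormedSpace ℝ F] [CompleteSpace F] (γ : Measure E)
    [IsProbabilityMeasure γ] {u : E → F} (hu : Continuous u) (hi : Integrable u) :
    ∫ x, avg γ u x = ∫ x, u x := by
  unfold avg
  rw [integral_integral_swap (integrable_prod_translate γ hu hi)]
  have : (fun y : E ↦ ∫ x, u (x + y)) = fun _ ↦ ∫ x, u x := by
    ext y
    exact integral_add_right_eq_self u y
  rw [this]
  simp

theorem IsDensity.norm_le {u : E → ℝ} (hu : IsDensity u) : ∃ M, ∀ x, ‖u x‖ ≤ M := by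
  obtain ⟨M, hM⟩ := hu.bdd
  exact ⟨M, fun x ↦ by rw [Real.norm_of_nonneg (hu.nonneg x)]; exact hM x⟩

theorem IsDensity.avg {u : E → ℝ} (hu : IsDensity u) (γ : Measure E) [IsProbabilityMeasure γ] :
    IsDensity (avg γ u) := by
  obtain ⟨M, hM⟩ := hu.norm_le
  refine ⟨continuous_avg γ hu.cont hM, fun x ↦ integral_nonneg fun y ↦ hu.nonneg _,
    ⟨M, fun x ↦ ?_⟩, integrable_avg γ hu.cont hu.integrable⟩
  calc _ ≤ ∫ y, M ∂γ := integral_mono (integrable_translate γ hu.cont hM x) (integrable_const M)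
        fun y ↦ (le_abs_self _).trans (hM _)
    _ = M := by simp

theorem IsDensity.integrable_rpow {u : E → ℝ} (hu : IsDensity u) {p : ℝ} (hp : 1 ≤ p) :
    Integrable fun x ↦ u x ^ p := by
  obtain ⟨M, hM⟩ := hu.bdd
  have hc : Continuous fun x ↦ u x ^ p := hu.cont.rpow_const fun _ ↦ Or.inr (by linarith)
  refine (hu.integrable.const_mul (M ^ (p - 1))).mono' hc.aestronglyMeasurable
    (.of_forall fun x ↦ ?_)
  have h0 := hu.nonneg x
  rw [Real.norm_of_nonneg (by positivity)]
  rcases h0.eq_or_lt with h | h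
  · rw [← h, Real.zero_rpow (by linarith)]; simp
  calc u x ^ p = u x ^ (p - 1) * u x := by rw [← Real.rpow_add_one h.ne']; simp
    _ ≤ M ^ (p - 1) * u x := by
      gcongr
      exact hM x

theorem IsDensity.integrable_mul {u v : E → ℝ} (hu : IsDensity u) (hv : IsDensity v) :
    Integrable fun x ↦ u x * v x := by
  obtain ⟨M, hM⟩ := hu.norm_le
  exact hv.integrable.bdd_mul hu.cont.aestronglyMeasurable (.of_forall hM)

theorem IsDensity.integrable_bellman {u v : E → ℝ} (hu : IsDensity u) (hv : IsDensity v)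
    {p q : ℝ} (hp : 2 ≤ p) (hq : 1 < q) (hq2 : q ≤ 2) (hpq : (p - 1) * (q - 1) = 1) :
    Integrable fun x ↦ bellman p q (u x, v x) := by
  refine (((hu.integrable_rpow (p := p) (by linarith)).add
    (hv.integrable_rpow (p := q) hq.le)).const_mul (10 * (p - 1) + 4)).mono' ?_
    (.of_forall fun x ↦ ?_)
  · exact ((continuous_bellman hp hq hq2).comp (hu.cont.prodMk hv.cont)).aestronglyMeasurable
  · rw [Real.norm_of_nonneg (bellman_nonneg hp (hu.nonneg x) (hv.nonneg x))]
    exact bellman_le hp hq2 hpq (hu.nonneg x) (hv.nonneg x)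

/-- Averaging does not increase the integral of a Bellman function. -/
theorem integral_bellman_avg_le {u v : E → ℝ} (hu : IsDensity u) (hv : IsDensity v)
    (γ : Measure E) [IsProbabilityMeasure γ] {p q σ : ℝ} (hp : 2 ≤ p) (hq : 1 < q) (hq2 : q ≤ 2)
    (hpq : (p - 1) * (q - 1) = 1) (hσ : |σ| ≤ 1) :
    ∫ x, (bellman p q (avg γ u x, avg γ v x) + σ * (avg γ u x * avg γ v x))
      ≤ ∫ x, (bellman p q (u x, v x) + σ * (u x * v x)) := by
  set F : ℝ × ℝ → ℝ := fun z ↦ bellman p q z + σ * (z.1 * z.2) with hF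
  have hFc : Continuous F := by
    have := continuous_bellman hp hq hq2
    fun_prop
  have hconv := convexOn_bellman (σ := σ) hp hq2 hpq hσ
  obtain ⟨M, hM⟩ := hu.norm_le
  obtain ⟨M', hM'⟩ := hv.norm_le
  have hGc : Continuous fun x ↦ F (u x, v x) := hFc.comp (hu.cont.prodMk hv.cont)
  have hGi : Integrable fun x ↦ F (u x, v x) :=
    (hu.integrable_bellman hv hp hq hq2 hpq).add ((hu.integrable_mul hv).const_mul σ)
  have hGb : ∃ K, ∀ x, ‖F (u x, v x)‖ ≤ K := by
    obtain ⟨K, hK⟩ := ((isCompact_Icc (a := -M) (b := M)).prod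
      (isCompact_Icc (a := -M') (b := M'))).exists_bound_of_continuousOn hFc.continuousOn
    exact ⟨K, fun x ↦ hK _ ⟨abs_le.1 (hM x), abs_le.1 (hM' x)⟩⟩
  obtain ⟨K, hK⟩ := hGb
  -- Averaging preserves integrals, so a pointwise comparison suffices; it is Jensen's inequality
  -- for the pair `(u, v)`.
  rw [← integral_avg γ hGc hGi]
  refine integral_mono ?_ (integrable_avg γ hGc hGi) fun x ↦ ?_
  · exact ((hu.avg γ).integrable_bellman (hv.avg γ) hp hq hq2 hpq).add
      (((hu.avg γ).integrable_mul (hv.avg γ)).const_mul σ)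
  · have h1 := integrable_translate γ hu.cont hM x
    have h2 := integrable_translate γ hv.cont hM' x
    have h := hconv.map_integral_le (μ := γ) (f := fun y ↦ (u (x + y), v (x + y)))
      hFc.continuousOn (isClosed_Ici.prod isClosed_Ici)
      (.of_forall fun y ↦ ⟨hu.nonneg _, hv.nonneg _⟩) (h1.prodMk h2)
      (integrable_translate γ hGc hK x)
    rw [integral_pair h1 h2] at h
    exact h

/-- Using the convexity of both `B + xy` and `B - xy` produces the absolute value. -/
theorem abs_integral_mul_sub_avg_le {u v : E → ℝ} (hu : IsDensity u) (hv : IsDensity v)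
    (γ : Measure E) [IsProbabilityMeasure γ] {p q : ℝ} (hp : 2 ≤ p) (hq : 1 < q) (hq2 : q ≤ 2)
    (hpq : (p - 1) * (q - 1) = 1) :
    |(∫ x, u x * v x) - ∫ x, avg γ u x * avg γ v x|
      ≤ (∫ x, bellman p q (u x, v x)) - ∫ x, bellman p q (avg γ u x, avg γ v x) := by
  have h : ∀ σ : ℝ, |σ| ≤ 1 →
      (∫ x, bellman p q (avg γ u x, avg γ v x)) + σ * ∫ x, avg γ u x * avg γ v x
        ≤ (∫ x, bellman p q (u x, v x)) + σ * ∫ x, u x * v x := by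
    intro σ hσ
    have h := integral_bellman_avg_le hu hv γ hp hq hq2 hpq hσ
    rw [integral_add (hu.integrable_bellman hv hp hq hq2 hpq)
      ((hu.integrable_mul hv).const_mul σ), integral_add
      ((hu.avg γ).integrable_bellman (hv.avg γ) hp hq hq2 hpq)
      (((hu.avg γ).integrable_mul (hv.avg γ)).const_mul σ), integral_const_mul,
      integral_const_mul] at h
    exact h
  have h1 := h 1 (by simp)
  have h2 := h (-1) (by simp)
  rw [abs_le]
  constructor <;> linarith

variable (E) in
/-- The Gaussian measure with characteristic function `exp(-t|ξ|²)`. -/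
noncomputable def heatMeasure (t : ℝ) : Measure E :=
  (ProbabilityTheory.stdGaussian E).map fun x ↦ √(2 * t) • x

instance (t : ℝ) : IsProbabilityMeasure (heatMeasure E t) :=
  Measure.isProbabilityMeasure_map (by fun_prop)

theorem charFun_heatMeasure {t : ℝ} (ht : 0 ≤ t) (ξ : E) :
    charFun (heatMeasure E t) ξ = Complex.exp (-(t * ‖ξ‖ ^ 2 : ℝ)) := by
  rw [heatMeasure, charFun_map_smul, ProbabilityTheory.charFun_stdGaussian]
  congr 1
  rw [norm_smul, Real.norm_of_nonneg (Real.sqrt_nonneg _)]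
  have : (√(2 * t)) ^ 2 = 2 * t := Real.sq_sqrt (by positivity)
  rw [Complex.ofReal_mul, mul_pow, ← Complex.ofReal_pow (√(2 * t)), this]
  push_cast
  ring

theorem heatMeasure_conv {s t : ℝ} (hs : 0 ≤ s) (ht : 0 ≤ t) :
    heatMeasure E s ∗ heatMeasure E t = heatMeasure E (s + t) := by
  refine Measure.ext_of_charFun (funext fun ξ ↦ ?_)
  rw [charFun_conv, charFun_heatMeasure hs, charFun_heatMeasure ht,
    charFun_heatMeasure (add_nonneg hs ht), ← Complex.exp_add]
  congr 1
  push_cast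
  ring

theorem avg_heatMeasure_avg {F : Type*} [NormedAddCommGroup F] [NormedSpace ℝ F]
    {s t : ℝ} (hs : 0 ≤ s) (ht : 0 ≤ t) {u : E → F} (hu : Continuous u) {M : ℝ}
    (hM : ∀ x, ‖u x‖ ≤ M) :
    avg (heatMeasure E s) (avg (heatMeasure E t) u) = avg (heatMeasure E (s + t)) u := by
  ext x
  unfold avg
  rw [← heatMeasure_conv hs ht, integral_conv (integrable_translate _ hu hM x)]
  simp only [add_assoc]

/-- The bilinear variation of the heat flow is controlled by a Bellman function. -/
theorem exists_heat_variation_density {u v : E → ℝ} (hu : IsDensity u) (hv : IsDensity v)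
    {p q : ℝ} (hp : 2 ≤ p) (hq : 1 < q) (hq2 : q ≤ 2) (hpq : (p - 1) * (q - 1) = 1) :
    ∃ ψ : ℝ → ℝ, (∀ t, 0 ≤ t → 0 ≤ ψ t) ∧
      ψ 0 ≤ (10 * (p - 1) + 4) * ((∫ x, u x ^ p) + ∫ x, v x ^ q) ∧
      ∀ s t, 0 ≤ s → s ≤ t →
        |(∫ x, avg (heatMeasure E s) u x * avg (heatMeasure E s) v x)
          - ∫ x, avg (heatMeasure E t) u x * avg (heatMeasure E t) v x| ≤ ψ s - ψ t := by
  obtain ⟨M, hM⟩ := hu.norm_le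
  obtain ⟨M', hM'⟩ := hv.norm_le
  refine ⟨fun t ↦ ∫ x, bellman p q (avg (heatMeasure E t) u x, avg (heatMeasure E t) v x),
    fun t _ ↦ integral_nonneg fun x ↦ bellman_nonneg hp ((hu.avg _).nonneg x)
      ((hv.avg _).nonneg x), ?_, fun s t hs hst ↦ ?_⟩
  · have h0 : ∀ w : E → ℝ, IsDensity w → avg (heatMeasure E 0) w = w := by
      intro w hw
      ext x
      have : heatMeasure E 0 = Measure.dirac 0 := by
        simp [heatMeasure, Measure.map_const]
      simp [avg, this]
    simp only [h0 u hu, h0 v hv]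
    rw [← integral_add (hu.integrable_rpow (by linarith)) (hv.integrable_rpow hq.le),
      ← integral_const_mul]
    refine integral_mono (hu.integrable_bellman hv hp hq hq2 hpq) ?_ fun x ↦
      bellman_le hp hq2 hpq (hu.nonneg x) (hv.nonneg x)
    exact ((hu.integrable_rpow (by linarith)).add (hv.integrable_rpow hq.le)).const_mul _
  · have h := abs_integral_mul_sub_avg_le (hu.avg (heatMeasure E s)) (hv.avg (heatMeasure E s))
      (heatMeasure E (t - s)) hp hq hq2 hpq
    rw [avg_heatMeasure_avg (by linarith) hs hu.cont hM,
      avg_heatMeasure_avg (by linarith) hs hv.cont hM', sub_add_cancel] at h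
    exact h

end Averaging

/-! ### Total variation in time and the decay of the Gamma function. -/

/-- The difference quotients of `φ` with step `ε` are dominated by those of the decreasing function
`ψ`. Their integrals telescope to at most `ε⁻¹ ∫_0^ε ψ ≤ ψ 0`, and Fatou's lemma passes to the
derivative. No differentiability of `ψ` is needed. -/
theorem setLIntegral_enorm_deriv_le {φ φ' : ℝ → ℂ} {ψ : ℝ → ℝ}
    (hd : ∀ t, 0 < t → HasDerivAt φ (φ' t) t) (hψ : ∀ t, 0 ≤ t → 0 ≤ ψ t)
    (h : ∀ s t, 0 ≤ s → s ≤ t → ‖φ s - φ t‖ ≤ ψ s - ψ t) :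
    ∫⁻ t in Set.Ioi (0 : ℝ), ‖φ' t‖ₑ ≤ ENNReal.ofReal (ψ 0) := by
  have hanti : AntitoneOn ψ (Set.Ici 0) := fun s hs t _ hst ↦ by
    linarith [h s t hs hst, norm_nonneg (φ s - φ t)]
  have hint : ∀ a b : ℝ, 0 ≤ a → 0 ≤ b → IntervalIntegrable ψ volume a b := fun a b ha hb ↦
    (hanti.mono fun x hx ↦ le_trans (le_min ha hb) hx.1).intervalIntegrable
  set ε : ℕ → ℝ := fun k ↦ 1 / ((k : ℝ) + 1) with hε
  have hε0 : ∀ k, 0 < ε k := fun k ↦ Nat.one_div_pos_of_nat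
  have hφc : ContinuousOn φ (Set.Ioi 0) := fun t ht ↦ (hd t ht).continuousAt.continuousWithinAt
  have hlim : ∀ t ∈ Set.Ioi (0 : ℝ), Filter.Tendsto
      (fun k ↦ ‖(ε k)⁻¹ • (φ (t + ε k) - φ t)‖ₑ) Filter.atTop (nhds ‖φ' t‖ₑ) := by
    intro t ht
    have h1 := (hd t ht).tendsto_slope_zero
    have h2 : Filter.Tendsto ε Filter.atTop (nhdsWithin 0 {0}ᶜ) :=
      tendsto_nhdsWithin_iff.2 ⟨tendsto_one_div_add_atTop_nhds_zero_nat,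
        .of_forall fun k ↦ (hε0 k).ne'⟩
    exact (h1.comp h2).enorm
  have hbound : ∀ k, ∫⁻ t in Set.Ioi (0 : ℝ), ‖(ε k)⁻¹ • (φ (t + ε k) - φ t)‖ₑ
      ≤ ENNReal.ofReal (ψ 0) := by
    intro k
    have hU : Set.Ioi (0 : ℝ) = ⋃ N : ℕ, Set.Ioc (0 : ℝ) N := by
      ext t
      simp only [Set.mem_Ioi, Set.mem_iUnion, Set.mem_Ioc, exists_and_left, iff_self_and]
      exact fun _ ↦ exists_nat_ge t
    rw [hU, setLIntegral_iUnion_of_directed]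
    swap
    · exact Monotone.directed_le fun a b hab ↦ Set.Ioc_subset_Ioc_right (by exact_mod_cast hab)
    refine iSup_le fun N ↦ ?_
    have hN : (0 : ℝ) ≤ N := Nat.cast_nonneg N
    have hi : IntervalIntegrable (fun t ↦ (ε k)⁻¹ * (ψ t - ψ (t + ε k))) volume 0 N := by
      refine ((hint 0 N le_rfl hN).sub ?_).const_mul _
      simpa using (hint (0 + ε k) (N + ε k) (by linarith [hε0 k])
        (by linarith [hε0 k])).comp_add_right (ε k)
    calc ∫⁻ t in Set.Ioc (0 : ℝ) N, ‖(ε k)⁻¹ • (φ (t + ε k) - φ t)‖ₑ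
        ≤ ∫⁻ t in Set.Ioc (0 : ℝ) N, ENNReal.ofReal ((ε k)⁻¹ * (ψ t - ψ (t + ε k))) := by
          refine setLIntegral_mono' measurableSet_Ioc fun t ht ↦ ?_
          rw [← ofReal_norm, norm_smul, norm_sub_rev, norm_inv,
            Real.norm_of_nonneg (hε0 k).le]
          refine ENNReal.ofReal_le_ofReal ?_
          have := inv_pos.2 (hε0 k)
          gcongr
          exact h _ _ ht.1.le (by linarith [hε0 k])
      _ = ENNReal.ofReal (∫ t in (0 : ℝ)..N, (ε k)⁻¹ * (ψ t - ψ (t + ε k))) := by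
          rw [intervalIntegral.integral_of_le hN, ofReal_integral_eq_lintegral_ofReal]
          · exact (intervalIntegrable_iff_integrableOn_Ioc_of_le hN).1 hi
          · refine (ae_restrict_iff' measurableSet_Ioc).2 (.of_forall fun t ht ↦ ?_)
            have h1 : ψ (t + ε k) ≤ ψ t :=
              hanti ht.1.le (Set.mem_Ici.2 (by linarith [hε0 k, ht.1])) (by linarith [hε0 k])
            have := inv_pos.2 (hε0 k)
            exact mul_nonneg this.le (sub_nonneg.2 h1)
      _ ≤ ENNReal.ofReal (ψ 0) := by
          refine ENNReal.ofReal_le_ofReal ?_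
          have e1 : ∫ t in (0 : ℝ)..N, ψ (t + ε k) = ∫ t in (ε k)..(N + ε k), ψ t := by
            simp [intervalIntegral.integral_comp_add_right]
          have e2 : IntervalIntegrable (fun t ↦ ψ (t + ε k)) volume 0 N := by
            simpa using (hint (0 + ε k) (N + ε k) (by linarith [hε0 k])
              (by linarith [hε0 k])).comp_add_right (ε k)
          rw [intervalIntegral.integral_const_mul, intervalIntegral.integral_sub
            (hint 0 N le_rfl hN) e2, e1]
          -- Both sides are the integral over `(0, N + ε)`; this is the telescoping.
          have e3 : (∫ t in (0 : ℝ)..N, ψ t) + ∫ t in (N : ℝ)..(N + ε k), ψ t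
              = (∫ t in (0 : ℝ)..(ε k), ψ t) + ∫ t in (ε k)..(N + ε k), ψ t := by
            rw [intervalIntegral.integral_add_adjacent_intervals (hint _ _ le_rfl hN)
              (hint _ _ hN (by linarith [hε0 k])),
              intervalIntegral.integral_add_adjacent_intervals (hint _ _ le_rfl (hε0 k).le)
              (hint _ _ (hε0 k).le (by linarith [hε0 k]))]
          have e4 : 0 ≤ ∫ t in (N : ℝ)..(N + ε k), ψ t :=
            intervalIntegral.integral_nonneg (by linarith [hε0 k]) fun t ht ↦
              hψ t (hN.trans ht.1)
          have e5 : ∫ t in (0 : ℝ)..(ε k), ψ t ≤ ε k * ψ 0 := by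
            calc ∫ t in (0 : ℝ)..(ε k), ψ t ≤ ∫ t in (0 : ℝ)..(ε k), ψ 0 :=
                  intervalIntegral.integral_mono_on (hε0 k).le (hint _ _ le_rfl (hε0 k).le)
                    intervalIntegrable_const fun t ht ↦ hanti Set.self_mem_Ici ht.1 ht.1
              _ = ε k * ψ 0 := by simp
          rw [inv_mul_le_iff₀ (hε0 k)]
          linarith
  calc ∫⁻ t in Set.Ioi (0 : ℝ), ‖φ' t‖ₑ
      = ∫⁻ t in Set.Ioi (0 : ℝ),
          Filter.liminf (fun k ↦ ‖(ε k)⁻¹ • (φ (t + ε k) - φ t)‖ₑ) Filter.atTop :=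
        setLIntegral_congr_fun measurableSet_Ioi fun t ht ↦ (hlim t ht).liminf_eq.symm
    _ ≤ Filter.liminf (fun k ↦ ∫⁻ t in Set.Ioi (0 : ℝ), ‖(ε k)⁻¹ • (φ (t + ε k) - φ t)‖ₑ)
          Filter.atTop := by
        refine lintegral_liminf_le' fun k ↦ ?_
        have : ContinuousOn (fun t ↦ (ε k)⁻¹ • (φ (t + ε k) - φ t)) (Set.Ioi 0) := by
          refine ContinuousOn.const_smul (g := fun t ↦ φ (t + ε k) - φ t) (ContinuousOn.sub ?_ hφc) (ε k)⁻¹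
          exact hφc.comp (by fun_prop) fun t (ht : 0 < t) ↦
            show 0 < t + ε k by linarith [hε0 k]
        exact (this.aestronglyMeasurable measurableSet_Ioi).enorm
    _ ≤ ENNReal.ofReal (ψ 0) := Filter.liminf_le_of_le (by isBoundedDefault)
        fun b hb ↦ by
          obtain ⟨k, hk⟩ := hb.exists
          exact hk.trans (hbound k)

/-- The reflection formula gives `Γ(1 + iτ) Γ(1 - iτ) sin(πiτ) = πiτ`. Since `|Γ(1 + iτ)| ≤ Γ(1) =
1` and `|sinh x| ≤ |x| e^{|x|}`, the claim follows. -/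
theorem norm_inv_Gamma_one_sub_le (τ : ℝ) :
    ‖(Complex.Gamma (1 - τ * I))⁻¹‖ ≤ Real.exp (Real.pi * |τ|) := by
  rcases eq_or_ne τ 0 with rfl | hτ
  · simp
  have hI : (τ : ℂ) * I ≠ 0 := by simp [hτ]
  have h1 : Complex.Gamma (1 + τ * I) * Complex.Gamma (1 - τ * I)
      * Complex.sin (Real.pi * (τ * I)) = Real.pi * (τ * I) := by
    have hs : Complex.sin (Real.pi * (τ * I)) ≠ 0 := by
      rw [← mul_assoc, Complex.sin_mul_I, ← Complex.ofReal_mul, ← Complex.ofReal_sinh]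
      refine mul_ne_zero ?_ I_ne_zero
      rw [Complex.ofReal_ne_zero, Ne, Real.sinh_eq_zero]
      simp [hτ, Real.pi_ne_zero]
    rw [add_comm (1 : ℂ), Complex.Gamma_add_one _ hI, mul_assoc (τ * I : ℂ),
      Complex.Gamma_mul_Gamma_one_sub, mul_assoc, div_mul_cancel₀ _ hs]
    ring
  have h2 : ‖Complex.Gamma (1 + τ * I)‖ ≤ 1 := by
    rw [Complex.Gamma_eq_integral (by simp), Complex.GammaIntegral]
    refine (norm_integral_le_integral_norm _).trans ?_
    rw [← Real.Gamma_one, Real.Gamma_eq_integral one_pos]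
    refine le_of_eq (setIntegral_congr_fun measurableSet_Ioi fun t (ht : 0 < t) ↦ ?_)
    simp [Complex.norm_cpow_eq_rpow_re_of_pos ht, Complex.norm_exp]
  have h3 : ‖Complex.sin (Real.pi * (τ * I))‖
      ≤ Real.pi * |τ| * Real.exp (Real.pi * |τ|) := by
    rw [← mul_assoc, Complex.sin_mul_I, ← Complex.ofReal_mul, ← Complex.ofReal_sinh, norm_mul,
      Complex.norm_I, mul_one, Complex.norm_real, Real.norm_eq_abs, Real.abs_sinh, abs_mul,
      abs_of_pos Real.pi_pos]
    set x := Real.pi * |τ|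
    have := Real.add_one_le_exp (-(2 * x))
    have e : Real.sinh x = Real.exp x * (1 - Real.exp (-(2 * x))) / 2 := by
      rw [Real.sinh_eq, mul_sub, ← Real.exp_add]; ring_nf
    rw [e]
    nlinarith [Real.exp_pos x]
  have h4 : Real.pi * |τ| = ‖Complex.Gamma (1 + τ * I)‖ * ‖Complex.Gamma (1 - τ * I)‖
      * ‖Complex.sin (Real.pi * (τ * I))‖ := by
    rw [← norm_mul, ← norm_mul, h1]
    simp [abs_of_pos Real.pi_pos]
  have hx : 0 < Real.pi * |τ| := by positivity
  have hG : 0 < ‖Complex.Gamma (1 - τ * I)‖ := by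
    rcases (norm_nonneg (Complex.Gamma (1 - τ * I))).eq_or_lt with h | h
    · rw [← h, mul_zero, zero_mul] at h4
      exact absurd h4 hx.ne'
    · exact h
  rw [norm_inv, inv_le_iff_one_le_mul₀ hG]
  have h5 : Real.pi * |τ| ≤ 1 * ‖Complex.Gamma (1 - τ * I)‖
      * (Real.pi * |τ| * Real.exp (Real.pi * |τ|)) := by
    calc _ = _ := h4
      _ ≤ _ := by gcongr
  by_contra hlt
  push Not at hlt
  nlinarith

/-! ### Fourier multipliers on `L^r` in bilinear form. -/

section Multipliers

variable {E : Type*} [NormedAddCommGroup E] [InnerProductSpace ℝ E] [FiniteDimensional ℝ E]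
  [MeasurableSpace E] [BorelSpace E]

/-- The `L^r` norm as a real number. -/
noncomputable def lpNormReal (r : ℝ) (f : E → ℂ) : ℝ :=
  (eLpNorm f (ENNReal.ofReal r)).toReal

/-- `m` is a Fourier multiplier on `L^r` with norm at most `M`, in bilinear form. -/
def IsMult (r r' M : ℝ) (m : E → ℂ) : Prop :=
  ∀ f g : 𝓢(E, ℂ), ‖∫ ξ, m ξ * 𝓕 f ξ * 𝓕⁻ g ξ‖ ≤ M * lpNormReal r f * lpNormReal r' g

theorem lpNormReal_nonneg (r : ℝ) (f : E → ℂ) : 0 ≤ lpNormReal r f := ENNReal.toReal_nonneg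

theorem integrable_rpow_norm (f : 𝓢(E, ℂ)) {r : ℝ} (hr : 0 < r) :
    Integrable fun x ↦ ‖f x‖ ^ r := by
  have h := (f.memLp (ENNReal.ofReal r) volume).integrable_norm_rpow (by simpa using hr)
    ENNReal.ofReal_ne_top
  rwa [ENNReal.toReal_ofReal hr.le] at h

theorem lpNormReal_rpow (f : 𝓢(E, ℂ)) {r : ℝ} (hr : 0 < r) :
    lpNormReal r f ^ r = ∫ x, ‖f x‖ ^ r := by
  rw [lpNormReal, (f.memLp (ENNReal.ofReal r) volume).eLpNorm_eq_integral_rpow_norm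
    (by simpa using hr) ENNReal.ofReal_ne_top, ENNReal.toReal_ofReal hr.le,
    ENNReal.toReal_ofReal (by positivity), ← Real.rpow_mul (by positivity),
    inv_mul_cancel₀ hr.ne', Real.rpow_one]

theorem lpNormReal_const_smul (f : 𝓢(E, ℂ)) (c : ℂ) (r : ℝ) :
    lpNormReal r (c • f : 𝓢(E, ℂ)) = ‖c‖ * lpNormReal r f := by
  have : ((c • f : 𝓢(E, ℂ)) : E → ℂ) = c • (f : E → ℂ) := rfl
  rw [lpNormReal, this, eLpNorm_const_smul, ENNReal.toReal_mul, lpNormReal]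
  simp

/-- A bilinear bound by powers of norms gives a bound by the product of the norms. -/
theorem isMult_of_rpow_le {r r' K : ℝ} (hr : 0 < r) (hr' : 0 < r') (hK : 0 ≤ K) {m : E → ℂ}
    (h : ∀ f g : 𝓢(E, ℂ),
      ‖∫ ξ, m ξ * 𝓕 f ξ * 𝓕⁻ g ξ‖ ≤ K * ((∫ x, ‖f x‖ ^ r) + ∫ x, ‖g x‖ ^ r')) :
    IsMult r r' (2 * K) m := by
  intro f g
  have key : ∀ ε : ℝ, 0 < ε → ‖∫ ξ, m ξ * 𝓕 f ξ * 𝓕⁻ g ξ‖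
      ≤ 2 * K * (lpNormReal r f + ε) * (lpNormReal r' g + ε) := by
    intro ε hε
    -- Dividing `f` and `g` by their norms makes each power integral at most `1`, whence the factor
    -- `2`. The `ε` avoids division by zero.
    set a := lpNormReal r f + ε with ha
    set b := lpNormReal r' g + ε with hb
    have ha0 : 0 < a := by have := lpNormReal_nonneg r f; positivity
    have hb0 : 0 < b := by have := lpNormReal_nonneg r' g; positivity
    have h1 := h ((a : ℂ)⁻¹ • f) ((b : ℂ)⁻¹ • g)
    rw [← lpNormReal_rpow _ hr, ← lpNormReal_rpow _ hr', lpNormReal_const_smul,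
      lpNormReal_const_smul] at h1
    have h2 : ∀ {u v s : ℝ}, 0 ≤ u → u ≤ v → 0 < v → 0 < s → (‖(v : ℂ)⁻¹‖ * u) ^ s ≤ 1 := by
      intro u v s hu huv hv hs
      refine Real.rpow_le_one (by positivity) ?_ hs.le
      rw [← Complex.ofReal_inv, Complex.norm_real, Real.norm_of_nonneg (by positivity),
        inv_mul_le_one₀ hv]
      exact huv
    have h3 := h2 (lpNormReal_nonneg r f) (by linarith : lpNormReal r f ≤ a) ha0 hr
    have h4 := h2 (lpNormReal_nonneg r' g) (by linarith : lpNormReal r' g ≤ b) hb0 hr'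
    have h5 : ∫ ξ, m ξ * 𝓕 ((a : ℂ)⁻¹ • f) ξ * 𝓕⁻ ((b : ℂ)⁻¹ • g) ξ
        = ((a : ℂ)⁻¹ * (b : ℂ)⁻¹) * ∫ ξ, m ξ * 𝓕 f ξ * 𝓕⁻ g ξ := by
      rw [← integral_const_mul]
      congr 1 with ξ
      rw [FourierTransform.fourier_smul, FourierTransform.fourierInv_smul]
      simp only [smul_apply, smul_eq_mul]
      ring
    rw [h5, norm_mul, norm_mul, norm_inv, norm_inv, Complex.norm_real, Complex.norm_real,
      Real.norm_of_nonneg ha0.le, Real.norm_of_nonneg hb0.le] at h1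
    rw [norm_inv, Complex.norm_real, Real.norm_of_nonneg ha0.le] at h3
    rw [norm_inv, Complex.norm_real, Real.norm_of_nonneg hb0.le] at h4
    have h6 : a⁻¹ * b⁻¹ * ‖∫ ξ, m ξ * 𝓕 f ξ * 𝓕⁻ g ξ‖ ≤ K * 2 := by
      refine h1.trans ?_
      gcongr
      linarith
    rw [← mul_inv, inv_mul_le_iff₀ (by positivity)] at h6
    linarith
  have hl : Filter.Tendsto (fun ε : ℝ ↦ 2 * K * (lpNormReal r f + ε) * (lpNormReal r' g + ε))
      (nhdsWithin 0 (Set.Ioi 0)) (nhds (2 * K * lpNormReal r f * lpNormReal r' g)) := by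
    have : Continuous fun ε : ℝ ↦ 2 * K * (lpNormReal r f + ε) * (lpNormReal r' g + ε) := by
      fun_prop
    have h := this.tendsto 0
    simp only [add_zero] at h
    exact h.mono_left nhdsWithin_le_nhds
  refine ge_of_tendsto hl ?_
  filter_upwards [self_mem_nhdsWithin] with ε hε using key ε hε

end Multipliers

/-! ### The pairing of two heat flows, for complex Schwartz functions. -/

section HeatFlow

variable {E : Type*} [NormedAddCommGroup E] [InnerProductSpace ℝ E] [FiniteDimensional ℝ E]
  [MeasurableSpace E] [BorelSpace E]

theorem integrable_fourier_mul (f g : 𝓢(E, ℂ)) :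
    Integrable fun ξ ↦ 𝓕 f ξ * 𝓕⁻ g ξ := by
  obtain ⟨M, hM⟩ : ∃ M, ∀ ξ, ‖𝓕 f ξ‖ ≤ M := ⟨_, (𝓕 f).norm_le_seminorm ℝ⟩
  exact (𝓕⁻ g).integrable.bdd_mul (𝓕 f).continuous.aestronglyMeasurable (.of_forall hM)

theorem integral_mul_eq_fourier (f g : 𝓢(E, ℂ)) :
    ∫ x, f x * g x = ∫ ξ, 𝓕 f ξ * 𝓕⁻ g ξ := by
  rw [SchwartzMap.integral_fourier_mul_eq, FourierTransform.fourier_fourierInv_eq]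

theorem integral_translate_mul (f g : 𝓢(E, ℂ)) (y : E) :
    ∫ x, f (x + y) * g x
      = ∫ ξ, cexp ((2 * Real.pi * inner ℝ y ξ : ℝ) * I) * (𝓕 f ξ * 𝓕⁻ g ξ) := by
  have h := integral_mul_eq_fourier (SchwartzMap.compSubConstCLM ℂ (-y) f) g
  simp only [SchwartzMap.compSubConstCLM_apply, sub_neg_eq_add] at h
  rw [h]
  congr 1 with ξ
  rw [← mul_assoc]
  congr 1
  have e : ((SchwartzMap.compSubConstCLM ℂ (-y) f : 𝓢(E, ℂ)) : E → ℂ) = f ∘ fun v ↦ v + y := by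
    ext x; simp
  rw [SchwartzMap.fourier_coe, e, SchwartzMap.fourier_coe]
  have := VectorFourier.fourierIntegral_comp_add_right Real.fourierChar volume (innerₗ E) f y
  refine (congrFun this ξ).trans ?_
  rw [Circle.smul_def, Real.fourierChar_apply]
  rfl

/-- After a translation in `x`, the pairing of the translates by `y₁` and `y₂` depends only on `y₁ -
y₂`. It contributes the character of `y₁ - y₂`, and integrating in `y₁` and `y₂` separately gives
the two characteristic functions. -/
theorem integral_avg_mul_avg (γ : Measure E) [IsProbabilityMeasure γ] (f g : 𝓢(E, ℂ)) :
    ∫ x, avg γ f x * avg γ g x = ∫ ξ, charFun γ ((2 * Real.pi) • ξ)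
      * charFun γ (-((2 * Real.pi) • ξ)) * (𝓕 f ξ * 𝓕⁻ g ξ) := by
  obtain ⟨M, hM⟩ : ∃ M, ∀ ξ, ‖g ξ‖ ≤ M := ⟨_, g.norm_le_seminorm ℝ⟩
  have hint : Integrable (fun z : E × (E × E) ↦ f (z.1 + z.2.1) * g (z.1 + z.2.2))
      ((volume : Measure E).prod (γ.prod γ)) := by
    have h1 : AEStronglyMeasurable (fun z : E × (E × E) ↦ g (z.1 + z.2.2))
        ((volume : Measure E).prod (γ.prod γ)) :=
      (g.continuous.comp (by fun_prop)).aestronglyMeasurable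
    have h2 : Integrable (fun z : E × (E × E) ↦ f (z.1 + z.2.1))
        ((volume : Measure E).prod (γ.prod γ)) := by
      have hm : AEStronglyMeasurable (fun z : E × (E × E) ↦ f (z.1 + z.2.1))
        ((volume : Measure E).prod (γ.prod γ)) :=
        (f.continuous.comp (by fun_prop)).aestronglyMeasurable
      rw [integrable_prod_iff' hm]
      refine ⟨.of_forall fun y ↦ f.integrable.comp_add_right y.1, ?_⟩
      have : (fun y : E × E ↦ ∫ x, ‖f ((x, y).1 + (x, y).2.1)‖) = fun _ ↦ ∫ x, ‖f x‖ := by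
        ext y
        exact integral_add_right_eq_self (fun x ↦ ‖f x‖) y.1
      rw [this]
      exact integrable_const _
    simpa only [mul_comm] using h2.bdd_mul h1 (.of_forall fun z ↦ hM _)
  have hint2 : Integrable (fun z : (E × E) × E ↦
      cexp ((2 * Real.pi * inner ℝ (z.1.1 - z.1.2) z.2 : ℝ) * I) * (𝓕 f z.2 * 𝓕⁻ g z.2))
      ((γ.prod γ).prod (volume : Measure E)) := by
    refine Integrable.bdd_mul (c := 1) ?_ ?_ (.of_forall fun z ↦ ?_)
    · exact (integrable_fourier_mul f g).comp_snd _
    · exact (by fun_prop : Continuous fun z : (E × E) × E ↦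
        cexp ((2 * Real.pi * inner ℝ (z.1.1 - z.1.2) z.2 : ℝ) * I)).aestronglyMeasurable
    · rw [Complex.norm_exp_ofReal_mul_I]
  calc ∫ x, avg γ f x * avg γ g x
      = ∫ x, ∫ y : E × E, f (x + y.1) * g (x + y.2) ∂(γ.prod γ) := by
        congr 1 with x
        exact (integral_prod_mul (fun y ↦ f (x + y)) fun y ↦ g (x + y)).symm
    _ = ∫ y : E × E, (∫ x, f (x + y.1) * g (x + y.2)) ∂(γ.prod γ) := integral_integral_swap hint
    _ = ∫ y : E × E, (∫ ξ, cexp ((2 * Real.pi * inner ℝ (y.1 - y.2) ξ : ℝ) * I)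
          * (𝓕 f ξ * 𝓕⁻ g ξ)) ∂(γ.prod γ) := by
        congr 1 with y
        rw [← integral_translate_mul,
          ← integral_add_right_eq_self (fun x ↦ f (x + (y.1 - y.2)) * g x) y.2]
        congr 1 with x
        congr 2
        abel
    _ = ∫ ξ, ∫ y : E × E, cexp ((2 * Real.pi * inner ℝ (y.1 - y.2) ξ : ℝ) * I)
          * (𝓕 f ξ * 𝓕⁻ g ξ) ∂(γ.prod γ) := integral_integral_swap hint2
    _ = _ := by
        congr 1 with ξ
        rw [integral_mul_const]
        congr 1
        rw [charFun_apply, charFun_apply, ← integral_prod_mul]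
        congr 1 with y
        rw [← Complex.exp_add]
        congr 1
        simp only [inner_neg_right, inner_smul_right, inner_sub_left]
        push_cast
        ring

/-- The positive and negative parts of the real and imaginary parts of a complex number. -/
noncomputable def quarter (k : Fin 4) (z : ℂ) : ℝ :=
  ![max z.re 0, max z.im 0, max (-z.re) 0, max (-z.im) 0] k

theorem continuous_quarter (k : Fin 4) : Continuous (quarter k) := by
  unfold quarter
  fin_cases k <;> simp <;> fun_prop

theorem quarter_nonneg (k : Fin 4) (z : ℂ) : 0 ≤ quarter k z := by
  fin_cases k <;> simp [quarter]

theorem quarter_le_norm (k : Fin 4) (z : ℂ) : quarter k z ≤ ‖z‖ := by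
  have h1 := abs_le.1 (Complex.abs_re_le_norm z)
  have h2 := abs_le.1 (Complex.abs_im_le_norm z)
  have h0 := norm_nonneg z
  fin_cases k <;> simp [quarter] <;> linarith

theorem sum_quarter (z : ℂ) : ∑ k : Fin 4, I ^ (k : ℕ) * (quarter k z : ℂ) = z := by
  have h : ∀ x : ℝ, max x 0 - max (-x) 0 = x := fun x ↦ by
    rcases le_total x 0 with h | h
    · rw [max_eq_right h, max_eq_left (by linarith)]; ring
    · rw [max_eq_left h, max_eq_right (by linarith)]; ring
  rw [Fin.sum_univ_four]
  apply Complex.ext <;> simp [quarter, pow_succ, ← sub_eq_add_neg, h]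

theorem isDensity_quarter (f : 𝓢(E, ℂ)) (k : Fin 4) : IsDensity fun x ↦ quarter k (f x) := by
  refine ⟨(continuous_quarter k).comp f.continuous, fun x ↦ quarter_nonneg k _,
    ⟨_, fun x ↦ (quarter_le_norm k _).trans (f.norm_le_seminorm ℝ x)⟩, ?_⟩
  refine f.integrable.norm.mono' ((continuous_quarter k).comp f.continuous).aestronglyMeasurable
    (.of_forall fun x ↦ ?_)
  rw [Real.norm_of_nonneg (quarter_nonneg k _)]
  exact quarter_le_norm k _

theorem avg_eq_sum_quarter (γ : Measure E) [IsProbabilityMeasure γ] (f : 𝓢(E, ℂ)) (x : E) :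
    avg γ f x = ∑ k : Fin 4, I ^ (k : ℕ) * ((avg γ (fun x ↦ quarter k (f x)) x : ℝ) : ℂ) := by
  unfold avg
  have h : ∀ k : Fin 4, Integrable (fun y ↦ I ^ (k : ℕ) * (quarter k (f (x + y)) : ℂ)) γ := by
    intro k
    obtain ⟨M, hM⟩ := (isDensity_quarter f k).norm_le
    exact (integrable_translate γ (isDensity_quarter f k).cont hM x).ofReal.const_mul _
  calc ∫ y, f (x + y) ∂γ = ∫ y, ∑ k : Fin 4, I ^ (k : ℕ) * (quarter k (f (x + y)) : ℂ) ∂γ := by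
        simp only [sum_quarter]
    _ = _ := by
        rw [integral_finsetSum _ fun k _ ↦ h k]
        congr 1 with k
        rw [integral_const_mul, integral_complex_ofReal]

theorem integral_avg_mul_avg_eq_sum (γ : Measure E) [IsProbabilityMeasure γ] (f g : 𝓢(E, ℂ)) :
    ∫ x, avg γ f x * avg γ g x = ∑ k : Fin 4, ∑ l : Fin 4, I ^ (k : ℕ) * I ^ (l : ℕ) *
      ((∫ x, avg γ (fun x ↦ quarter k (f x)) x * avg γ (fun x ↦ quarter l (g x)) x : ℝ) : ℂ) := by
  have h : ∀ k l : Fin 4, Integrable (fun x ↦ I ^ (k : ℕ) * I ^ (l : ℕ) *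
      ((avg γ (fun x ↦ quarter k (f x)) x * avg γ (fun x ↦ quarter l (g x)) x : ℝ) : ℂ)) :=
    fun k l ↦ (((isDensity_quarter f k).avg γ).integrable_mul
      ((isDensity_quarter g l).avg γ)).ofReal.const_mul _
  calc ∫ x, avg γ f x * avg γ g x
      = ∫ x, ∑ k : Fin 4, ∑ l : Fin 4, I ^ (k : ℕ) * I ^ (l : ℕ) *
      ((avg γ (fun x ↦ quarter k (f x)) x * avg γ (fun x ↦ quarter l (g x)) x : ℝ) : ℂ) := by
        congr 1 with x
        rw [avg_eq_sum_quarter, avg_eq_sum_quarter, Finset.sum_mul_sum]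
        refine Finset.sum_congr rfl fun k _ ↦ Finset.sum_congr rfl fun l _ ↦ ?_
        push_cast
        ring
    _ = _ := by
        rw [integral_finsetSum _ fun k _ ↦ integrable_finsetSum _ fun l _ ↦ h k l]
        refine Finset.sum_congr rfl fun k _ ↦ ?_
        rw [integral_finsetSum _ fun l _ ↦ h k l]
        refine Finset.sum_congr rfl fun l _ ↦ ?_
        rw [integral_const_mul, integral_complex_ofReal]

/-- The Bellman argument applies to nonnegative functions, so `f` and `g` are each split into four
nonnegative parts. The constant `16` counts the pairs. -/
theorem exists_heat_variation_of_two_le (f g : 𝓢(E, ℂ)) {p q : ℝ} (hp : 2 ≤ p)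
    (hpq : p.HolderConjugate q) :
    ∃ ψ : ℝ → ℝ, (∀ t, 0 ≤ t → 0 ≤ ψ t) ∧
      ψ 0 ≤ 16 * (10 * (p + q) + 4) * ((∫ x, ‖f x‖ ^ p) + ∫ x, ‖g x‖ ^ q) ∧
      ∀ s t, 0 ≤ s → s ≤ t →
        ‖(∫ x, avg (heatMeasure E s) f x * avg (heatMeasure E s) g x)
          - ∫ x, avg (heatMeasure E t) f x * avg (heatMeasure E t) g x‖ ≤ ψ s - ψ t := by
  have hq : 1 < q := hpq.symm.lt
  have hmul : (p - 1) * (q - 1) = 1 := by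
    have := hpq.mul_eq_add
    linarith
  have hq2 : q ≤ 2 := by nlinarith
  choose ψ hψ0 hψ hψv using fun k l : Fin 4 ↦
    exists_heat_variation_density (isDensity_quarter f k) (isDensity_quarter g l) hp hq hq2 hmul
  have hF : ∀ k : Fin 4, ∫ x, quarter k (f x) ^ p ≤ ∫ x, ‖f x‖ ^ p := fun k ↦
    integral_mono ((isDensity_quarter f k).integrable_rpow (by linarith))
      (integrable_rpow_norm f (by linarith)) fun x ↦
        Real.rpow_le_rpow (quarter_nonneg k _) (quarter_le_norm k _) (by linarith)
  have hG : ∀ k : Fin 4, ∫ x, quarter k (g x) ^ q ≤ ∫ x, ‖g x‖ ^ q := fun k ↦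
    integral_mono ((isDensity_quarter g k).integrable_rpow (by linarith))
      (integrable_rpow_norm g (by linarith)) fun x ↦
        Real.rpow_le_rpow (quarter_nonneg k _) (quarter_le_norm k _) (by linarith)
  have hF0 : 0 ≤ ∫ x, ‖f x‖ ^ p := integral_nonneg fun x ↦ by positivity
  have hG0 : 0 ≤ ∫ x, ‖g x‖ ^ q := integral_nonneg fun x ↦ by positivity
  refine ⟨fun t ↦ ∑ k, ∑ l, ψ k l t, fun t ht ↦
    Finset.sum_nonneg fun k _ ↦ Finset.sum_nonneg fun l _ ↦ hψ0 k l t ht, ?_, fun s t hs hst ↦ ?_⟩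
  · have h1 : ∀ k l : Fin 4, ψ k l 0
        ≤ (10 * (p + q) + 4) * ((∫ x, ‖f x‖ ^ p) + ∫ x, ‖g x‖ ^ q) := by
      intro k l
      refine (hψ k l).trans ?_
      have hp1 : 0 ≤ 10 * (p - 1) + 4 := by linarith
      have hp2 : 10 * (p - 1) + 4 ≤ 10 * (p + q) + 4 := by linarith
      exact mul_le_mul hp2 (add_le_add (hF k) (hG l)) (add_nonneg
        (integral_nonneg fun x ↦ Real.rpow_nonneg (quarter_nonneg k _) _)
        (integral_nonneg fun x ↦ Real.rpow_nonneg (quarter_nonneg l _) _)) (by linarith)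
    calc ∑ k, ∑ l, ψ k l 0 ≤ ∑ _k : Fin 4, ∑ _l : Fin 4,
          (10 * (p + q) + 4) * ((∫ x, ‖f x‖ ^ p) + ∫ x, ‖g x‖ ^ q) :=
          Finset.sum_le_sum fun k _ ↦ Finset.sum_le_sum fun l _ ↦ h1 k l
      _ = _ := by simp; ring
  · rw [integral_avg_mul_avg_eq_sum, integral_avg_mul_avg_eq_sum]
    simp only [← Finset.sum_sub_distrib]
    refine (norm_sum_le _ _).trans (Finset.sum_le_sum fun k _ ↦ (norm_sum_le _ _).trans
      (Finset.sum_le_sum fun l _ ↦ ?_))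
    rw [← mul_sub, ← Complex.ofReal_sub, norm_mul, Complex.norm_real]
    simpa using hψv k l s t hs hst

/-- The Bellman function needs `p ≥ 2`; otherwise `q ≥ 2`, and the symmetry of the pairing lets the
two functions exchange roles. -/
theorem exists_heat_variation (f g : 𝓢(E, ℂ)) {p q : ℝ} (hpq : p.HolderConjugate q) :
    ∃ ψ : ℝ → ℝ, (∀ t, 0 ≤ t → 0 ≤ ψ t) ∧
      ψ 0 ≤ 16 * (10 * (p + q) + 4) * ((∫ x, ‖f x‖ ^ p) + ∫ x, ‖g x‖ ^ q) ∧
      ∀ s t, 0 ≤ s → s ≤ t →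
        ‖(∫ x, avg (heatMeasure E s) f x * avg (heatMeasure E s) g x)
          - ∫ x, avg (heatMeasure E t) f x * avg (heatMeasure E t) g x‖ ≤ ψ s - ψ t := by
  rcases le_total 2 p with hp | hp
  · exact exists_heat_variation_of_two_le f g hp hpq
  · have hq : 2 ≤ q := by
      have h1 := hpq.mul_eq_add
      have h2 := hpq.lt
      have h3 := hpq.symm.lt
      nlinarith
    obtain ⟨ψ, h1, h2, h3⟩ := exists_heat_variation_of_two_le g f hq hpq.symm
    refine ⟨ψ, h1, ?_, fun s t hs hst ↦ ?_⟩
    · rwa [add_comm p, add_comm (∫ x, ‖f x‖ ^ p)]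
    · simpa only [mul_comm] using h3 s t hs hst

end HeatFlow

/-! ### Imaginary powers of `I - bΔ`. -/

section ImaginaryPowers

variable {E : Type*} [NormedAddCommGroup E] [InnerProductSpace ℝ E] [FiniteDimensional ℝ E]
  [MeasurableSpace E] [BorelSpace E]

/-- The symbol `1 + 4π² b |ξ|²`. -/
noncomputable def helmholtz (b : ℝ) (ξ : E) : ℝ := 1 + b * (4 * Real.pi ^ 2 * ‖ξ‖ ^ 2)

theorem one_le_helmholtz {b : ℝ} (hb : 0 ≤ b) (ξ : E) : 1 ≤ helmholtz b ξ := by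
  unfold helmholtz
  have : 0 ≤ b * (4 * Real.pi ^ 2 * ‖ξ‖ ^ 2) := by positivity
  linarith

theorem continuous_helmholtz (b : ℝ) : Continuous (helmholtz b : E → ℝ) := by
  unfold helmholtz
  fun_prop

theorem integrable_sq_mul_fourier_mul (f g : 𝓢(E, ℂ)) :
    Integrable fun ξ ↦ ((‖ξ‖ ^ 2 : ℝ) : ℂ) * (𝓕 f ξ * 𝓕⁻ g ξ) := by
  obtain ⟨M, hM⟩ : ∃ M, ∀ ξ, ‖𝓕⁻ g ξ‖ ≤ M := ⟨_, (𝓕⁻ g).norm_le_seminorm ℝ⟩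
  have hc : Continuous fun ξ ↦ ((‖ξ‖ ^ 2 : ℝ) : ℂ) * (𝓕 f ξ * 𝓕⁻ g ξ) := by
    have h1 := (𝓕 f).continuous
    have h2 := (𝓕⁻ g).continuous
    fun_prop
  refine (((𝓕 f).integrable_pow_mul volume 2).mul_const M).mono' hc.aestronglyMeasurable
    (.of_forall fun ξ ↦ ?_)
  rw [norm_mul, norm_mul, Complex.norm_real, ← mul_assoc]
  simp only [norm_pow, norm_norm]
  gcongr
  exact hM ξ

theorem integrable_helmholtz_mul_fourier_mul (b : ℝ) (f g : 𝓢(E, ℂ)) :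
    Integrable fun ξ ↦ (helmholtz b ξ : ℂ) * (𝓕 f ξ * 𝓕⁻ g ξ) := by
  have h := (integrable_fourier_mul f g).add ((integrable_sq_mul_fourier_mul f g).const_mul
    ((b * (4 * Real.pi ^ 2) : ℝ) : ℂ))
  refine h.congr (.of_forall fun ξ ↦ ?_)
  simp only [helmholtz, Pi.add_apply]
  push_cast
  ring

/-- The bilinear form of the semigroup generated by `I - bΔ`. -/
noncomputable def heatForm (b : ℝ) (f g : 𝓢(E, ℂ)) (t : ℝ) : ℂ :=
  ∫ ξ, (Real.exp (-(2 * t * helmholtz b ξ)) : ℂ) * (𝓕 f ξ * 𝓕⁻ g ξ)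

/-- Both functions flow for time `b t`, so the Gaussian symbol appears squared. This is why `2 t`
stands in the exponent of `heatForm`. -/
theorem heatForm_eq {b t : ℝ} (hb : 0 ≤ b) (ht : 0 ≤ t) (f g : 𝓢(E, ℂ)) :
    heatForm b f g t = (Real.exp (-(2 * t)) : ℂ) *
      ∫ x, avg (heatMeasure E (b * t)) f x * avg (heatMeasure E (b * t)) g x := by
  rw [integral_avg_mul_avg, ← integral_const_mul, heatForm]
  congr 1 with ξ
  rw [charFun_heatMeasure (by positivity), charFun_heatMeasure (by positivity), norm_neg,
    ← Complex.exp_add, ← mul_assoc (Real.exp (-(2 * t)) : ℂ), Complex.ofReal_exp,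
    Complex.ofReal_exp, ← Complex.exp_add, norm_smul, Real.norm_of_nonneg (by positivity)]
  congr 2
  simp only [helmholtz]
  push_cast
  ring

theorem hasDerivAt_heatForm {b t : ℝ} (hb : 0 ≤ b) (ht : 0 < t) (f g : 𝓢(E, ℂ)) :
    HasDerivAt (heatForm b f g)
      (∫ ξ, (-(2 * helmholtz b ξ * Real.exp (-(2 * t * helmholtz b ξ))) : ℝ)
        * (𝓕 f ξ * 𝓕⁻ g ξ)) t := by
  have hG := integrable_fourier_mul f g
  have hc := continuous_helmholtz (E := E) b
  refine (hasDerivAt_integral_of_dominated_loc_of_deriv_le (μ := (volume : Measure E))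
    (s := Set.Ioi 0) (x₀ := t)
    (F := fun t ξ ↦ (Real.exp (-(2 * t * helmholtz b ξ)) : ℂ) * (𝓕 f ξ * 𝓕⁻ g ξ))
    (F' := fun t ξ ↦ (-(2 * helmholtz b ξ * Real.exp (-(2 * t * helmholtz b ξ))) : ℝ)
        * (𝓕 f ξ * 𝓕⁻ g ξ))
    (bound := fun ξ ↦ 2 * ‖(helmholtz b ξ : ℂ) * (𝓕 f ξ * 𝓕⁻ g ξ)‖)
    (Ioi_mem_nhds ht) (.of_forall fun s ↦ ?_) ?_ ?_ (.of_forall fun ξ s hs ↦ ?_) ?_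
    (.of_forall fun ξ s hs ↦ ?_)).2
  · exact (by fun_prop : Continuous fun ξ : E ↦
      (Real.exp (-(2 * s * helmholtz b ξ)) : ℂ)).aestronglyMeasurable.mul hG.1
  · refine hG.bdd_mul (c := 1) (by fun_prop : Continuous fun ξ : E ↦
      (Real.exp (-(2 * t * helmholtz b ξ)) : ℂ)).aestronglyMeasurable (.of_forall fun ξ ↦ ?_)
    have := one_le_helmholtz hb ξ
    rw [Complex.norm_real, Real.norm_of_nonneg (Real.exp_pos _).le, Real.exp_le_one_iff]
    have : 0 ≤ 2 * t * helmholtz b ξ := by positivity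
    linarith
  · exact (by fun_prop : Continuous fun ξ : E ↦
      ((-(2 * helmholtz b ξ * Real.exp (-(2 * t * helmholtz b ξ))) : ℝ) : ℂ)).aestronglyMeasurable.mul
      hG.1
  · have h1 := one_le_helmholtz hb ξ
    have hs : 0 < s := hs
    have h2 : Real.exp (-(2 * s * helmholtz b ξ)) ≤ 1 := by
      rw [Real.exp_le_one_iff]
      have : 0 ≤ 2 * s * helmholtz b ξ := by positivity
      linarith
    rw [norm_mul, norm_mul (helmholtz b ξ : ℂ), Complex.norm_real, Complex.norm_real, norm_neg,
      norm_mul, norm_mul, Real.norm_of_nonneg (Real.exp_pos _).le, ← mul_assoc]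
    have h3 : ‖(2 : ℝ)‖ = 2 := by norm_num
    rw [h3]
    refine mul_le_mul_of_nonneg_right ?_ (norm_nonneg _)
    exact mul_le_of_le_one_right (by positivity) h2
  · exact (integrable_helmholtz_mul_fourier_mul b f g).norm.const_mul 2
  · have h1 : HasDerivAt (fun s : ℝ ↦ -(2 * s * helmholtz b ξ)) (-(2 * helmholtz b ξ)) s := by
      simpa using (((hasDerivAt_id s).const_mul 2).mul_const (helmholtz b ξ)).fun_neg
    have h2 := h1.exp.ofReal_comp.mul_const (𝓕 f ξ * 𝓕⁻ g ξ)
    refine h2.congr_deriv ?_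
    congr 2
    ring

theorem norm_integral_mul_le_rpow (f g : 𝓢(E, ℂ)) {p q : ℝ} (hpq : p.HolderConjugate q) :
    ‖∫ x, f x * g x‖ ≤ (∫ x, ‖f x‖ ^ p) + ∫ x, ‖g x‖ ^ q := by
  have h1 := integrable_rpow_norm f hpq.pos
  have h2 := integrable_rpow_norm g hpq.symm.pos
  rw [← integral_add h1 h2]
  refine norm_integral_le_of_norm_le (h1.add h2) (.of_forall fun x ↦ ?_)
  rw [norm_mul]
  refine (Real.young_inequality_of_nonneg (norm_nonneg _) (norm_nonneg _) hpq).trans ?_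
  exact add_le_add (div_le_self (by positivity) hpq.lt.le)
    (div_le_self (by positivity) hpq.symm.lt.le)

/-- The form is a decreasing scalar `e^{-2t}` times `Φ (b t)`. By the product rule for variations,
`ψ (b t) + e^{-2t} K` is a majorant as soon as `K` bounds `Φ`. With `K = ‖Φ 0‖ + ψ 0` the majorant
at `0` contains `ψ 0` twice, so `16` becomes `32`, and `‖Φ 0‖` once, which Young's inequality
bounds. -/
theorem setLIntegral_deriv_heatForm_le {b : ℝ} (hb : 0 ≤ b) (f g : 𝓢(E, ℂ)) {p q : ℝ}
    (hpq : p.HolderConjugate q) :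
    ∫⁻ t in Set.Ioi (0 : ℝ), ‖∫ ξ, (-(2 * helmholtz b ξ * Real.exp (-(2 * t * helmholtz b ξ))) : ℝ)
        * (𝓕 f ξ * 𝓕⁻ g ξ)‖ₑ
      ≤ ENNReal.ofReal ((32 * (10 * (p + q) + 4) + 1) *
        ((∫ x, ‖f x‖ ^ p) + ∫ x, ‖g x‖ ^ q)) := by
  obtain ⟨ψ, hψ0, hψ, hψv⟩ := exists_heat_variation f g hpq
  set Φ : ℝ → ℂ := fun t ↦ ∫ x, avg (heatMeasure E t) f x * avg (heatMeasure E t) g x with hΦ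
  have hΦ0 : ‖Φ 0‖ ≤ (∫ x, ‖f x‖ ^ p) + ∫ x, ‖g x‖ ^ q := by
    have h0 : ∀ w : 𝓢(E, ℂ), avg (heatMeasure E 0) w = w := by
      intro w
      ext x
      have : heatMeasure E 0 = Measure.dirac 0 := by
        simp [heatMeasure, Measure.map_const]
      simp [avg, this]
    simp only [hΦ, h0]
    exact norm_integral_mul_le_rpow f g hpq
  set K := ‖Φ 0‖ + ψ 0 with hK
  have hΦK : ∀ t, 0 ≤ t → ‖Φ t‖ ≤ K := fun t ht ↦ by
    have h1 := hψv 0 t le_rfl ht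
    have h2 := hψ0 t ht
    have h3 : ‖Φ t‖ ≤ ‖Φ 0‖ + ‖Φ 0 - Φ t‖ := by
      have := norm_sub_le (Φ 0) (Φ 0 - Φ t)
      rwa [sub_sub_cancel] at this
    linarith
  have hK0 : 0 ≤ K := (norm_nonneg _).trans (hΦK 0 le_rfl)
  have key := setLIntegral_enorm_deriv_le (φ := heatForm b f g)
    (ψ := fun t ↦ ψ (b * t) + Real.exp (-(2 * t)) * K)
    (fun t ht ↦ hasDerivAt_heatForm hb ht f g)
    (fun t ht ↦ add_nonneg (hψ0 _ (by positivity)) (by positivity)) ?_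
  · refine key.trans (ENNReal.ofReal_le_ofReal ?_)
    simp only [mul_zero, neg_zero, Real.exp_zero, one_mul]
    linarith
  · intro s t hs hst
    have ht := hs.trans hst
    rw [heatForm_eq hb hs, heatForm_eq hb ht]
    have e : (Real.exp (-(2 * s)) : ℂ) * Φ (b * s) - (Real.exp (-(2 * t)) : ℂ) * Φ (b * t)
        = (Real.exp (-(2 * s)) : ℂ) * (Φ (b * s) - Φ (b * t))
          + ((Real.exp (-(2 * s)) - Real.exp (-(2 * t)) : ℝ) : ℂ) * Φ (b * t) := by
      push_cast; ring
    have h1 : Real.exp (-(2 * s)) ≤ 1 := by rw [Real.exp_le_one_iff]; linarith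
    have h2 : Real.exp (-(2 * t)) ≤ Real.exp (-(2 * s)) := Real.exp_le_exp.2 (by linarith)
    have h3 := hψv (b * s) (b * t) (by positivity) (by gcongr)
    have h4 := hΦK (b * t) (by positivity)
    refine (congrArg norm e).trans_le ((norm_add_le _ _).trans ?_)
    rw [norm_mul, norm_mul, Complex.norm_real, Complex.norm_real,
      Real.norm_of_nonneg (Real.exp_pos _).le, Real.norm_of_nonneg (by linarith)]
    have h5 : Real.exp (-(2 * s)) * ‖Φ (b * s) - Φ (b * t)‖ ≤ ψ (b * s) - ψ (b * t) :=
      (mul_le_of_le_one_left (norm_nonneg _) h1).trans h3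
    have h6 : (Real.exp (-(2 * s)) - Real.exp (-(2 * t))) * ‖Φ (b * t)‖
        ≤ (Real.exp (-(2 * s)) - Real.exp (-(2 * t))) * K := by gcongr
    linarith

theorem integral_cpow_mul_helmholtz_exp (τ : ℝ) {l : ℝ} (hl : 0 < l) :
    ∫ t in Set.Ioi (0 : ℝ), (t : ℂ) ^ (-(τ * I)) * ((2 * l * Real.exp (-(2 * t * l)) : ℝ) : ℂ)
      = cexp (τ * I * Real.log 2) * cexp (τ * I * Real.log l) * Complex.Gamma (1 - τ * I) := by
  have h2l : 0 < 2 * l := by positivity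
  have h := Complex.integral_cpow_mul_exp_neg_mul_Ioi (a := 1 - τ * I) (r := 2 * l) (by simp) h2l
  have e1 : ∀ t : ℝ, (t : ℂ) ^ (-(τ * I)) * ((2 * l * Real.exp (-(2 * t * l)) : ℝ) : ℂ)
      = (2 * l : ℂ) * ((t : ℂ) ^ (1 - τ * I - 1) * cexp (-(((2 * l : ℝ) : ℂ) * t))) := by
    intro t
    rw [show 1 - (τ : ℂ) * I - 1 = -(τ * I) by ring]
    push_cast
    rw [show -(2 * (l : ℂ) * t) = -(2 * t * l) by ring]
    ring
  simp only [e1]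
  rw [integral_const_mul, h, ← mul_assoc]
  congr 1
  have hne : ((2 * l : ℝ) : ℂ) ≠ 0 := by exact_mod_cast h2l.ne'
  rw [one_div, Complex.inv_cpow _ _ (by
      rw [Complex.arg_ofReal_of_nonneg h2l.le]; exact Real.pi_pos.ne),
    Complex.cpow_sub _ _ hne, Complex.cpow_one, Complex.cpow_def_of_ne_zero hne,
    ← Complex.ofReal_log h2l.le, Real.log_mul (by norm_num) hl.ne', ← Complex.exp_add]
  rw [inv_div]
  push_cast at hne ⊢
  rw [mul_div_cancel₀ _ hne]
  congr 1
  ring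

/-- This is the Gamma integral `∫ t^{-iτ} 2λ e^{-2tλ} dt = (2λ)^{iτ} Γ(1 - iτ)` with `λ` the symbol,
integrated in frequency. It turns the imaginary power into a unimodular weight against the time
derivative of `heatForm`. -/
theorem integral_imaginaryPower_mul_Gamma {b : ℝ} (hb : 0 ≤ b) (τ : ℝ) (f g : 𝓢(E, ℂ)) :
    cexp (τ * I * Real.log 2) * Complex.Gamma (1 - τ * I) *
      ∫ ξ, cexp (τ * I * Real.log (helmholtz b ξ)) * 𝓕 f ξ * 𝓕⁻ g ξ
    = ∫ t in Set.Ioi (0 : ℝ), (t : ℂ) ^ (-(τ * I)) *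
        -∫ ξ, (-(2 * helmholtz b ξ * Real.exp (-(2 * t * helmholtz b ξ))) : ℝ)
          * (𝓕 f ξ * 𝓕⁻ g ξ) := by
  have hG := integrable_fourier_mul f g
  have hc := continuous_helmholtz (E := E) b
  have hint : Integrable (fun z : E × ℝ ↦ (z.2 : ℂ) ^ (-(τ * I)) *
      ((2 * helmholtz b z.1 * Real.exp (-(2 * z.2 * helmholtz b z.1)) : ℝ) : ℂ)
        * (𝓕 f z.1 * 𝓕⁻ g z.1))
      ((volume : Measure E).prod (volume.restrict (Set.Ioi (0 : ℝ)))) := by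
    have hm : AEStronglyMeasurable (fun z : E × ℝ ↦ (z.2 : ℂ) ^ (-(τ * I)) *
      ((2 * helmholtz b z.1 * Real.exp (-(2 * z.2 * helmholtz b z.1)) : ℝ) : ℂ)
        * (𝓕 f z.1 * 𝓕⁻ g z.1))
      ((volume : Measure E).prod (volume.restrict (Set.Ioi (0 : ℝ)))) := by
      have h1 : Continuous fun ξ ↦ 𝓕 f ξ * 𝓕⁻ g ξ := (𝓕 f).continuous.mul (𝓕⁻ g).continuous
      have h2 : Measurable fun t : ℝ ↦ (t : ℂ) ^ (-(τ * I)) := by fun_prop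
      have h3 : Continuous fun z : E × ℝ ↦
        ((2 * helmholtz b z.1 * Real.exp (-(2 * z.2 * helmholtz b z.1)) : ℝ) : ℂ) := by fun_prop
      exact (((h2.comp measurable_snd).mul h3.measurable).mul
        (h1.measurable.comp measurable_fst)).aestronglyMeasurable
    have hn : ∀ ξ : E, ∀ t ∈ Set.Ioi (0 : ℝ), ‖(t : ℂ) ^ (-(τ * I)) *
        ((2 * helmholtz b ξ * Real.exp (-(2 * t * helmholtz b ξ)) : ℝ) : ℂ)
          * (𝓕 f ξ * 𝓕⁻ g ξ)‖
        = 2 * helmholtz b ξ * ‖𝓕 f ξ * 𝓕⁻ g ξ‖ * Real.exp (-(2 * helmholtz b ξ) * t) := by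
      intro ξ t ht
      have := one_le_helmholtz hb ξ
      rw [norm_mul, norm_mul, Complex.norm_cpow_eq_rpow_re_of_pos ht, Complex.norm_real,
        Real.norm_of_nonneg (by positivity)]
      simp only [neg_re, mul_re, ofReal_re, I_re, mul_zero, ofReal_im, I_im, mul_one, sub_self,
        neg_zero, Real.rpow_zero, one_mul]
      rw [show -(2 * helmholtz b ξ) * t = -(2 * t * helmholtz b ξ) by ring]
      ring
    rw [integrable_prod_iff hm]
    constructor
    · refine .of_forall fun ξ ↦ ?_
      have h1 := one_le_helmholtz hb ξ
      have h2 : IntegrableOn (fun t : ℝ ↦ 2 * helmholtz b ξ * ‖𝓕 f ξ * 𝓕⁻ g ξ‖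
          * Real.exp (-(2 * helmholtz b ξ) * t)) (Set.Ioi 0) :=
        (integrableOn_exp_mul_Ioi (by linarith) 0).const_mul _
      refine Integrable.mono' h2 ?_ ((ae_restrict_iff' measurableSet_Ioi).2
        (.of_forall fun t ht ↦ (hn ξ t ht).le))
      have h3 : Measurable fun t : ℝ ↦ (t : ℂ) ^ (-(τ * I)) := by fun_prop
      have h4 : Continuous fun t : ℝ ↦
        ((2 * helmholtz b ξ * Real.exp (-(2 * t * helmholtz b ξ)) : ℝ) : ℂ) := by fun_prop
      exact ((h3.mul h4.measurable).mul_const (𝓕 f ξ * 𝓕⁻ g ξ)).aestronglyMeasurable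
    · refine hG.norm.congr (.of_forall fun ξ ↦ ?_)
      have h1 := one_le_helmholtz hb ξ
      have h2 := setIntegral_congr_fun (μ := volume) measurableSet_Ioi (hn ξ)
      refine Eq.symm (Eq.trans h2 ?_)
      rw [integral_const_mul, integral_exp_mul_Ioi (by linarith)]
      simp only [mul_zero, Real.exp_zero]
      field_simp
  calc _ = ∫ ξ, (cexp (τ * I * Real.log 2) * cexp (τ * I * Real.log (helmholtz b ξ))
          * Complex.Gamma (1 - τ * I)) * (𝓕 f ξ * 𝓕⁻ g ξ) := by
        rw [← integral_const_mul]
        congr 1 with ξ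
        ring
    _ = ∫ ξ, ∫ t in Set.Ioi (0 : ℝ), (t : ℂ) ^ (-(τ * I)) *
          ((2 * helmholtz b ξ * Real.exp (-(2 * t * helmholtz b ξ)) : ℝ) : ℂ)
          * (𝓕 f ξ * 𝓕⁻ g ξ) := by
        congr 1 with ξ
        rw [integral_mul_const, integral_cpow_mul_helmholtz_exp τ
          (by linarith [one_le_helmholtz hb ξ])]
    _ = ∫ t in Set.Ioi (0 : ℝ), ∫ ξ, (t : ℂ) ^ (-(τ * I)) *
          ((2 * helmholtz b ξ * Real.exp (-(2 * t * helmholtz b ξ)) : ℝ) : ℂ)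
          * (𝓕 f ξ * 𝓕⁻ g ξ) := integral_integral_swap hint
    _ = _ := by
        refine setIntegral_congr_fun measurableSet_Ioi fun t _ ↦ ?_
        rw [← integral_neg, ← integral_const_mul]
        congr 1 with ξ
        push_cast
        ring

/-- Imaginary powers of `I - bΔ` are bounded on `L^p` for `1 < p < ∞`. -/
theorem isMult_imaginaryPower {b : ℝ} (hb : 0 ≤ b) (τ : ℝ) {p q : ℝ} (hpq : p.HolderConjugate q) :
    IsMult p q (2 * ((32 * (10 * (p + q) + 4) + 1) * Real.exp (Real.pi * |τ|)))
      fun ξ : E ↦ cexp (τ * I * Real.log (helmholtz b ξ)) := by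
  have hp := hpq.pos
  have hq := hpq.symm.pos
  refine isMult_of_rpow_le hp hq (by positivity) fun f g ↦ ?_
  have h1 := setLIntegral_deriv_heatForm_le hb f g hpq
  have h2 := integral_imaginaryPower_mul_Gamma hb τ f g
  have hΓ : Complex.Gamma (1 - τ * I) ≠ 0 := Complex.Gamma_ne_zero_of_re_pos (by simp)
  set S := (∫ x, ‖f x‖ ^ p) + ∫ x, ‖g x‖ ^ q with hS
  have hS0 : 0 ≤ S := add_nonneg (integral_nonneg fun x ↦ by positivity)
    (integral_nonneg fun x ↦ by positivity)
  set J := ∫ ξ, cexp (τ * I * Real.log (helmholtz b ξ)) * 𝓕 f ξ * 𝓕⁻ g ξ with hJ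
  -- The weight `t^{-iτ}` has modulus one, so only the total variation of the heat form remains.
  have h3 : ‖Complex.Gamma (1 - τ * I)‖ * ‖J‖ ≤ (32 * (10 * (p + q) + 4) + 1) * S := by
    have e : ‖Complex.Gamma (1 - τ * I)‖ * ‖J‖
        = ‖cexp (τ * I * Real.log 2) * Complex.Gamma (1 - τ * I) * J‖ := by
      rw [norm_mul, norm_mul, show (τ : ℂ) * I * Real.log 2 = ((τ * Real.log 2 : ℝ) : ℂ) * I by
        push_cast; ring, Complex.norm_exp_ofReal_mul_I, one_mul]
    rw [e, h2]
    refine (ENNReal.ofReal_le_ofReal_iff (by positivity)).1 ?_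
    rw [ofReal_norm]
    refine (enorm_integral_le_lintegral_enorm _).trans (le_trans (le_of_eq ?_) h1)
    refine setLIntegral_congr_fun measurableSet_Ioi fun t ht ↦ ?_
    rw [enorm_mul, enorm_neg]
    have : ‖(t : ℂ) ^ (-(τ * I))‖ₑ = 1 := by
      rw [← ofReal_norm, Complex.norm_cpow_eq_rpow_re_of_pos ht]
      simp
    rw [this, one_mul]
  have h4 := norm_inv_Gamma_one_sub_le τ
  calc ‖J‖ = ‖(Complex.Gamma (1 - τ * I))⁻¹‖ * (‖Complex.Gamma (1 - τ * I)‖ * ‖J‖) := by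
        rw [norm_inv, inv_mul_cancel_left₀ (norm_ne_zero_iff.2 hΓ)]
    _ ≤ Real.exp (Real.pi * |τ|) * ((32 * (10 * (p + q) + 4) + 1) * S) := by gcongr
    _ = _ := by ring

end ImaginaryPowers

/-! ### Hölder's inequality for pairings. -/

section Holder

theorem enorm_integral_mul_le_eLpNorm {α : Type*} [MeasurableSpace α] {μ : Measure α}
    {f g : α → ℂ} {p q : ℝ} (hpq : p.HolderConjugate q) (hf : AEStronglyMeasurable f μ)
    (hg : AEStronglyMeasurable g μ) :
    ‖∫ x, f x * g x ∂μ‖ₑ ≤ eLpNorm f (ENNReal.ofReal p) μ * eLpNorm g (ENNReal.ofReal q) μ := by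
  have := hpq.ennrealOfReal
  refine (enorm_integral_le_lintegral_enorm _).trans ?_
  rw [← eLpNorm_one_eq_lintegral_enorm]
  exact eLpNorm_smul_le_mul_eLpNorm (φ := f) (f := g) (r := 1) hg hf

end Holder

/-! ### Logarithms of symbols as multipliers, by Frullani's formula. -/

section LogSymbol

variable {E : Type*} [NormedAddCommGroup E] [InnerProductSpace ℝ E] [FiniteDimensional ℝ E]
  [MeasurableSpace E] [BorelSpace E]

theorem norm_integral_mul_le_lpNormReal {f g : E → ℂ} {p q : ℝ} (hpq : p.HolderConjugate q)
    (hf : MemLp f (ENNReal.ofReal p)) (hg : MemLp g (ENNReal.ofReal q)) :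
    ‖∫ x, f x * g x‖ ≤ lpNormReal p f * lpNormReal q g := by
  have h := enorm_integral_mul_le_eLpNorm hpq hf.1 hg.1
  have h2 := ENNReal.toReal_mono (ENNReal.mul_ne_top hf.eLpNorm_ne_top hg.eLpNorm_ne_top) h
  rwa [ENNReal.toReal_mul, toReal_enorm] at h2

theorem IsMult.mono {r r' M M' : ℝ} {m : E → ℂ} (h : IsMult r r' M m) (hM : M ≤ M') :
    IsMult r r' M' m := fun f g ↦ (h f g).trans (by
  have := lpNormReal_nonneg r f
  have := lpNormReal_nonneg r' g
  gcongr)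

theorem norm_integral_translate_mul_le {p q : ℝ} (hpq : p.HolderConjugate q) (f g : 𝓢(E, ℂ))
    (y : E) : ‖∫ ξ, cexp ((2 * Real.pi * inner ℝ y ξ : ℝ) * I) * (𝓕 f ξ * 𝓕⁻ g ξ)‖
      ≤ lpNormReal p f * lpNormReal q g := by
  rw [← integral_translate_mul]
  have h1 : lpNormReal p (SchwartzMap.compSubConstCLM ℂ (-y) f) = lpNormReal p f := by
    unfold lpNormReal
    congr 1
    exact eLpNorm_comp_measurePreserving (g := f) (f := fun x : E ↦ x - -y)
      f.continuous.aestronglyMeasurable (measurePreserving_sub_right volume (-y))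
  have h2 := norm_integral_mul_le_lpNormReal hpq
    ((SchwartzMap.compSubConstCLM ℂ (-y) f).memLp (ENNReal.ofReal p) volume)
    (g.memLp (ENNReal.ofReal q) volume)
  rw [h1] at h2
  simpa only [SchwartzMap.compSubConstCLM_apply, sub_neg_eq_add] using h2

/-- A character is the symbol of a translation, an isometry of `L^p`. A superposition of characters
is therefore bounded by the total mass of its coefficients. -/
theorem isMult_integral_character {p q : ℝ} (hpq : p.HolderConjugate q) (γ : Measure E)
    [IsProbabilityMeasure γ] {a : E → ℂ} (ha : Continuous a) {M : ℝ} (hM : ∀ y, ‖a y‖ ≤ M) :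
    IsMult p q (∫ y, ‖a y‖ ∂γ) fun ξ ↦
      ∫ y, a y * cexp ((2 * Real.pi * inner ℝ y ξ : ℝ) * I) ∂γ := by
  intro f g
  have hG := integrable_fourier_mul f g
  have hint : Integrable (fun z : E × E ↦ a z.2 * cexp ((2 * Real.pi * inner ℝ z.2 z.1 : ℝ) * I)
      * (𝓕 f z.1 * 𝓕⁻ g z.1)) ((volume : Measure E).prod γ) := by
    refine Integrable.bdd_mul (c := M) (hG.comp_fst γ) ?_ (.of_forall fun z ↦ ?_)
    · exact (by fun_prop : Continuous fun z : E × E ↦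
        a z.2 * cexp ((2 * Real.pi * inner ℝ z.2 z.1 : ℝ) * I)).aestronglyMeasurable
    · rw [norm_mul, Complex.norm_exp_ofReal_mul_I, mul_one]
      exact hM _
  have e : ∫ ξ, (∫ y, a y * cexp ((2 * Real.pi * inner ℝ y ξ : ℝ) * I) ∂γ) * 𝓕 f ξ * 𝓕⁻ g ξ
      = ∫ y, a y * (∫ ξ, cexp ((2 * Real.pi * inner ℝ y ξ : ℝ) * I) * (𝓕 f ξ * 𝓕⁻ g ξ)) ∂γ := by
    calc _ = ∫ ξ, (∫ y, a y * cexp ((2 * Real.pi * inner ℝ y ξ : ℝ) * I)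
            * (𝓕 f ξ * 𝓕⁻ g ξ) ∂γ) := by
          congr 1 with ξ
          rw [integral_mul_const, mul_assoc]
      _ = ∫ y, (∫ ξ, a y * cexp ((2 * Real.pi * inner ℝ y ξ : ℝ) * I)
            * (𝓕 f ξ * 𝓕⁻ g ξ)) ∂γ := integral_integral_swap hint
      _ = _ := by
          congr 1 with y
          rw [← integral_const_mul]
          simp only [mul_assoc]
  rw [e, mul_assoc, ← integral_mul_const]
  have hai : Integrable (fun y ↦ ‖a y‖) γ :=
    (Integrable.of_bound ha.aestronglyMeasurable M (.of_forall hM)).norm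
  refine norm_integral_le_of_norm_le (hai.mul_const _) (.of_forall fun y ↦ ?_)
  rw [norm_mul]
  gcongr
  exact norm_integral_translate_mul_le hpq f g y

theorem integral_character_heatMeasure {t : ℝ} (ht : 0 ≤ t) (ξ : E) :
    ∫ y, cexp ((2 * Real.pi * inner ℝ y ξ : ℝ) * I) ∂(heatMeasure E t)
      = (Real.exp (-(t * (4 * Real.pi ^ 2 * ‖ξ‖ ^ 2))) : ℝ) := by
  have h := charFun_heatMeasure ht ((2 * Real.pi) • ξ)
  rw [charFun_apply] at h
  simp only [inner_smul_right] at h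
  rw [h, Complex.ofReal_exp, norm_smul, Real.norm_of_nonneg (by positivity)]
  congr 1
  push_cast
  ring

/-- Shifting a Gaussian symbol by `η` multiplies its kernel by a character. The difference thus
becomes a superposition of characters with an explicit coefficient, as `isMult_integral_character`
requires. -/
theorem exp_sub_exp_eq_integral_heatMeasure {t : ℝ} (ht : 0 ≤ t) (κ : ℝ) (ξ η : E) :
    ((Real.exp (-(t * (κ + 4 * Real.pi ^ 2 * ‖ξ‖ ^ 2)))
      - Real.exp (-(t * helmholtz 1 (ξ + η))) : ℝ) : ℂ)
      = ∫ y, ((Real.exp (-(t * κ)) : ℂ) - Real.exp (-t) *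
          cexp ((2 * Real.pi * inner ℝ y η : ℝ) * I)) *
          cexp ((2 * Real.pi * inner ℝ y ξ : ℝ) * I) ∂(heatMeasure E t) := by
  have hi : ∀ ζ : E, Integrable (fun y ↦ cexp ((2 * Real.pi * inner ℝ y ζ : ℝ) * I))
      (heatMeasure E t) := fun ζ ↦ by
    refine Integrable.of_bound (C := 1) (by fun_prop : Continuous fun y : E ↦
      cexp ((2 * Real.pi * inner ℝ y ζ : ℝ) * I)).aestronglyMeasurable (.of_forall fun y ↦ ?_)
    rw [Complex.norm_exp_ofReal_mul_I]
  have e : ∀ y : E, ((Real.exp (-(t * κ)) : ℂ) - Real.exp (-t) *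
          cexp ((2 * Real.pi * inner ℝ y η : ℝ) * I)) *
          cexp ((2 * Real.pi * inner ℝ y ξ : ℝ) * I)
      = (Real.exp (-(t * κ)) : ℂ) * cexp ((2 * Real.pi * inner ℝ y ξ : ℝ) * I)
        - Real.exp (-t) * cexp ((2 * Real.pi * inner ℝ y (ξ + η) : ℝ) * I) := fun y ↦ by
    rw [sub_mul, mul_assoc (Real.exp (-t) : ℂ), ← Complex.exp_add, inner_add_right]
    congr 3
    push_cast
    ring
  simp only [e]
  rw [integral_sub ((hi ξ).const_mul _) ((hi (ξ + η)).const_mul _), integral_const_mul,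
    integral_const_mul, integral_character_heatMeasure ht, integral_character_heatMeasure ht,
    ← Complex.ofReal_mul, ← Complex.ofReal_mul, ← Real.exp_add, ← Real.exp_add,
    ← Complex.ofReal_sub]
  simp only [helmholtz]
  ring_nf

theorem integrable_norm_heatMeasure (t : ℝ) :
    Integrable (fun y : E ↦ ‖y‖) (heatMeasure E t) := by
  rw [heatMeasure, integrable_map_measure (by fun_prop) (by fun_prop)]
  have h := (ProbabilityTheory.IsGaussian.integrable_id
    (μ := ProbabilityTheory.stdGaussian E)).norm.const_mul (√(2 * t))
  refine h.congr (.of_forall fun y ↦ ?_)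
  simp [norm_smul, abs_of_nonneg (Real.sqrt_nonneg _)]

theorem integral_norm_heatMeasure (t : ℝ) : ∫ y, ‖y‖ ∂(heatMeasure E t)
    = √(2 * t) * ∫ y, ‖y‖ ∂(ProbabilityTheory.stdGaussian E) := by
  rw [heatMeasure, integral_map (by fun_prop) (by fun_prop), ← integral_const_mul]
  congr 1 with y
  rw [norm_smul, Real.norm_of_nonneg (Real.sqrt_nonneg _)]

variable (E) in
/-- A constant controlling the modulus of continuity of the heat symbols. -/
noncomputable def heatConst : ℝ :=
  2 * Real.pi * (√2 * ∫ y, ‖y‖ ∂(ProbabilityTheory.stdGaussian E))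

theorem heatConst_nonneg : 0 ≤ heatConst E := by
  have : 0 ≤ ∫ y, ‖y‖ ∂(ProbabilityTheory.stdGaussian E) := integral_nonneg fun y ↦ norm_nonneg y
  unfold heatConst
  positivity

/-- Either `|1 - e^{iα}| ≤ 2`, or `|1 - e^{iα}| ≤ |α|` together with the first moment of the
Gaussian, which is proportional to `√t`. -/
theorem integral_norm_character_sub_le (t κ : ℝ) (η : E) :
    ∫ y, ‖(Real.exp (-(t * κ)) : ℂ) - Real.exp (-t) *
          cexp ((2 * Real.pi * inner ℝ y η : ℝ) * I)‖ ∂(heatMeasure E t)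
      ≤ |Real.exp (-(t * κ)) - Real.exp (-t)|
        + Real.exp (-t) * min 2 (heatConst E * ‖η‖ * √t) := by
  have hb : ∀ y : E, ‖1 - cexp ((2 * Real.pi * inner ℝ y η : ℝ) * I)‖
      ≤ 2 * Real.pi * ‖η‖ * ‖y‖ := fun y ↦ by
    have h := Real.norm_exp_I_mul_ofReal_sub_one_le (x := 2 * Real.pi * inner ℝ y η)
    rw [norm_sub_rev, mul_comm _ I]
    refine h.trans ?_
    rw [norm_mul, Real.norm_of_nonneg (by positivity)]
    have := norm_inner_le_norm (𝕜 := ℝ) y η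
    calc _ ≤ 2 * Real.pi * (‖y‖ * ‖η‖) := by gcongr
      _ = _ := by ring
  have hb2 : ∀ y : E, ‖1 - cexp ((2 * Real.pi * inner ℝ y η : ℝ) * I)‖ ≤ 2 := fun y ↦ by
    refine (norm_sub_le _ _).trans ?_
    rw [Complex.norm_exp_ofReal_mul_I]
    norm_num
  have hp : ∀ y : E, ‖(Real.exp (-(t * κ)) : ℂ) - Real.exp (-t) *
          cexp ((2 * Real.pi * inner ℝ y η : ℝ) * I)‖
      ≤ |Real.exp (-(t * κ)) - Real.exp (-t)|
        + Real.exp (-t) * ‖1 - cexp ((2 * Real.pi * inner ℝ y η : ℝ) * I)‖ := fun y ↦ by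
    have e : (Real.exp (-(t * κ)) : ℂ) - Real.exp (-t) *
          cexp ((2 * Real.pi * inner ℝ y η : ℝ) * I)
        = ((Real.exp (-(t * κ)) - Real.exp (-t) : ℝ) : ℂ)
          + (Real.exp (-t) : ℂ) * (1 - cexp ((2 * Real.pi * inner ℝ y η : ℝ) * I)) := by
      push_cast; ring
    rw [e]
    refine (norm_add_le _ _).trans (le_of_eq ?_)
    rw [norm_mul, Complex.norm_real, Complex.norm_real, Real.norm_of_nonneg (Real.exp_pos _).le,
      Real.norm_eq_abs]
  have hci : Continuous fun y : E ↦ ‖1 - cexp ((2 * Real.pi * inner ℝ y η : ℝ) * I)‖ := by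
    fun_prop
  have hi1 : Integrable (fun y : E ↦ ‖1 - cexp ((2 * Real.pi * inner ℝ y η : ℝ) * I)‖)
      (heatMeasure E t) :=
    Integrable.of_bound (C := 2) hci.aestronglyMeasurable (.of_forall fun y ↦ by
      rw [norm_norm]; exact hb2 y)
  have hi2 : Integrable (fun y : E ↦ |Real.exp (-(t * κ)) - Real.exp (-t)|
        + Real.exp (-t) * ‖1 - cexp ((2 * Real.pi * inner ℝ y η : ℝ) * I)‖) (heatMeasure E t) :=
    (integrable_const _).add (hi1.const_mul _)
  have hi0 : Integrable (fun y : E ↦ ‖(Real.exp (-(t * κ)) : ℂ) - Real.exp (-t) *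
          cexp ((2 * Real.pi * inner ℝ y η : ℝ) * I)‖) (heatMeasure E t) := by
    refine hi2.mono' (by fun_prop : Continuous fun y : E ↦ ‖(Real.exp (-(t * κ)) : ℂ)
      - Real.exp (-t) * cexp ((2 * Real.pi * inner ℝ y η : ℝ) * I)‖).aestronglyMeasurable
      (.of_forall fun y ↦ ?_)
    rw [norm_norm]
    exact hp y
  refine (integral_mono hi0 hi2 hp).trans ?_
  rw [integral_add (integrable_const _) (hi1.const_mul _), integral_const_mul]
  simp only [integral_const, probReal_univ, one_smul]
  gcongr
  refine le_min ?_ ?_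
  · refine (integral_mono hi1 (integrable_const 2) hb2).trans ?_
    simp
  · refine (integral_mono hi1 ((integrable_norm_heatMeasure t).const_mul _) hb).trans ?_
    rw [integral_const_mul, integral_norm_heatMeasure, Real.sqrt_mul (by norm_num), heatConst]
    apply le_of_eq
    ring

/-- An integrable majorant for the Frullani integral of the heat symbols. -/
noncomputable def frullaniMajorant (κ A δ t : ℝ) : ℝ :=
  |κ - 1| * Real.exp (-(min κ 1) * t) + 2 * Real.exp (-1 * t)
    + (Set.Ioc 0 δ).indicator (fun t ↦ A * t ^ (-(1 / 2) : ℝ)) t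
    + (Set.Ioc δ 1).indicator (fun t ↦ 2 * t⁻¹) t

theorem abs_exp_sub_exp_le (a b : ℝ) :
    |Real.exp (-a) - Real.exp (-b)| ≤ |a - b| * Real.exp (-(min a b)) := by
  wlog h : a ≤ b generalizing a b
  · have := this b a (le_of_not_ge h)
    rwa [abs_sub_comm, abs_sub_comm a, min_comm]
  rw [min_eq_left h, abs_of_nonneg (sub_nonneg.2 (Real.exp_le_exp.2 (by linarith))),
    abs_sub_comm, abs_of_nonneg (sub_nonneg.2 h)]
  have h1 : Real.exp (-b) = Real.exp (-a) * Real.exp (-(b - a)) := by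
    rw [← Real.exp_add]; congr 1; ring
  have h2 := Real.add_one_le_exp (-(b - a))
  have h3 := Real.exp_pos (-a)
  rw [h1]
  nlinarith

/-- Below `δ` the bound `A √t` leaves the integrable power `t^{-1/2}`. Between `δ` and `1` the bound
`2` leaves `2/t`, the source of the logarithm, and beyond `1` the exponential decays. -/
theorem inv_mul_le_frullaniMajorant {κ A δ t : ℝ} (hA : 0 ≤ A) (ht : 0 < t) :
    t⁻¹ * (|Real.exp (-(t * κ)) - Real.exp (-t)| + Real.exp (-t) * min 2 (A * √t))
      ≤ frullaniMajorant κ A δ t := by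
  have h1 : t⁻¹ * |Real.exp (-(t * κ)) - Real.exp (-t)|
      ≤ |κ - 1| * Real.exp (-(min κ 1) * t) := by
    have h := abs_exp_sub_exp_le (t * κ) (t * 1)
    rw [← mul_sub, abs_mul, abs_of_pos ht, ← mul_min_of_nonneg _ _ ht.le] at h
    rw [inv_mul_le_iff₀ ht]
    refine (le_of_eq (by rw [mul_one])).trans (h.trans (le_of_eq ?_))
    rw [show -(t * min κ 1) = -(min κ 1) * t by ring]
    ring
  have he : Real.exp (-t) ≤ 1 := Real.exp_le_one_iff.2 (by linarith)
  have hmin : 0 ≤ min 2 (A * √t) := le_min (by norm_num) (by positivity)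
  have h2 : t⁻¹ * (Real.exp (-t) * min 2 (A * √t)) ≤ 2 * Real.exp (-1 * t)
    + (Set.Ioc 0 δ).indicator (fun t ↦ A * t ^ (-(1 / 2) : ℝ)) t
    + (Set.Ioc δ 1).indicator (fun t ↦ 2 * t⁻¹) t := by
    have i1 : 0 ≤ (Set.Ioc 0 δ).indicator (fun t ↦ A * t ^ (-(1 / 2) : ℝ)) t :=
      Set.indicator_nonneg (fun s hs ↦ mul_nonneg hA (Real.rpow_nonneg hs.1.le _)) t
    by_cases c1 : t ≤ δ
    · rw [Set.indicator_of_mem (show t ∈ Set.Ioc 0 δ from ⟨ht, c1⟩),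
        Set.indicator_of_notMem (fun h ↦ absurd h.1 (not_lt.2 c1))]
      have : t⁻¹ * (Real.exp (-t) * min 2 (A * √t)) ≤ A * t ^ (-(1 / 2) : ℝ) := by
        rw [inv_mul_le_iff₀ ht]
        calc _ ≤ 1 * (A * √t) := by
              gcongr
              exact min_le_right _ _
          _ = t * (A * t ^ (-(1 / 2) : ℝ)) := by
              rw [Real.sqrt_eq_rpow, show (1 / 2 : ℝ) = 1 + -(1 / 2) by norm_num,
                Real.rpow_add ht, Real.rpow_one]
              ring_nf
      have := Real.exp_pos (-1 * t)
      linarith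
    · by_cases c2 : t ≤ 1
      · rw [Set.indicator_of_mem (show t ∈ Set.Ioc δ 1 from ⟨not_le.1 c1, c2⟩)]
        have : t⁻¹ * (Real.exp (-t) * min 2 (A * √t)) ≤ 2 * t⁻¹ := by
          rw [mul_comm]
          gcongr
          calc _ ≤ 1 * (2 : ℝ) := by
                gcongr
                exact min_le_left _ _
            _ = 2 := one_mul _
        have := Real.exp_pos (-1 * t)
        linarith
      · have i2 : (Set.Ioc δ 1).indicator (fun t ↦ 2 * t⁻¹) t = 0 :=
          Set.indicator_of_notMem (fun h ↦ c2 h.2) _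
        have h3 : t⁻¹ ≤ 1 := inv_le_one_of_one_le₀ (not_le.1 c2).le
        have : t⁻¹ * (Real.exp (-t) * min 2 (A * √t)) ≤ 2 * Real.exp (-1 * t) := by
          calc _ ≤ 1 * (Real.exp (-t) * 2) := by
                gcongr
                exact min_le_left _ _
            _ = _ := by ring_nf
        linarith
  rw [mul_add, frullaniMajorant]
  linarith

theorem integrableOn_frullaniMajorant {κ A δ : ℝ} (hκ : 0 < κ) (hδ : 0 < δ) (hδ1 : δ ≤ 1) :
    IntegrableOn (frullaniMajorant κ A δ) (Set.Ioi 0) ∧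
      ∫ t in Set.Ioi 0, frullaniMajorant κ A δ t
        = |κ - 1| / min κ 1 + 2 + 2 * A * √δ - 2 * Real.log δ := by
  have hm : 0 < min κ 1 := lt_min hκ one_pos
  have i1 : IntegrableOn (fun t ↦ |κ - 1| * Real.exp (-(min κ 1) * t)) (Set.Ioi 0) :=
    (integrableOn_exp_mul_Ioi (by linarith) 0).const_mul _
  have i2 : IntegrableOn (fun t : ℝ ↦ 2 * Real.exp (-1 * t)) (Set.Ioi 0) :=
    (integrableOn_exp_mul_Ioi (by norm_num) 0).const_mul _
  have j3 : IntervalIntegrable (fun t : ℝ ↦ A * t ^ (-(1 / 2) : ℝ)) volume 0 δ :=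
    (intervalIntegral.intervalIntegrable_rpow' (by norm_num)).const_mul _
  have j4 : IntervalIntegrable (fun t : ℝ ↦ 2 * t⁻¹) volume δ 1 := by
    refine ContinuousOn.intervalIntegrable ?_
    rw [Set.uIcc_of_le hδ1]
    exact continuousOn_const.mul (continuousOn_inv₀.mono fun x hx ↦ (hδ.trans_le hx.1).ne')
  have s3 : Set.Ioc 0 δ ∩ Set.Ioi 0 = Set.Ioc 0 δ := Set.inter_eq_left.2 fun x hx ↦ hx.1
  have s4 : Set.Ioc δ 1 ∩ Set.Ioi 0 = Set.Ioc δ 1 :=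
    Set.inter_eq_left.2 fun x hx ↦ hδ.trans hx.1
  have i3 : IntegrableOn ((Set.Ioc 0 δ).indicator (fun t ↦ A * t ^ (-(1 / 2) : ℝ)))
      (Set.Ioi 0) := by
    rw [IntegrableOn, integrable_indicator_iff measurableSet_Ioc, IntegrableOn,
      Measure.restrict_restrict measurableSet_Ioc, s3]
    exact (intervalIntegrable_iff_integrableOn_Ioc_of_le hδ.le).1 j3
  have i4 : IntegrableOn ((Set.Ioc δ 1).indicator (fun t ↦ 2 * t⁻¹)) (Set.Ioi 0) := by
    rw [IntegrableOn, integrable_indicator_iff measurableSet_Ioc, IntegrableOn,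
      Measure.restrict_restrict measurableSet_Ioc, s4]
    exact (intervalIntegrable_iff_integrableOn_Ioc_of_le hδ1).1 j4
  refine ⟨((i1.add i2).add i3).add i4, ?_⟩
  have e := (integral_add ((i1.add i2).add i3) i4).trans
    (congrArg₂ (· + ·) ((integral_add (i1.add i2) i3).trans
      (congrArg₂ (· + ·) (integral_add i1 i2) rfl)) rfl)
  refine e.trans ?_
  rw [integral_const_mul, integral_const_mul, integral_exp_mul_Ioi (by linarith),
    integral_exp_mul_Ioi (by norm_num), integral_indicator measurableSet_Ioc,
    integral_indicator measurableSet_Ioc, Measure.restrict_restrict measurableSet_Ioc,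
    Measure.restrict_restrict measurableSet_Ioc, s3, s4,
    ← intervalIntegral.integral_of_le hδ.le, ← intervalIntegral.integral_of_le hδ1,
    intervalIntegral.integral_const_mul, intervalIntegral.integral_const_mul,
    integral_rpow (Or.inl (by norm_num)), integral_inv_of_pos hδ one_pos, one_div δ,
    Real.log_inv]
  have e3 : δ ^ (-(1 / 2) + 1 : ℝ) = √δ := by rw [Real.sqrt_eq_rpow]; norm_num
  rw [e3, Real.zero_rpow (by norm_num)]
  simp only [mul_zero, Real.exp_zero]
  field_simp
  ring

theorem integral_frullani {A B : ℝ} (hA : 0 < A) (hB : 0 < B) :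
    IntegrableOn (fun t : ℝ ↦ t⁻¹ * (Real.exp (-(t * B)) - Real.exp (-(t * A)))) (Set.Ioi 0) ∧
    ∫ t in Set.Ioi (0 : ℝ), |t⁻¹ * (Real.exp (-(t * B)) - Real.exp (-(t * A)))|
      ≤ |B - A| / min A B ∧
    ∫ t in Set.Ioi (0 : ℝ), t⁻¹ * (Real.exp (-(t * B)) - Real.exp (-(t * A)))
      = Real.log A - Real.log B := by
  have hm : 0 < min A B := lt_min hA hB
  have hb : ∀ t ∈ Set.Ioi (0 : ℝ), |t⁻¹ * (Real.exp (-(t * B)) - Real.exp (-(t * A)))|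
      ≤ |B - A| * Real.exp (-(min A B) * t) := by
    intro t ht
    have ht : 0 < t := ht
    have h := abs_exp_sub_exp_le (t * B) (t * A)
    rw [← mul_sub, abs_mul, abs_of_pos ht, ← mul_min_of_nonneg _ _ ht.le, min_comm] at h
    rw [abs_mul, abs_of_pos (inv_pos.2 ht), inv_mul_le_iff₀ ht]
    refine h.trans (le_of_eq ?_)
    rw [show -(t * min A B) = -(min A B) * t by ring]
    ring
  have hbi : IntegrableOn (fun t : ℝ ↦ |B - A| * Real.exp (-(min A B) * t)) (Set.Ioi 0) :=
    (integrableOn_exp_mul_Ioi (by linarith) 0).const_mul _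
  have hi : IntegrableOn (fun t : ℝ ↦ t⁻¹ * (Real.exp (-(t * B)) - Real.exp (-(t * A))))
      (Set.Ioi 0) := by
    refine Integrable.mono' hbi (by fun_prop : Measurable fun t : ℝ ↦
      t⁻¹ * (Real.exp (-(t * B)) - Real.exp (-(t * A)))).aestronglyMeasurable
      ((ae_restrict_iff' measurableSet_Ioi).2 (.of_forall hb))
  refine ⟨hi, ?_, ?_⟩
  · refine (setIntegral_mono_on hi.abs hbi measurableSet_Ioi hb).trans (le_of_eq ?_)
    rw [integral_const_mul, integral_exp_mul_Ioi (by linarith)]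
    simp only [mul_zero, Real.exp_zero]
    field_simp
  · have hc : Continuous fun x : ℝ ↦ Real.exp (-x) := by fun_prop
    have h := Frullani.integral_Ioi_eq (f := fun x : ℝ ↦ Real.exp (-x)) (a := B) (b := A)
      (L := 1) (R := 0) (hc.locallyIntegrable.locallyIntegrableOn _) hB hA ?_ ?_ ?_
    · rw [← Real.log_div hA.ne' hB.ne']
      simpa [mul_comm] using h
    · have := hc.tendsto 0
      simp only [neg_zero, Real.exp_zero] at this
      exact this.mono_left nhdsWithin_le_nhds
    · exact Real.tendsto_exp_neg_atTop_nhds_zero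
    · simpa [mul_comm] using hi

/-- Frullani's formula `log A - log B = ∫ (e^{-tB} - e^{-tA}) dt/t` reduces the claim to Gaussian
symbols at each `t`. The growth in `η` must be only logarithmic, because this symbol is
exponentiated later. -/
theorem isMult_log_sub {κ : ℝ} (hκ : 0 < κ) (η : E) {p q : ℝ} (hpq : p.HolderConjugate q) :
    IsMult p q (|κ - 1| / min κ 1 + 2 + 2 * heatConst E + 4 * Real.log (1 + ‖η‖)) fun ξ : E ↦
      ((Real.log (helmholtz 1 (ξ + η)) - Real.log (κ + 4 * Real.pi ^ 2 * ‖ξ‖ ^ 2) : ℝ) : ℂ) := by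
  intro f g
  have hG := integrable_fourier_mul f g
  have hG2 := integrable_sq_mul_fourier_mul f g
  have hGc : Continuous fun ξ ↦ 𝓕 f ξ * 𝓕⁻ g ξ := (𝓕 f).continuous.mul (𝓕⁻ g).continuous
  have hc := continuous_helmholtz (E := E) 1
  have hX : ∀ ξ : E, 0 ≤ 4 * Real.pi ^ 2 * ‖ξ‖ ^ 2 := fun ξ ↦ by positivity
  have hA : ∀ ξ : E, 0 < helmholtz 1 (ξ + η) := fun ξ ↦
    one_pos.trans_le (one_le_helmholtz zero_le_one _)
  have hB : ∀ ξ : E, 0 < κ + 4 * Real.pi ^ 2 * ‖ξ‖ ^ 2 := fun ξ ↦ by linarith [hX ξ]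
  have hm : 0 < min κ 1 := lt_min hκ one_pos
  set D : E → ℝ → ℝ := fun ξ t ↦ t⁻¹ * (Real.exp (-(t * (κ + 4 * Real.pi ^ 2 * ‖ξ‖ ^ 2)))
    - Real.exp (-(t * helmholtz 1 (ξ + η)))) with hD
  have hint : Integrable (fun z : E × ℝ ↦ (D z.1 z.2 : ℂ) * (𝓕 f z.1 * 𝓕⁻ g z.1))
      ((volume : Measure E).prod (volume.restrict (Set.Ioi (0 : ℝ)))) := by
    have hme : AEStronglyMeasurable (fun z : E × ℝ ↦ (D z.1 z.2 : ℂ) * (𝓕 f z.1 * 𝓕⁻ g z.1))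
        ((volume : Measure E).prod (volume.restrict (Set.Ioi (0 : ℝ)))) := by
      have h1 : Measurable fun z : E × ℝ ↦ z.2⁻¹ := measurable_snd.inv
      have h2 : Continuous fun z : E × ℝ ↦
        Real.exp (-(z.2 * (κ + 4 * Real.pi ^ 2 * ‖z.1‖ ^ 2)))
          - Real.exp (-(z.2 * helmholtz 1 (z.1 + η))) := by fun_prop
      exact ((Complex.measurable_ofReal.comp (h1.mul h2.measurable)).mul
        (hGc.measurable.comp measurable_fst)).aestronglyMeasurable
    rw [integrable_prod_iff hme]
    constructor
    · refine .of_forall fun ξ ↦ ?_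
      exact (integral_frullani (hA ξ) (hB ξ)).1.ofReal.mul_const (𝓕 f ξ * 𝓕⁻ g ξ)
    -- This bound, quadratic in `ξ`, serves only to justify Fubini; the decay of the Schwartz
    -- functions absorbs it.
    · have hbi : Integrable fun ξ ↦ (κ + 1 + 8 * Real.pi ^ 2 * ‖η‖ ^ 2) / min κ 1
          * ‖𝓕 f ξ * 𝓕⁻ g ξ‖ + 12 * Real.pi ^ 2 / min κ 1 *
            ‖((‖ξ‖ ^ 2 : ℝ) : ℂ) * (𝓕 f ξ * 𝓕⁻ g ξ)‖ :=
        (hG.norm.const_mul _).add (hG2.norm.const_mul _)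
      refine hbi.mono' hme.norm.integral_prod_right' (.of_forall fun ξ ↦ ?_)
      rw [Real.norm_of_nonneg (integral_nonneg fun t ↦ norm_nonneg _)]
      simp only [norm_mul, Complex.norm_real, norm_pow, norm_norm]
      rw [integral_mul_const]
      have h1 := (integral_frullani (hA ξ) (hB ξ)).2.1
      have h2 : |κ + 4 * Real.pi ^ 2 * ‖ξ‖ ^ 2 - helmholtz 1 (ξ + η)|
          ≤ κ + 1 + 8 * Real.pi ^ 2 * ‖η‖ ^ 2 + 12 * Real.pi ^ 2 * ‖ξ‖ ^ 2 := by
        have h3 : ‖ξ + η‖ ^ 2 ≤ 2 * ‖ξ‖ ^ 2 + 2 * ‖η‖ ^ 2 := by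
          have := norm_add_le ξ η
          nlinarith [norm_nonneg (ξ + η), sq_nonneg (‖ξ‖ - ‖η‖)]
        have h4 : 4 * Real.pi ^ 2 * ‖ξ + η‖ ^ 2
            ≤ 4 * Real.pi ^ 2 * (2 * ‖ξ‖ ^ 2 + 2 * ‖η‖ ^ 2) := by gcongr
        have h5 := hX ξ
        have h6 := hX η
        have h7 := hX (ξ + η)
        rw [abs_le, helmholtz]
        constructor <;> linarith
      have h3 : min κ 1 ≤ min (helmholtz 1 (ξ + η)) (κ + 4 * Real.pi ^ 2 * ‖ξ‖ ^ 2) :=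
        le_min ((min_le_right _ _).trans (one_le_helmholtz zero_le_one _))
          ((min_le_left _ _).trans (by linarith [hX ξ]))
      have h4 : ∫ t in Set.Ioi (0 : ℝ), ‖D ξ t‖
          ≤ (κ + 1 + 8 * Real.pi ^ 2 * ‖η‖ ^ 2 + 12 * Real.pi ^ 2 * ‖ξ‖ ^ 2) / min κ 1 := by
        refine h1.trans ?_
        gcongr
      calc _ ≤ (κ + 1 + 8 * Real.pi ^ 2 * ‖η‖ ^ 2 + 12 * Real.pi ^ 2 * ‖ξ‖ ^ 2) / min κ 1
            * (‖𝓕 f ξ‖ * ‖𝓕⁻ g ξ‖) := by gcongr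
        _ = _ := by ring
  have e : ∫ ξ, ((Real.log (helmholtz 1 (ξ + η)) - Real.log (κ + 4 * Real.pi ^ 2 * ‖ξ‖ ^ 2) : ℝ)
        : ℂ) * 𝓕 f ξ * 𝓕⁻ g ξ
      = ∫ t in Set.Ioi (0 : ℝ), ∫ ξ, (D ξ t : ℂ) * (𝓕 f ξ * 𝓕⁻ g ξ) := by
    rw [← integral_integral_swap hint]
    congr 1 with ξ
    rw [integral_mul_const, integral_complex_ofReal, (integral_frullani (hA ξ) (hB ξ)).2.2, mul_assoc]
  -- With this choice `‖η‖ √δ ≤ 1`, while `-2 log δ = 4 log (1 + ‖η‖)`.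
  set δ := ((1 + ‖η‖) ^ 2)⁻¹ with hδ
  have h1η : 1 ≤ 1 + ‖η‖ := by linarith [norm_nonneg η]
  have hδ0 : 0 < δ := by positivity
  have hδ1 : δ ≤ 1 := inv_le_one_of_one_le₀ (one_le_pow₀ h1η)
  have hC := heatConst_nonneg (E := E)
  obtain ⟨hMi, hMe⟩ := integrableOn_frullaniMajorant (A := heatConst E * ‖η‖) hκ hδ0 hδ1
  have hf0 := lpNormReal_nonneg p f
  have hg0 := lpNormReal_nonneg q g
  rw [e]
  refine (norm_integral_le_of_norm_le (hMi.mul_const (lpNormReal p f * lpNormReal q g))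
    ((ae_restrict_iff' measurableSet_Ioi).2 (.of_forall fun t ht ↦ ?_))).trans ?_
  · have ht : 0 < t := ht
    have h1 := isMult_integral_character hpq (heatMeasure E t)
      (a := fun y ↦ (Real.exp (-(t * κ)) : ℂ) - Real.exp (-t) *
        cexp ((2 * Real.pi * inner ℝ y η : ℝ) * I)) (by fun_prop)
      (M := Real.exp (-(t * κ)) + Real.exp (-t)) (fun y ↦ by
        refine (norm_sub_le _ _).trans ?_
        rw [norm_mul, Complex.norm_exp_ofReal_mul_I, mul_one, Complex.norm_real,
          Complex.norm_real, Real.norm_of_nonneg (Real.exp_pos _).le,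
          Real.norm_of_nonneg (Real.exp_pos _).le]) f g
    simp only [← exp_sub_exp_eq_integral_heatMeasure ht.le] at h1
    have h2 : ∫ ξ, (D ξ t : ℂ) * (𝓕 f ξ * 𝓕⁻ g ξ)
        = (t⁻¹ : ℝ) * ∫ ξ, ((Real.exp (-(t * (κ + 4 * Real.pi ^ 2 * ‖ξ‖ ^ 2)))
            - Real.exp (-(t * helmholtz 1 (ξ + η))) : ℝ) : ℂ) * 𝓕 f ξ * 𝓕⁻ g ξ := by
      rw [← integral_const_mul]
      congr 1 with ξ
      simp only [hD]
      push_cast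
      ring
    rw [h2, norm_mul, Complex.norm_real, Real.norm_of_nonneg (by positivity)]
    calc _ ≤ t⁻¹ * ((|Real.exp (-(t * κ)) - Real.exp (-t)|
        + Real.exp (-t) * min 2 (heatConst E * ‖η‖ * √t)) * lpNormReal p f * lpNormReal q g) := by
          gcongr
          refine h1.trans ?_
          gcongr
          exact integral_norm_character_sub_le t κ η
      _ = (t⁻¹ * (|Real.exp (-(t * κ)) - Real.exp (-t)|
        + Real.exp (-t) * min 2 (heatConst E * ‖η‖ * √t))) *
          (lpNormReal p f * lpNormReal q g) := by ring
      _ ≤ _ := by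
          gcongr
          exact inv_mul_le_frullaniMajorant (by positivity) ht
  · rw [integral_mul_const, hMe, ← mul_assoc]
    gcongr
    have h1 : √δ = (1 + ‖η‖)⁻¹ := by
      rw [hδ, ← inv_pow, Real.sqrt_sq (by positivity)]
    have h2 : Real.log δ = -(2 * Real.log (1 + ‖η‖)) := by
      rw [hδ, Real.log_inv, Real.log_pow]
      norm_num
    have h3 : ‖η‖ * √δ ≤ 1 := by
      rw [h1, ← div_eq_mul_inv, div_le_one (by positivity)]
      linarith
    rw [h2]
    nlinarith

end LogSymbol

/-! ### Temperate growth of complex powers and logarithms of the symbol. -/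

section TemperateGrowth

theorem hasTemperateGrowth_cexp_mul_I :
    Function.HasTemperateGrowth fun x : ℝ ↦ cexp (x * I) := by
  have hd : ∀ n : ℕ, iteratedDeriv n (fun x : ℝ ↦ cexp (x * I)) = fun x : ℝ ↦ I ^ n * cexp (x * I) := by
    intro n
    induction n with
    | zero => ext x; simp
    | succ n ih =>
      rw [iteratedDeriv_succ, ih]
      ext x
      have h1 : HasDerivAt (fun x : ℝ ↦ (x : ℂ) * I) I x := by
        simpa using (Complex.ofRealCLM.hasDerivAt (x := x)).mul_const I
      have h2 := (h1.cexp.const_mul (I ^ n)).deriv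
      rw [h2]
      ring
  refine ⟨?_, fun n ↦ ⟨0, 1, fun x ↦ ?_⟩⟩
  · exact (Complex.ofRealCLM.contDiff.mul contDiff_const).cexp
  · rw [norm_iteratedFDeriv_eq_norm_iteratedDeriv, hd, norm_mul, Complex.norm_exp_ofReal_mul_I]
    simp

variable {E : Type*} [NormedAddCommGroup E] [InnerProductSpace ℝ E]

theorem hasTemperateGrowth_log_one_add_norm_sq :
    Function.HasTemperateGrowth fun ξ : E ↦ Real.log (1 + ‖ξ‖ ^ 2) := by
  have hpos : ∀ ξ : E, 0 < 1 + ‖ξ‖ ^ 2 := fun ξ ↦ by positivity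
  have hd : ∀ ξ : E, HasFDerivAt (fun ξ : E ↦ Real.log (1 + ‖ξ‖ ^ 2))
      ((1 + ‖ξ‖ ^ 2)⁻¹ • (2 : ℝ) • innerSL ℝ ξ) ξ := fun ξ ↦ by
    have h := ((hasStrictFDerivAt_norm_sq ξ).hasFDerivAt.const_add 1).log (hpos ξ).ne'
    rwa [← Nat.cast_smul_eq_nsmul ℝ] at h
  refine Function.HasTemperateGrowth.of_fderiv (k := 2) (C := 1) ?_
    (fun ξ ↦ (hd ξ).differentiableAt) fun ξ ↦ ?_
  · have e : fderiv ℝ (fun ξ : E ↦ Real.log (1 + ‖ξ‖ ^ 2))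
        = fun ξ ↦ ((1 + ‖ξ‖ ^ 2) ^ (-1 : ℝ) : ℝ) • (2 : ℝ) • innerSL ℝ ξ := by
      ext1 ξ
      rw [(hd ξ).fderiv, Real.rpow_neg_one]
    rw [e]
    have h1 : Function.HasTemperateGrowth fun ξ : E ↦ ((1 + ‖ξ‖ ^ 2) ^ (-1 : ℝ) : ℝ) := by
      fun_prop
    have h2 : Function.HasTemperateGrowth fun ξ : E ↦ (innerSL ℝ ξ : E →L[ℝ] ℝ) :=
      (innerSL ℝ).hasTemperateGrowth
    exact h1.smul ((Function.HasTemperateGrowth.const (2 : ℝ)).smul h2)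
  · rw [Real.norm_of_nonneg (Real.log_nonneg (by nlinarith [sq_nonneg ‖ξ‖]))]
    have := Real.log_le_sub_one_of_pos (hpos ξ)
    nlinarith [norm_nonneg ξ]

theorem hasTemperateGrowth_log_helmholtz {b : ℝ} (hb : 0 ≤ b) :
    Function.HasTemperateGrowth fun ξ : E ↦ Real.log (helmholtz b ξ) := by
  have h := (hasTemperateGrowth_log_one_add_norm_sq (E := E)).comp
    ((√b * (2 * Real.pi)) • ContinuousLinearMap.id ℝ E).hasTemperateGrowth
  convert h using 1
  ext ξ
  simp only [Function.comp, smul_apply, ContinuousLinearMap.id_apply,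
    norm_smul, helmholtz, Real.norm_of_nonneg (show 0 ≤ √b * (2 * Real.pi) by positivity)]
  rw [mul_pow, mul_pow, Real.sq_sqrt hb]
  ring_nf

theorem hasTemperateGrowth_add_const (η : E) : Function.HasTemperateGrowth fun ξ : E ↦ ξ + η :=
  Function.HasTemperateGrowth.id.add (Function.HasTemperateGrowth.const η)

/-- The symbol of the complex power `(I - bΔ)^z`. -/
noncomputable def helmPow (b : ℝ) (z : ℂ) (ξ : E) : ℂ := cexp (z * Real.log (helmholtz b ξ))

theorem helmPow_add (b : ℝ) (z w : ℂ) (ξ : E) :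
    helmPow b (z + w) ξ = helmPow b z ξ * helmPow b w ξ := by
  rw [helmPow, add_mul, Complex.exp_add, helmPow, helmPow]

theorem norm_helmPow (b : ℝ) (z : ℂ) (ξ : E) :
    ‖helmPow b z ξ‖ = Real.exp (z.re * Real.log (helmholtz b ξ)) := by
  rw [helmPow, Complex.norm_exp, Complex.re_mul_ofReal]

/-- The real part of the exponent gives a real power, and the imaginary part a unimodular function
of the logarithm; each factor has temperate growth. -/
theorem hasTemperateGrowth_helmPow {b : ℝ} (hb : 0 ≤ b) (z : ℂ) :
    Function.HasTemperateGrowth (helmPow b z : E → ℂ) := by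
  have h1 : Function.HasTemperateGrowth fun ξ : E ↦
      (((1 + ‖(√b * (2 * Real.pi)) • ξ‖ ^ 2) ^ z.re : ℝ) : ℂ) := by
    have h0 : Function.HasTemperateGrowth fun ξ : E ↦ (((1 + ‖ξ‖ ^ 2) ^ z.re : ℝ) : ℂ) := by
      fun_prop
    exact h0.comp ((√b * (2 * Real.pi)) • ContinuousLinearMap.id ℝ E).hasTemperateGrowth
  have h2 : Function.HasTemperateGrowth fun ξ : E ↦
      cexp ((z.im * Real.log (helmholtz b ξ) : ℝ) * I) :=
    hasTemperateGrowth_cexp_mul_I.comp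
      ((Function.HasTemperateGrowth.const z.im).mul (hasTemperateGrowth_log_helmholtz hb))
  suffices key : (helmPow b z : E → ℂ) = (fun ξ : E ↦
      (((1 + ‖(√b * (2 * Real.pi)) • ξ‖ ^ 2) ^ z.re : ℝ) : ℂ)) * fun ξ : E ↦
      cexp ((z.im * Real.log (helmholtz b ξ) : ℝ) * I) by
    rw [key]
    exact h1.mul h2
  ext ξ
  have hp : 0 < helmholtz b ξ := one_pos.trans_le (by
    unfold helmholtz
    have : 0 ≤ b * (4 * Real.pi ^ 2 * ‖ξ‖ ^ 2) := by positivity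
    linarith)
  have e : 1 + ‖(√b * (2 * Real.pi)) • ξ‖ ^ 2 = helmholtz b ξ := by
    rw [norm_smul, Real.norm_of_nonneg (show 0 ≤ √b * (2 * Real.pi) by positivity), mul_pow,
      mul_pow, Real.sq_sqrt hb, helmholtz]
    ring
  simp only [Pi.mul_apply]
  rw [e, Real.rpow_def_of_pos hp, Complex.ofReal_exp, ← Complex.exp_add, helmPow]
  congr 1
  push_cast
  conv_lhs => rw [← Complex.re_add_im z]
  ring

end TemperateGrowth

/-! ### Duality and the algebra of multipliers. -/

section Duality

variable {E : Type*} [NormedAddCommGroup E] [InnerProductSpace ℝ E] [FiniteDimensional ℝ E]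
  [MeasurableSpace E] [BorelSpace E]

theorem exists_schwartz_eLpNorm_sub_le {q : ℝ} (hq : 1 ≤ q) {v : E → ℂ}
    (hv : MemLp v (ENNReal.ofReal q)) {ε : ℝ} (hε : 0 < ε) :
    ∃ g : 𝓢(E, ℂ), HasCompactSupport ⇑g ∧
      eLpNorm (v - ⇑g) (ENNReal.ofReal q) ≤ ENNReal.ofReal ε := by
  obtain ⟨g, h1, h2, h3⟩ := MemLp.exist_eLpNorm_sub_le ENNReal.ofReal_ne_top
    (by simpa using hq) hv hε
  exact ⟨h1.toSchwartzMap h2, h1, h3⟩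

/-- The converse of Hölder's inequality, tested on Schwartz functions. -/
theorem lpNormReal_le_of_forall_schwartz {p q : ℝ} (hpq : p.HolderConjugate q) {h : E → ℂ}
    (hh : MemLp h (ENNReal.ofReal p)) {A : ℝ} (hA : 0 ≤ A)
    (H : ∀ g : 𝓢(E, ℂ), ‖∫ x, h x * g x‖ ≤ A * lpNormReal q g) : lpNormReal p h ≤ A := by
  have hp := hpq.pos
  have hq := hpq.symm.pos
  set N := lpNormReal p h with hN
  have hN0 : 0 ≤ N := lpNormReal_nonneg p h
  rcases hN0.eq_or_lt with h0 | hNpos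
  · rwa [← h0]
  have hNp : N ^ p = ∫ x, ‖h x‖ ^ p := by
    rw [hN, lpNormReal, hh.eLpNorm_eq_integral_rpow_norm (by simpa using hp)
      ENNReal.ofReal_ne_top, ENNReal.toReal_ofReal hp.le, ENNReal.toReal_ofReal (by positivity),
      ← Real.rpow_mul (by positivity), inv_mul_cancel₀ hp.ne', Real.rpow_one]
  -- The extremal function for Hölder's inequality: `h v = |h|^p` and `|v|^q = |h|^p`.
  set v : E → ℂ := fun x ↦ (‖h x‖ ^ (p - 2) : ℝ) * (starRingEnd ℂ) (h x) with hv
  have hvn : ∀ x, ‖v x‖ = ‖h x‖ ^ (p - 1) := fun x ↦ by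
    simp only [hv, norm_mul, Complex.norm_real, RCLike.norm_conj]
    rw [Real.norm_of_nonneg (by positivity)]
    rcases (norm_nonneg (h x)).eq_or_lt with h1 | h1
    · rw [← h1, mul_zero, Real.zero_rpow (by linarith [hpq.lt])]
    · rw [← Real.rpow_add_one h1.ne']
      ring_nf
  have hvh : ∀ x, h x * v x = ((‖h x‖ ^ p : ℝ) : ℂ) := fun x ↦ by
    simp only [hv]
    rw [mul_left_comm, Complex.mul_conj, Complex.normSq_eq_norm_sq, ← Complex.ofReal_mul]
    congr 1
    rcases (norm_nonneg (h x)).eq_or_lt with h1 | h1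
    · rw [← h1, Real.zero_rpow hp.ne']; simp
    · rw [← Real.rpow_natCast ‖h x‖ 2, ← Real.rpow_add h1]
      norm_num
  have hvm : AEStronglyMeasurable v := by
    have h1 := hh.1.norm.aemeasurable.pow_const (p - 2)
    exact ((Complex.measurable_ofReal.comp_aemeasurable h1).aestronglyMeasurable).mul
      (Complex.continuous_conj.comp_aestronglyMeasurable hh.1)
  have hvq : ∀ x, ‖v x‖ ^ q = ‖h x‖ ^ p := fun x ↦ by
    rw [hvn, ← Real.rpow_mul (norm_nonneg _), hpq.sub_one_mul_conj]
  have hvL : MemLp v (ENNReal.ofReal q) := by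
    rw [← integrable_norm_rpow_iff hvm (by simpa using hq) ENNReal.ofReal_ne_top,
      ENNReal.toReal_ofReal hq.le]
    simp only [hvq]
    have := hh.integrable_norm_rpow (by simpa using hp) ENNReal.ofReal_ne_top
    rwa [ENNReal.toReal_ofReal hp.le] at this
  have hvN : lpNormReal q v = N ^ (p - 1) := by
    rw [lpNormReal, hvL.eLpNorm_eq_integral_rpow_norm (by simpa using hq)
      ENNReal.ofReal_ne_top, ENNReal.toReal_ofReal hq.le, ENNReal.toReal_ofReal (by positivity)]
    simp only [hvq]
    rw [← hNp, ← Real.rpow_mul hN0]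
    congr 1
    rw [← div_eq_mul_inv, hpq.div_conj_eq_sub_one]
  have hint : ∫ x, h x * v x = ((N ^ p : ℝ) : ℂ) := by
    simp only [hvh]
    rw [hNp, integral_complex_ofReal]
  -- The hypothesis tests only Schwartz functions, so `v` is replaced by a Schwartz function within
  -- `ε` in `L^q`.
  have key : ∀ ε : ℝ, 0 < ε → N ^ p ≤ A * (N ^ (p - 1) + ε) + N * ε := by
    intro ε hε
    obtain ⟨g, -, hg⟩ := exists_schwartz_eLpNorm_sub_le hpq.symm.lt.le hvL hε
    have hgL := g.memLp (ENNReal.ofReal q) volume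
    have hd : MemLp (v - ⇑g) (ENNReal.ofReal q) := hvL.sub hgL
    have hdN : lpNormReal q (v - ⇑g) ≤ ε := ENNReal.toReal_le_of_le_ofReal hε.le hg
    have hgN : lpNormReal q g ≤ N ^ (p - 1) + ε := by
      rw [← hvN]
      have e : (g : E → ℂ) = v - (v - ⇑g) := by simp
      have h1 := eLpNorm_sub_le (p := ENNReal.ofReal q) hvm hd.1 (by simpa using hpq.symm.lt.le)
      rw [← e] at h1
      have h2 := ENNReal.toReal_mono (ENNReal.add_ne_top.2 ⟨hvL.eLpNorm_ne_top,
        hd.eLpNorm_ne_top⟩) h1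
      rw [ENNReal.toReal_add hvL.eLpNorm_ne_top hd.eLpNorm_ne_top] at h2
      exact h2.trans (add_le_add le_rfl hdN)
    have := hpq.ennrealOfReal
    have e : ∫ x, h x * v x = (∫ x, h x * g x) + ∫ x, h x * (v - ⇑g) x := by
      rw [← integral_add]
      · congr 1 with x
        simp only [Pi.sub_apply]
        ring
      · exact hh.integrable_mul hgL
      · exact hh.integrable_mul hd
    have h1 : N ^ p = ‖∫ x, h x * v x‖ := by
      rw [hint, Complex.norm_real, Real.norm_of_nonneg (by positivity)]
    rw [h1, e]
    refine (norm_add_le _ _).trans (add_le_add ((H g).trans (by gcongr))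
      ((norm_integral_mul_le_lpNormReal hpq hh hd).trans (by gcongr)))
  have hl : Filter.Tendsto (fun ε : ℝ ↦ A * (N ^ (p - 1) + ε) + N * ε)
      (nhdsWithin 0 (Set.Ioi 0)) (nhds (A * N ^ (p - 1))) := by
    have : Continuous fun ε : ℝ ↦ A * (N ^ (p - 1) + ε) + N * ε := by fun_prop
    have h := this.tendsto 0
    simp only [add_zero, mul_zero] at h
    exact h.mono_left nhdsWithin_le_nhds
  have h2 : N ^ p ≤ A * N ^ (p - 1) := by
    refine ge_of_tendsto hl ?_
    filter_upwards [self_mem_nhdsWithin] with ε hε using key ε hε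
  have h3 : N ^ p = N * N ^ (p - 1) := by
    rw [← Real.rpow_one_add' hN0 (by linarith)]
    ring_nf
  rw [h3] at h2
  exact le_of_mul_le_mul_right h2 (by positivity)

theorem fourier_fourierMultiplierCLM_apply {m : E → ℂ} (hm : m.HasTemperateGrowth) (f : 𝓢(E, ℂ))
    (ξ : E) : 𝓕 (SchwartzMap.fourierMultiplierCLM ℂ m f) ξ = m ξ * 𝓕 f ξ := by
  rw [SchwartzMap.fourierMultiplierCLM_apply, FourierTransform.fourier_fourierInv_eq,
    SchwartzMap.smulLeftCLM_apply_apply hm, smul_eq_mul]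

theorem integral_fourierMultiplierCLM_mul {m : E → ℂ} (hm : m.HasTemperateGrowth)
    (f g : 𝓢(E, ℂ)) : ∫ x, SchwartzMap.fourierMultiplierCLM ℂ m f x * g x
      = ∫ ξ, m ξ * 𝓕 f ξ * 𝓕⁻ g ξ := by
  rw [integral_mul_eq_fourier]
  simp only [fourier_fourierMultiplierCLM_apply hm]

theorem IsMult.lpNormReal_le {p q M : ℝ} (hpq : p.HolderConjugate q) (hM : 0 ≤ M) {m : E → ℂ}
    (hm : m.HasTemperateGrowth) (h : IsMult p q M m) (f : 𝓢(E, ℂ)) :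
    lpNormReal p (SchwartzMap.fourierMultiplierCLM ℂ m f) ≤ M * lpNormReal p f := by
  refine lpNormReal_le_of_forall_schwartz hpq (SchwartzMap.memLp _ _ _)
    (mul_nonneg hM (lpNormReal_nonneg p f)) fun g ↦ ?_
  rw [integral_fourierMultiplierCLM_mul hm]
  exact h f g

theorem IsMult.mul {p q M M' : ℝ} (hpq : p.HolderConjugate q) (hM : 0 ≤ M) (hM' : 0 ≤ M')
    {m m' : E → ℂ} (hm' : m'.HasTemperateGrowth) (h : IsMult p q M m) (h' : IsMult p q M' m') :
    IsMult p q (M * M') fun ξ ↦ m ξ * m' ξ := by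
  intro f g
  have h1 := h (SchwartzMap.fourierMultiplierCLM ℂ m' f) g
  simp only [fourier_fourierMultiplierCLM_apply hm', ← mul_assoc] at h1
  refine h1.trans ?_
  have := h'.lpNormReal_le hpq hM' hm' f
  have := lpNormReal_nonneg q g
  calc _ ≤ M * (M' * lpNormReal p f) * lpNormReal q g := by gcongr
    _ = _ := by ring

theorem isMult_const {p q : ℝ} (hpq : p.HolderConjugate q) (c : ℂ) :
    IsMult p q ‖c‖ fun _ : E ↦ c := by
  intro f g
  have e : ∫ ξ, c * 𝓕 f ξ * 𝓕⁻ g ξ = c * ∫ x, f x * g x := by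
    rw [integral_mul_eq_fourier, ← integral_const_mul]
    simp only [mul_assoc]
  rw [e, norm_mul, mul_assoc]
  gcongr
  exact norm_integral_mul_le_lpNormReal hpq (f.memLp _ _) (g.memLp _ _)

theorem IsMult.add {p q M M' : ℝ} {m m' : E → ℂ} {B B' : ℝ} (hm : Continuous m)
    (hm' : Continuous m') (hB : ∀ ξ, ‖m ξ‖ ≤ B) (hB' : ∀ ξ, ‖m' ξ‖ ≤ B') (h : IsMult p q M m)
    (h' : IsMult p q M' m') : IsMult p q (M + M') fun ξ ↦ m ξ + m' ξ := by
  intro f g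
  have hG := integrable_fourier_mul f g
  have i1 := hG.bdd_mul hm.aestronglyMeasurable (.of_forall hB)
  have i2 := hG.bdd_mul hm'.aestronglyMeasurable (.of_forall hB')
  have e : ∫ ξ, (m ξ + m' ξ) * 𝓕 f ξ * 𝓕⁻ g ξ
      = (∫ ξ, m ξ * 𝓕 f ξ * 𝓕⁻ g ξ) + ∫ ξ, m' ξ * 𝓕 f ξ * 𝓕⁻ g ξ := by
    simp only [mul_assoc]
    rw [← integral_add i1 i2]
    simp only [add_mul]
  rw [e, add_mul, add_mul]
  exact (norm_add_le _ _).trans (add_le_add (h f g) (h' f g))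

theorem IsMult.pow {p q M : ℝ} (hpq : p.HolderConjugate q) (hM : 0 ≤ M) {m : E → ℂ}
    (hm : m.HasTemperateGrowth) (h : IsMult p q M m) (k : ℕ) :
    IsMult p q (M ^ k) fun ξ ↦ m ξ ^ k := by
  induction k with
  | zero => simpa using isMult_const (E := E) hpq 1
  | succ k ih =>
    simp only [pow_succ]
    exact ih.mul hpq (by positivity) hM hm h

/-- Exponentials of bounded multipliers are multipliers. -/
theorem IsMult.cexp {p q M B : ℝ} (hpq : p.HolderConjugate q) (hM : 0 ≤ M) {m : E → ℂ}
    (hm : m.HasTemperateGrowth) (hB : ∀ ξ, ‖m ξ‖ ≤ B) (h : IsMult p q M m) (a : ℂ) :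
    IsMult p q (Real.exp (‖a‖ * M)) fun ξ ↦ Complex.exp (a * m ξ) := by
  intro f g
  have hG := integrable_fourier_mul f g
  have hmc : Continuous m := hm.1.continuous
  -- The exponential is expanded in its power series, whose `k`-th power is a multiplier of norm `M
  -- ^ k`. The pointwise bound `B` serves only to exchange sum and integral and does not enter the
  -- final norm.
  set F : ℕ → E → ℂ := fun k ξ ↦ (a ^ k / k.factorial) * (m ξ ^ k * 𝓕 f ξ * 𝓕⁻ g ξ) with hF
  have hi : ∀ k, Integrable fun ξ ↦ m ξ ^ k * 𝓕 f ξ * 𝓕⁻ g ξ := fun k ↦ by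
    simp only [mul_assoc]
    exact hG.bdd_mul (c := B ^ k) (hmc.pow k).aestronglyMeasurable (.of_forall fun ξ ↦ by
      rw [norm_pow]
      exact pow_le_pow_left₀ (norm_nonneg _) (hB ξ) k)
  have hFn : ∀ k, ∫ ξ, ‖F k ξ‖ ≤ (‖a‖ * B) ^ k / k.factorial * ∫ ξ, ‖𝓕 f ξ * 𝓕⁻ g ξ‖ := by
    intro k
    rw [← integral_const_mul]
    refine integral_mono ((hi k).const_mul _).norm (hG.norm.const_mul _) fun ξ ↦ ?_
    simp only [hF, norm_mul, norm_div, norm_pow, Complex.norm_natCast, mul_pow]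
    have := pow_le_pow_left₀ (norm_nonneg _) (hB ξ) k
    calc _ = ‖a‖ ^ k / k.factorial * (‖m ξ‖ ^ k) * (‖𝓕 f ξ‖ * ‖𝓕⁻ g ξ‖) := by ring
      _ ≤ ‖a‖ ^ k / k.factorial * (B ^ k) * (‖𝓕 f ξ‖ * ‖𝓕⁻ g ξ‖) := by gcongr
      _ = _ := by ring
  have hS : HasSum (fun k ↦ ∫ ξ, F k ξ) (∫ ξ, ∑' k, F k ξ) :=
    hasSum_integral_of_summable_integral_norm (fun k ↦ (hi k).const_mul _)
      (Summable.of_nonneg_of_le (fun k ↦ integral_nonneg fun ξ ↦ norm_nonneg _) hFn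
        ((Real.summable_pow_div_factorial (‖a‖ * B)).mul_right _))
  have e : ∀ ξ, ∑' k, F k ξ = Complex.exp (a * m ξ) * 𝓕 f ξ * 𝓕⁻ g ξ := fun ξ ↦ by
    have h1 := (NormedSpace.expSeries_div_hasSum_exp (a * m ξ)).mul_right (𝓕 f ξ * 𝓕⁻ g ξ)
    rw [← Complex.exp_eq_exp_ℂ, ← mul_assoc] at h1
    rw [← h1.tsum_eq]
    congr 1 with k
    simp only [hF, mul_pow]
    ring
  simp only [e] at hS
  have hE : HasSum (fun k : ℕ ↦ (‖a‖ * M) ^ k / k.factorial * (lpNormReal p f * lpNormReal q g))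
      (Real.exp (‖a‖ * M) * (lpNormReal p f * lpNormReal q g)) := by
    rw [Real.exp_eq_exp_ℝ]
    exact (NormedSpace.expSeries_div_hasSum_exp (‖a‖ * M)).mul_right _
  rw [← hS.tsum_eq, mul_assoc]
  refine tsum_of_norm_bounded hE fun k ↦ ?_
  simp only [hF]
  rw [integral_const_mul, norm_mul, norm_div, norm_pow, Complex.norm_natCast, mul_pow]
  have h1 := h.pow hpq hM hm k f g
  calc _ ≤ ‖a‖ ^ k / k.factorial * (M ^ k * lpNormReal p f * lpNormReal q g) := by gcongr
    _ = _ := by ring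

end Duality

/-! ### Modulations and the expansion of a product into characters. -/

section Modulation

variable {E : Type*} [NormedAddCommGroup E] [InnerProductSpace ℝ E] [FiniteDimensional ℝ E]
  [MeasurableSpace E] [BorelSpace E]

theorem hasTemperateGrowth_character (η : E) :
    Function.HasTemperateGrowth fun x : E ↦ cexp ((2 * Real.pi * inner ℝ x η : ℝ) * I) :=
  hasTemperateGrowth_cexp_mul_I.comp
    ((Function.HasTemperateGrowth.const (2 * Real.pi)).mul (Function.hasTemperateGrowth_inner_left η))

/-- Multiplication by the character of frequency `η`. -/
noncomputable def modulate (η : E) (g : 𝓢(E, ℂ)) : 𝓢(E, ℂ) :=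
  SchwartzMap.smulLeftCLM ℂ (fun x : E ↦ cexp ((2 * Real.pi * inner ℝ x η : ℝ) * I)) g

theorem modulate_apply (η : E) (g : 𝓢(E, ℂ)) (x : E) :
    modulate η g x = cexp ((2 * Real.pi * inner ℝ x η : ℝ) * I) * g x := by
  rw [modulate, SchwartzMap.smulLeftCLM_apply_apply (hasTemperateGrowth_character η), smul_eq_mul]

theorem fourierInv_modulate (η : E) (g : 𝓢(E, ℂ)) (ξ : E) :
    𝓕⁻ (modulate η g) ξ = 𝓕⁻ g (ξ + η) := by
  rw [SchwartzMap.fourierInv_coe, SchwartzMap.fourierInv_coe, Real.fourierInv_eq',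
    Real.fourierInv_eq']
  congr 1 with x
  rw [modulate_apply, smul_eq_mul, smul_eq_mul, ← mul_assoc, ← Complex.exp_add, inner_add_right]
  congr 2
  push_cast
  ring

theorem lpNormReal_modulate (q : ℝ) (η : E) (g : 𝓢(E, ℂ)) :
    lpNormReal q (modulate η g) = lpNormReal q g := by
  unfold lpNormReal
  congr 1
  refine eLpNorm_congr_norm_ae (.of_forall fun x ↦ ?_)
  rw [modulate_apply, norm_mul, Complex.norm_exp_ofReal_mul_I, one_mul]

theorem schwartz_eq_integral_character (φ : 𝓢(E, ℂ)) (x : E) :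
    φ x = ∫ η, 𝓕 φ η * cexp ((2 * Real.pi * inner ℝ x η : ℝ) * I) := by
  have h : (𝓕⁻ (𝓕 φ) : 𝓢(E, ℂ)) x = φ x := by rw [FourierTransform.fourierInv_fourier_eq]
  rw [← h, SchwartzMap.fourierInv_coe, Real.fourierInv_eq']
  congr 1 with η
  rw [smul_eq_mul, mul_comm, real_inner_comm]

/-- Multiplication by a Schwartz function, expanded into modulations. -/
theorem integral_mul_mul_eq (φ u h : 𝓢(E, ℂ)) :
    ∫ x, φ x * u x * h x = ∫ η, 𝓕 φ η * ∫ ξ, 𝓕 u ξ * 𝓕⁻ h (ξ + η) := by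
  obtain ⟨M, hM⟩ : ∃ M, ∀ x, ‖u x‖ ≤ M := ⟨_, u.norm_le_seminorm ℝ⟩
  have huh : Integrable fun x ↦ u x * h x :=
    h.integrable.bdd_mul u.continuous.aestronglyMeasurable (.of_forall hM)
  have hint : Integrable (fun z : E × E ↦ cexp ((2 * Real.pi * inner ℝ z.1 z.2 : ℝ) * I) *
      ((u z.1 * h z.1) * 𝓕 φ z.2)) ((volume : Measure E).prod volume) := by
    refine Integrable.bdd_mul (c := 1) (huh.mul_prod (𝓕 φ).integrable)
      (by fun_prop : Continuous fun z : E × E ↦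
        cexp ((2 * Real.pi * inner ℝ z.1 z.2 : ℝ) * I)).aestronglyMeasurable (.of_forall fun z ↦ ?_)
    rw [Complex.norm_exp_ofReal_mul_I]
  calc _ = ∫ x, ∫ η, cexp ((2 * Real.pi * inner ℝ x η : ℝ) * I) * ((u x * h x) * 𝓕 φ η) := by
        congr 1 with x
        rw [schwartz_eq_integral_character φ x, mul_assoc, ← integral_mul_const]
        congr 1 with η
        ring
    _ = ∫ η, ∫ x, cexp ((2 * Real.pi * inner ℝ x η : ℝ) * I) * ((u x * h x) * 𝓕 φ η) :=
        integral_integral_swap hint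
    _ = _ := by
        congr 1 with η
        have h1 := integral_mul_eq_fourier u (modulate η h)
        simp only [fourierInv_modulate] at h1
        rw [← h1, ← integral_const_mul]
        congr 1 with x
        rw [modulate_apply]
        ring

theorem integral_fourierMultiplierCLM_mul' {m : E → ℂ} (hm : m.HasTemperateGrowth)
    (f g : 𝓢(E, ℂ)) : ∫ x, SchwartzMap.fourierMultiplierCLM ℂ m f x * g x
      = ∫ x, f x * 𝓕 (SchwartzMap.smulLeftCLM ℂ m (𝓕⁻ g)) x := by
  rw [integral_fourierMultiplierCLM_mul hm, integral_mul_eq_fourier,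
    FourierTransform.fourierInv_fourier_eq]
  congr 1 with ξ
  rw [SchwartzMap.smulLeftCLM_apply_apply hm, smul_eq_mul]
  ring

end Modulation

/-! ### Multiplication by Schwartz functions on Sobolev spaces. -/

section LogDifference

variable {E : Type*} [NormedAddCommGroup E] [InnerProductSpace ℝ E] [FiniteDimensional ℝ E]
  [MeasurableSpace E] [BorelSpace E]

/-- The difference of the logarithmic symbols of a translated and of a dilated Laplacian. -/
noncomputable def logDiff (b : ℝ) (η ξ : E) : ℂ :=
  ((Real.log (helmholtz 1 (ξ + η)) - Real.log (helmholtz b ξ) : ℝ) : ℂ)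

theorem hasTemperateGrowth_logDiff {b : ℝ} (hb : 0 ≤ b) (η : E) :
    Function.HasTemperateGrowth (logDiff b η) :=
  Function.Complex.hasTemperateGrowth_ofReal.comp
    (((hasTemperateGrowth_log_helmholtz zero_le_one).comp (hasTemperateGrowth_add_const η)).sub
      (hasTemperateGrowth_log_helmholtz hb))

/-- Each of the two symbols is at most a constant times the other. Only the finiteness of the bound
matters, for `IsMult.cexp`; its size in `η` is irrelevant. -/
theorem norm_logDiff_le {b : ℝ} (hb : 0 < b) (η ξ : E) :
    ‖logDiff b η ξ‖ ≤ Real.log ((1 + 2 / b + 8 * Real.pi ^ 2 * ‖η‖ ^ 2) + (1 + 2 * b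
      + b * (8 * Real.pi ^ 2 * ‖η‖ ^ 2))) := by
  have h1 := one_le_helmholtz zero_le_one (ξ + η)
  have h2 := one_le_helmholtz hb.le ξ
  set C := (1 + 2 / b + 8 * Real.pi ^ 2 * ‖η‖ ^ 2) + (1 + 2 * b
      + b * (8 * Real.pi ^ 2 * ‖η‖ ^ 2)) with hC
  have hC1 : 1 + 2 / b + 8 * Real.pi ^ 2 * ‖η‖ ^ 2 ≤ C := by
    rw [hC]; linarith [show 0 ≤ 1 + 2 * b + b * (8 * Real.pi ^ 2 * ‖η‖ ^ 2) by positivity]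
  have hC2 : 1 + 2 * b + b * (8 * Real.pi ^ 2 * ‖η‖ ^ 2) ≤ C := by
    rw [hC]; linarith [show 0 ≤ 1 + 2 / b + 8 * Real.pi ^ 2 * ‖η‖ ^ 2 by positivity]
  have hC0 : 0 < C := lt_of_lt_of_le (by positivity) hC1
  have n1 : ‖ξ + η‖ ^ 2 ≤ 2 * ‖ξ‖ ^ 2 + 2 * ‖η‖ ^ 2 := by
    have := norm_add_le ξ η
    nlinarith [norm_nonneg (ξ + η), sq_nonneg (‖ξ‖ - ‖η‖)]
  have n2 : ‖ξ‖ ^ 2 ≤ 2 * ‖ξ + η‖ ^ 2 + 2 * ‖η‖ ^ 2 := by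
    have h := norm_sub_le (ξ + η) η
    rw [add_sub_cancel_right] at h
    nlinarith [norm_nonneg ξ, sq_nonneg (‖ξ + η‖ - ‖η‖)]
  have hp : 0 < 4 * Real.pi ^ 2 := by positivity
  have u1 : helmholtz 1 (ξ + η) ≤ C * helmholtz b ξ := by
    have e1 : helmholtz 1 (ξ + η)
        ≤ 1 + 8 * Real.pi ^ 2 * ‖η‖ ^ 2 + 2 / b * (b * (4 * Real.pi ^ 2 * ‖ξ‖ ^ 2)) := by
      rw [helmholtz, ← mul_assoc (2 / b), div_mul_cancel₀ _ hb.ne']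
      nlinarith
    have e2 : b * (4 * Real.pi ^ 2 * ‖ξ‖ ^ 2) ≤ helmholtz b ξ := by rw [helmholtz]; linarith
    calc _ ≤ (1 + 8 * Real.pi ^ 2 * ‖η‖ ^ 2) * 1 + 2 / b * helmholtz b ξ := by
          rw [mul_one]
          exact e1.trans (by gcongr)
      _ ≤ (1 + 8 * Real.pi ^ 2 * ‖η‖ ^ 2) * helmholtz b ξ + 2 / b * helmholtz b ξ := by gcongr
      _ = (1 + 2 / b + 8 * Real.pi ^ 2 * ‖η‖ ^ 2) * helmholtz b ξ := by ring
      _ ≤ _ := by gcongr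
  have u2 : helmholtz b ξ ≤ C * helmholtz 1 (ξ + η) := by
    have e1 : helmholtz b ξ
        ≤ 1 + b * (8 * Real.pi ^ 2 * ‖η‖ ^ 2) + 2 * b * (4 * Real.pi ^ 2 * ‖ξ + η‖ ^ 2) := by
      have : b * (4 * Real.pi ^ 2 * ‖ξ‖ ^ 2)
          ≤ b * (4 * Real.pi ^ 2 * (2 * ‖ξ + η‖ ^ 2 + 2 * ‖η‖ ^ 2)) := by gcongr
      rw [helmholtz]
      linarith
    have e2 : 4 * Real.pi ^ 2 * ‖ξ + η‖ ^ 2 ≤ helmholtz 1 (ξ + η) := by rw [helmholtz]; linarith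
    calc _ ≤ (1 + b * (8 * Real.pi ^ 2 * ‖η‖ ^ 2)) * 1 + 2 * b * helmholtz 1 (ξ + η) := by
          rw [mul_one]
          exact e1.trans (by gcongr)
      _ ≤ (1 + b * (8 * Real.pi ^ 2 * ‖η‖ ^ 2)) * helmholtz 1 (ξ + η)
          + 2 * b * helmholtz 1 (ξ + η) := by gcongr
      _ = (1 + 2 * b + b * (8 * Real.pi ^ 2 * ‖η‖ ^ 2)) * helmholtz 1 (ξ + η) := by ring
      _ ≤ _ := by gcongr
  have l1 := Real.log_le_log (by linarith) u1
  have l2 := Real.log_le_log (by linarith) u2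
  rw [Real.log_mul hC0.ne' (by linarith)] at l1 l2
  rw [logDiff, Complex.norm_real, Real.norm_eq_abs, abs_le]
  constructor <;> linarith

/-- Factoring `b` out of `helmholtz b` leaves `b⁻¹ + 4π²|ξ|²`, the case `κ = b⁻¹` of
`isMult_log_sub`, and the constant multiplier `-log b`. -/
theorem isMult_logDiff {b : ℝ} (hb : 0 < b) (η : E) {p q : ℝ} (hpq : p.HolderConjugate q) :
    IsMult p q ((|b⁻¹ - 1| / min b⁻¹ 1 + 2 + 2 * heatConst E + |Real.log b|)
      + 4 * Real.log (1 + ‖η‖)) (logDiff b η) := by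
  have hκ : 0 < b⁻¹ := inv_pos.2 hb
  have h1 := isMult_log_sub hκ η hpq
  have h2 := isMult_const (E := E) hpq (-Real.log b : ℝ)
  have e : ∀ ξ : E, ((Real.log (helmholtz 1 (ξ + η))
      - Real.log (b⁻¹ + 4 * Real.pi ^ 2 * ‖ξ‖ ^ 2) : ℝ) : ℂ)
      = logDiff b η ξ - ((-Real.log b : ℝ) : ℂ) := fun ξ ↦ by
    have h3 : helmholtz b ξ = b * (b⁻¹ + 4 * Real.pi ^ 2 * ‖ξ‖ ^ 2) := by
      rw [helmholtz, mul_add, mul_inv_cancel₀ hb.ne']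
    have h4 : b⁻¹ + 4 * Real.pi ^ 2 * ‖ξ‖ ^ 2 ≠ 0 := by positivity
    rw [logDiff, h3, Real.log_mul hb.ne' h4]
    push_cast
    ring
  have hc := (hasTemperateGrowth_logDiff hb.le η).1.continuous
  have h := IsMult.add (m := fun ξ : E ↦ ((Real.log (helmholtz 1 (ξ + η))
      - Real.log (b⁻¹ + 4 * Real.pi ^ 2 * ‖ξ‖ ^ 2) : ℝ) : ℂ))
    (m' := fun _ ↦ ((-Real.log b : ℝ) : ℂ)) (by
      simp only [e]
      exact hc.sub continuous_const) continuous_const (fun ξ ↦ by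
      rw [e]
      exact (norm_sub_le _ _).trans (add_le_add (norm_logDiff_le hb η ξ) le_rfl))
    (fun _ ↦ le_rfl) h1 h2
  rw [Complex.norm_real, norm_neg, Real.norm_eq_abs] at h
  have e2 : (fun ξ : E ↦ ((Real.log (helmholtz 1 (ξ + η))
      - Real.log (b⁻¹ + 4 * Real.pi ^ 2 * ‖ξ‖ ^ 2) : ℝ) : ℂ) + ((-Real.log b : ℝ) : ℂ))
      = logDiff b η := by
    ext ξ
    rw [e]
    ring
  rw [e2] at h
  exact h.mono (le_of_eq (by ring))

theorem exists_integral_fourier_mul_rpow_le (φ : 𝓢(E, ℂ)) (a : ℝ) :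
    Integrable fun η ↦ ‖𝓕 φ η‖ * (1 + ‖η‖) ^ a := by
  obtain ⟨k, hk⟩ := exists_nat_ge a
  have h : Integrable fun η ↦ 2 ^ k * (‖𝓕 φ η‖ + ‖η‖ ^ k * ‖𝓕 φ η‖) :=
    ((𝓕 φ).integrable.norm.add ((𝓕 φ).integrable_pow_mul volume k)).const_mul _
  have hc : Continuous fun η ↦ ‖𝓕 φ η‖ * (1 + ‖η‖) ^ a :=
    (𝓕 φ).continuous.norm.mul ((continuous_const.add continuous_norm).rpow_const fun η ↦
      Or.inl (show 1 + ‖η‖ ≠ 0 by positivity))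
  refine h.mono' hc.aestronglyMeasurable (.of_forall fun η ↦ ?_)
  have hn := norm_nonneg η
  rw [Real.norm_of_nonneg (by positivity)]
  have h1 : (1 + ‖η‖) ^ a ≤ (1 + ‖η‖) ^ k := by
    rw [← Real.rpow_natCast]
    exact Real.rpow_le_rpow_of_exponent_le (by linarith) hk
  have h2 : (1 + ‖η‖) ^ k ≤ 2 ^ k * (1 + ‖η‖ ^ k) := by
    rcases le_total ‖η‖ 1 with h3 | h3
    · calc (1 + ‖η‖) ^ k ≤ 2 ^ k := pow_le_pow_left₀ (by positivity) (by linarith) k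
        _ ≤ 2 ^ k * (1 + ‖η‖ ^ k) := le_mul_of_one_le_right (by positivity)
            (by linarith [pow_nonneg hn k])
    · calc (1 + ‖η‖) ^ k ≤ (2 * ‖η‖) ^ k := pow_le_pow_left₀ (by positivity) (by linarith) k
        _ = 2 ^ k * ‖η‖ ^ k := mul_pow _ _ _
        _ ≤ 2 ^ k * (1 + ‖η‖ ^ k) := by gcongr; linarith
  calc _ ≤ ‖𝓕 φ η‖ * (2 ^ k * (1 + ‖η‖ ^ k)) := by
        gcongr
        exact h1.trans h2
    _ = _ := by ring

/-- Multiplication by a Schwartz function is bounded on Sobolev spaces, also between the spaces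
defined by differently scaled Laplacians, with control of imaginary powers. -/
theorem exists_lpNormReal_mul_le (φ : 𝓢(E, ℂ)) (s : ℝ) {b : ℝ} (hb : 0 < b) {p q : ℝ}
    (hpq : p.HolderConjugate q) : ∃ C : ℝ, 0 ≤ C ∧ ∀ (τ : ℝ) (w : 𝓢(E, ℂ)),
      lpNormReal p (SchwartzMap.fourierMultiplierCLM ℂ (helmPow 1 s) (SchwartzMap.smulLeftCLM ℂ φ
        (SchwartzMap.fourierMultiplierCLM ℂ (helmPow b (-s + τ * I)) w)))
      ≤ C * Real.exp (Real.pi * |τ|) * lpNormReal p w := by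
  have hp := hpq.pos
  have hq := hpq.symm.pos
  set K := |b⁻¹ - 1| / min b⁻¹ 1 + 2 + 2 * heatConst E + |Real.log b| with hK
  have hK0 : 0 ≤ K := by
    have := heatConst_nonneg (E := E)
    have : 0 < min b⁻¹ 1 := lt_min (inv_pos.2 hb) one_pos
    positivity
  set C₁ := 2 * (32 * (10 * (p + q) + 4) + 1) with hC₁
  set C₂ := ∫ η, ‖𝓕 φ η‖ * (1 + ‖η‖) ^ (4 * |s|) with hC₂
  have hC₂i := exists_integral_fourier_mul_rpow_le φ (4 * |s|)
  have hC₂0 : 0 ≤ C₂ := integral_nonneg fun η ↦ by positivity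
  refine ⟨C₂ * Real.exp (|s| * K) * C₁, by positivity, fun τ w ↦ ?_⟩
  -- The imaginary part of the power is split off; it costs `e^{π|τ|}`, and a real power remains.
  set w₁ := SchwartzMap.fourierMultiplierCLM ℂ (helmPow b (τ * I)) w with hw₁
  have hg1 : ∀ z, Function.HasTemperateGrowth (helmPow 1 z : E → ℂ) :=
    hasTemperateGrowth_helmPow zero_le_one
  have hgb : ∀ z, Function.HasTemperateGrowth (helmPow b z : E → ℂ) :=
    hasTemperateGrowth_helmPow hb.le
  have hw₁n : lpNormReal p w₁ ≤ C₁ * Real.exp (Real.pi * |τ|) * lpNormReal p w :=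
    ((isMult_imaginaryPower hb.le τ hpq).mono (le_of_eq (by rw [hC₁]; ring))).lpNormReal_le hpq
      (by positivity) (hgb (τ * I)) w
  have hE0 := Real.exp_pos (Real.pi * |τ|)
  have hw0 := lpNormReal_nonneg p w
  refine lpNormReal_le_of_forall_schwartz hpq (SchwartzMap.memLp _ _ _) (by positivity) fun g ↦ ?_
  have hg0 := lpNormReal_nonneg q g
  rw [integral_fourierMultiplierCLM_mul' (hg1 s)]
  simp only [SchwartzMap.smulLeftCLM_apply_apply φ.hasTemperateGrowth, smul_eq_mul]
  rw [integral_mul_mul_eq]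
  have key : ∀ η, ‖∫ ξ, 𝓕 (SchwartzMap.fourierMultiplierCLM ℂ (helmPow b (-s + τ * I)) w) ξ
      * 𝓕⁻ (𝓕 (SchwartzMap.smulLeftCLM ℂ (helmPow 1 s) (𝓕⁻ g))) (ξ + η)‖
      ≤ Real.exp (|s| * K) * (1 + ‖η‖) ^ (4 * |s|) * (lpNormReal p w₁ * lpNormReal q g) := by
    intro η
    have h1 := (isMult_logDiff hb η hpq).cexp hpq (by
      have : 0 ≤ Real.log (1 + ‖η‖) := Real.log_nonneg (by linarith [norm_nonneg η])
      positivity) (hasTemperateGrowth_logDiff hb.le η) (norm_logDiff_le hb η) s w₁ (modulate η g)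
    rw [lpNormReal_modulate, Complex.norm_real, Real.norm_eq_abs, mul_add, Real.exp_add] at h1
    have e2 : Real.exp (|s| * (4 * Real.log (1 + ‖η‖))) = (1 + ‖η‖) ^ (4 * |s|) := by
      rw [Real.rpow_def_of_pos (by linarith [norm_nonneg η])]
      ring_nf
    rw [← hK, e2, mul_assoc] at h1
    refine le_trans (le_of_eq (congrArg norm ?_)) h1
    congr 1 with ξ
    rw [FourierTransform.fourierInv_fourier_eq, SchwartzMap.smulLeftCLM_apply_apply (hg1 s),
      fourier_fourierMultiplierCLM_apply (hgb _), hw₁, fourier_fourierMultiplierCLM_apply (hgb _),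
      fourierInv_modulate, helmPow_add, smul_eq_mul]
    have e3 : cexp (s * logDiff b η ξ) = helmPow b (-s) ξ * helmPow 1 s (ξ + η) := by
      rw [helmPow, helmPow, ← Complex.exp_add, logDiff]
      congr 1
      push_cast
      ring
    simp only [e3]
    ring
  refine (norm_integral_le_of_norm_le (hC₂i.mul_const
    (Real.exp (|s| * K) * (lpNormReal p w₁ * lpNormReal q g))) (.of_forall fun η ↦ ?_)).trans ?_
  · rw [norm_mul]
    calc _ ≤ ‖𝓕 φ η‖ * (Real.exp (|s| * K) * (1 + ‖η‖) ^ (4 * |s|)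
          * (lpNormReal p w₁ * lpNormReal q g)) := by
          gcongr
          exact key η
      _ = _ := by ring
  · rw [integral_mul_const, ← hC₂]
    calc _ ≤ C₂ * (Real.exp (|s| * K) * ((C₁ * Real.exp (Real.pi * |τ|) * lpNormReal p w)
          * lpNormReal q g)) := by gcongr
      _ = _ := by ring

end LogDifference

/-! ### Dilations and the a priori estimate. -/

section Dilation

variable {E : Type*} [NormedAddCommGroup E] [InnerProductSpace ℝ E] [FiniteDimensional ℝ E]
  [MeasurableSpace E] [BorelSpace E]

/-- The dilation `x ↦ w (l x)` of a Schwartz function. -/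
noncomputable def dilate {l : ℝ} (hl : l ≠ 0) : 𝓢(E, ℂ) →L[ℂ] 𝓢(E, ℂ) :=
  SchwartzMap.compCLMOfContinuousLinearEquiv ℂ
    (LinearEquiv.smulOfNeZero ℝ E l hl).toContinuousLinearEquiv

theorem dilate_apply {l : ℝ} (hl : l ≠ 0) (w : 𝓢(E, ℂ)) (x : E) : dilate hl w x = w (l • x) := rfl

theorem fourier_dilate {l : ℝ} (hl : 0 < l) (w : 𝓢(E, ℂ)) (ξ : E) :
    𝓕 (dilate hl.ne' w) ξ = ((l ^ Module.finrank ℝ E)⁻¹ : ℝ) * 𝓕 w (l⁻¹ • ξ) := by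
  have h := Measure.integral_comp_smul_of_nonneg (volume : Measure E)
    (fun x ↦ cexp ((-2 * Real.pi * inner ℝ x (l⁻¹ • ξ) : ℝ) * I) * w x) l (hR := hl.le)
  rw [SchwartzMap.fourier_coe, SchwartzMap.fourier_coe, Real.fourier_eq', Real.fourier_eq']
  simp only [smul_eq_mul]
  rw [Complex.real_smul] at h
  rw [← h]
  congr 1 with x
  rw [dilate_apply, inner_smul_right, real_inner_smul_left, inv_mul_cancel_left₀ hl.ne']

/-- Dilation by `l` rescales the Laplacian by `l^{-2}`. This is why the preceding estimates carry
the parameter `b`. -/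
theorem dilate_fourierMultiplierCLM {l : ℝ} (hl : 0 < l) (z : ℂ) (w : 𝓢(E, ℂ)) :
    dilate hl.ne' (SchwartzMap.fourierMultiplierCLM ℂ (helmPow 1 z) w)
      = SchwartzMap.fourierMultiplierCLM ℂ (helmPow (l ^ 2)⁻¹ z) (dilate hl.ne' w) := by
  apply (FourierTransform.fourierCLE ℂ 𝓢(E, ℂ)).injective
  ext ξ
  simp only [FourierTransform.fourierCLE_apply]
  rw [fourier_dilate hl, fourier_fourierMultiplierCLM_apply (hasTemperateGrowth_helmPow zero_le_one z),
    fourier_fourierMultiplierCLM_apply (hasTemperateGrowth_helmPow (by positivity) z),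
    fourier_dilate hl]
  have e : helmPow 1 z (l⁻¹ • ξ) = helmPow (l ^ 2)⁻¹ z ξ := by
    rw [helmPow, helmPow, helmholtz, helmholtz, norm_smul, norm_inv, Real.norm_of_nonneg hl.le]
    congr 4
    ring
  rw [e]
  ring

theorem exists_lpNormReal_dilate_le {l : ℝ} (hl : 0 < l) {p : ℝ} (hp : 0 < p) :
    ∃ C : ℝ, 0 ≤ C ∧ ∀ w : 𝓢(E, ℂ), lpNormReal p (dilate hl.ne' w) ≤ C * lpNormReal p w := by
  refine ⟨((l ^ Module.finrank ℝ E)⁻¹) ^ p⁻¹, by positivity, fun w ↦ ?_⟩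
  have h := Measure.integral_comp_smul_of_nonneg (volume : Measure E)
    (fun x ↦ ‖w x‖ ^ p) l (hR := hl.le)
  have h1 := lpNormReal_rpow (dilate hl.ne' w) hp
  simp only [dilate_apply] at h1
  rw [h, ← lpNormReal_rpow w hp, smul_eq_mul] at h1
  have h2 := congrArg (fun x : ℝ ↦ x ^ p⁻¹) h1
  rw [← Real.rpow_mul (lpNormReal_nonneg _ _), mul_inv_cancel₀ hp.ne', Real.rpow_one,
    Real.mul_rpow (by positivity) (by have := lpNormReal_nonneg p w; positivity),
    ← Real.rpow_mul (lpNormReal_nonneg _ _), mul_inv_cancel₀ hp.ne', Real.rpow_one] at h2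
  exact h2.le

/-- The main a priori estimate in Sobolev spaces. -/
theorem exists_lpNormReal_mul_dilate_le (φ : 𝓢(E, ℂ)) (s : ℝ) {l : ℝ} (hl : 0 < l) {p q : ℝ}
    (hpq : p.HolderConjugate q) : ∃ C : ℝ, 0 ≤ C ∧ ∀ (τ : ℝ) (w : 𝓢(E, ℂ)),
      lpNormReal p (SchwartzMap.fourierMultiplierCLM ℂ (helmPow 1 s) (SchwartzMap.smulLeftCLM ℂ φ
        (dilate hl.ne' (SchwartzMap.fourierMultiplierCLM ℂ (helmPow 1 (-s + τ * I)) w))))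
      ≤ C * Real.exp (Real.pi * |τ|) * lpNormReal p w := by
  obtain ⟨C₁, hC₁, h₁⟩ := exists_lpNormReal_mul_le φ s (b := (l ^ 2)⁻¹) (by positivity) hpq
  obtain ⟨C₂, hC₂, h₂⟩ := exists_lpNormReal_dilate_le (E := E) hl hpq.pos
  refine ⟨C₁ * C₂, by positivity, fun τ w ↦ ?_⟩
  rw [dilate_fourierMultiplierCLM hl]
  calc _ ≤ C₁ * Real.exp (Real.pi * |τ|) * (C₂ * lpNormReal p w) :=
        (h₁ τ _).trans (by have := h₂ w; gcongr)
    _ = _ := by ring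

end Dilation

/-! ### Hörmander norms of sums of dyadic pieces. -/

section Sobolev

variable {n : ℕ}

theorem besselSymbol_eq_helmPow (s : ℝ) :
    besselSymbol n s = helmPow 1 ((s / 2 : ℝ) : ℂ) := by
  ext ξ
  have h := one_le_helmholtz zero_le_one ξ
  have e : 1 + 4 * Real.pi ^ 2 * ‖ξ‖ ^ 2 = helmholtz 1 ξ := by rw [helmholtz, one_mul]
  rw [besselSymbol, e, helmPow, Real.rpow_def_of_pos (by linarith), Complex.ofReal_exp]
  push_cast
  ring_nf

theorem isGivenBy_toTemperedDistributionCLM (H : 𝓢(EuclideanSpace ℝ (Fin n), ℂ)) :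
    IsGivenBy (SchwartzMap.toTemperedDistributionCLM (EuclideanSpace ℝ (Fin n)) ℂ volume H) H := by
  intro φ
  refine ⟨?_, by simp [SchwartzMap.toTemperedDistributionCLM_apply_apply]⟩
  obtain ⟨M, hM⟩ : ∃ M, ∀ x, ‖φ x‖ ≤ M := ⟨_, φ.norm_le_seminorm ℝ⟩
  exact H.integrable.bdd_mul φ.continuous.aestronglyMeasurable (.of_forall hM)

theorem sobolevENorm_le (r s : ℝ) (H : 𝓢(EuclideanSpace ℝ (Fin n), ℂ)) :
    sobolevENorm r s H ≤ eLpNorm (SchwartzMap.fourierMultiplierCLM ℂ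
      (helmPow 1 ((s / 2 : ℝ) : ℂ)) H) (ENNReal.ofReal r) := by
  unfold sobolevENorm
  refine iInf_le_of_le (SchwartzMap.toTemperedDistributionCLM _ ℂ volume H) ?_
  refine iInf_le_of_le (SchwartzMap.fourierMultiplierCLM ℂ
      (helmPow 1 ((s / 2 : ℝ) : ℂ)) H) ?_
  refine iInf_le_of_le (isGivenBy_toTemperedDistributionCLM H) ?_
  refine iInf_le_of_le (SchwartzMap.memLp _ _ _) ?_
  refine iInf_le_of_le ?_ le_rfl
  rw [besselOp, besselSymbol_eq_helmPow,
    TemperedDistribution.fourierMultiplierCLM_toTemperedDistributionCLM_eq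
      (hasTemperateGrowth_helmPow zero_le_one _)]
  exact isGivenBy_toTemperedDistributionCLM _

/-- A dyadic cutoff function equal to one on the support of the Fourier transform of `Ψ`. -/
noncomputable def fatBump (Ψ : 𝓢(EuclideanSpace ℝ (Fin n), ℂ)) :
    𝓢(EuclideanSpace ℝ (Fin n), ℂ) :=
  ∑ i ∈ Finset.Icc (-2 : ℤ) 2, dilate (zpow_ne_zero i (two_ne_zero (α := ℝ))) (𝓕 Ψ)

theorem fatBump_apply (Ψ : 𝓢(EuclideanSpace ℝ (Fin n), ℂ)) (ξ : EuclideanSpace ℝ (Fin n)) :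
    fatBump Ψ ξ = ∑ i ∈ Finset.Icc (-2 : ℤ) 2, 𝓕 Ψ ((2 : ℝ) ^ i • ξ) := by
  rw [fatBump, sum_apply]
  rfl

theorem zpow_le_of_mul_le {i k : ℤ} {x y : ℝ} (hx : 0 < x)
    (h : (2 : ℝ) ^ i * x ≤ y) (hxy : y < 2 ^ (k + 1) * x) : i ≤ k := by
  have h1 : (2 : ℝ) ^ i < 2 ^ (k + 1) := lt_of_mul_lt_mul_right (h.trans_lt hxy) hx.le
  have := (zpow_lt_zpow_iff_right₀ (one_lt_two : (1 : ℝ) < 2)).1 h1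
  omega

theorem IsDyadicPartition.support_zpow {Ψ : 𝓢(EuclideanSpace ℝ (Fin n), ℂ)}
    (hΨ : IsDyadicPartition Ψ) {i : ℤ} {ξ : EuclideanSpace ℝ (Fin n)}
    (h : 𝓕 Ψ ((2 : ℝ) ^ i • ξ) ≠ 0) : 1 / 2 ≤ (2 : ℝ) ^ i * ‖ξ‖ ∧ (2 : ℝ) ^ i * ‖ξ‖ ≤ 2 := by
  have := hΨ.support_subset _ h
  rwa [norm_smul, Real.norm_of_nonneg (by positivity)] at this

/-- Where `𝓕 Ψ` does not vanish, `1/2 ≤ |ξ| ≤ 2`. There only the scales `|j| ≤ 2` of the partition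
of unity can contribute, and these are the ones that `fatBump` sums. -/
theorem IsDyadicPartition.fatBump_eq_one {Ψ : 𝓢(EuclideanSpace ℝ (Fin n), ℂ)}
    (hΨ : IsDyadicPartition Ψ) {ξ : EuclideanSpace ℝ (Fin n)} (h : 𝓕 Ψ ξ ≠ 0) :
    fatBump Ψ ξ = 1 := by
  obtain ⟨h1, h2⟩ := hΨ.support_subset ξ h
  have hξ : ξ ≠ 0 := by
    rintro rfl
    norm_num at h1
  have hs := hΨ.hasSum_one ξ hξ
  have hz : ∀ j ∉ Finset.Icc (-2 : ℤ) 2, 𝓕 Ψ ((2 : ℝ) ^ (-j) • ξ) = 0 := by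
    intro j hj
    by_contra hne
    obtain ⟨h3, h4⟩ := hΨ.support_zpow hne
    have hξ0 : 0 < ‖ξ‖ := by linarith
    apply hj
    rw [Finset.mem_Icc]
    have a1 : -j ≤ 2 := zpow_le_of_mul_le hξ0 h4 (by norm_num; linarith)
    have a2 : j ≤ 2 := by
      have h5 : (2 : ℝ) ^ j * (1 / 2) ≤ ‖ξ‖ := by
        calc (2 : ℝ) ^ j * (1 / 2) ≤ 2 ^ j * (2 ^ (-j) * ‖ξ‖) := by gcongr
          _ = ‖ξ‖ := by rw [← mul_assoc, ← zpow_add₀ two_ne_zero]; simp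
      exact zpow_le_of_mul_le (by norm_num) h5 (by norm_num; linarith)
    constructor <;> omega
  rw [fatBump_apply, hs.unique (hasSum_sum_of_ne_finset_zero hz)]
  refine Finset.sum_bij (fun i _ ↦ -i) ?_ ?_ ?_ ?_
  · intro i hi
    rw [Finset.mem_Icc] at hi ⊢
    omega
  · intro i _ j _ hij
    exact neg_injective hij
  · intro i hi
    refine ⟨-i, ?_, neg_neg i⟩
    rw [Finset.mem_Icc] at hi ⊢
    omega
  · intro i _
    rw [neg_neg]

theorem IsDyadicPartition.fatBump_support {Ψ : 𝓢(EuclideanSpace ℝ (Fin n), ℂ)}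
    (hΨ : IsDyadicPartition Ψ) {ξ : EuclideanSpace ℝ (Fin n)} (h : fatBump Ψ ξ ≠ 0) :
    1 / 8 ≤ ‖ξ‖ ∧ ‖ξ‖ ≤ 8 := by
  rw [fatBump_apply] at h
  obtain ⟨i, hi, hne⟩ := Finset.exists_ne_zero_of_sum_ne_zero h
  rw [Finset.mem_Icc] at hi
  obtain ⟨h1, h2⟩ := hΨ.support_zpow hne
  have u1 : (2 : ℝ) ^ i ≤ 2 ^ (2 : ℤ) := zpow_le_zpow_right₀ one_le_two hi.2
  have u2 : (2 : ℝ) ^ (-2 : ℤ) ≤ 2 ^ i := zpow_le_zpow_right₀ one_le_two hi.1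
  norm_num at u1 u2
  have := norm_nonneg ξ
  constructor <;> nlinarith

/-- The function `∑_{k ∈ J} (u_k · fatBump) (2^{-k} ξ)`. -/
noncomputable def dyadicSum (Ψ : 𝓢(EuclideanSpace ℝ (Fin n), ℂ)) (J : Finset ℤ)
    (u : ℤ → 𝓢(EuclideanSpace ℝ (Fin n), ℂ)) (ξ : EuclideanSpace ℝ (Fin n)) : ℂ :=
  ∑ k ∈ J, u k ((2 : ℝ) ^ (-k) • ξ) * fatBump Ψ ((2 : ℝ) ^ (-k) • ξ)

theorem continuous_dyadicSum (Ψ : 𝓢(EuclideanSpace ℝ (Fin n), ℂ)) (J : Finset ℤ)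
    (u : ℤ → 𝓢(EuclideanSpace ℝ (Fin n), ℂ)) : Continuous (dyadicSum Ψ J u) := by
  unfold dyadicSum
  refine continuous_finsetSum _ fun k _ ↦ ?_
  exact ((u k).continuous.comp (continuous_const_smul _)).mul
    ((fatBump Ψ).continuous.comp (continuous_const_smul _))

theorem memLp_top_dyadicSum (Ψ : 𝓢(EuclideanSpace ℝ (Fin n), ℂ)) (J : Finset ℤ)
    (u : ℤ → 𝓢(EuclideanSpace ℝ (Fin n), ℂ)) : MemLp (dyadicSum Ψ J u) (⊤ : ℝ≥0∞) := by
  have hM : ∀ v : 𝓢(EuclideanSpace ℝ (Fin n), ℂ), ∃ M, ∀ x, ‖v x‖ ≤ M :=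
    fun v ↦ ⟨_, v.norm_le_seminorm ℝ⟩
  choose M hM using hM
  refine memLp_top_of_bound (continuous_dyadicSum Ψ J u).aestronglyMeasurable
    (∑ k ∈ J, M (u k) * M (fatBump Ψ)) (.of_forall fun ξ ↦ ?_)
  refine (norm_sum_le _ _).trans (Finset.sum_le_sum fun k _ ↦ ?_)
  rw [norm_mul]
  exact mul_le_mul (hM _ _) (hM _ _) (norm_nonneg _) ((norm_nonneg _).trans (hM _ 0))

theorem two_zpow_pos (i : ℤ) : (0 : ℝ) < 2 ^ i := by positivity

/-- The localization of a dilated fat bump to the support of the Fourier transform of `Ψ`. -/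
noncomputable def cutoff (Ψ : 𝓢(EuclideanSpace ℝ (Fin n), ℂ)) (i : ℤ) :
    𝓢(EuclideanSpace ℝ (Fin n), ℂ) :=
  SchwartzMap.smulLeftCLM ℂ (⇑(𝓕 Ψ : 𝓢(EuclideanSpace ℝ (Fin n), ℂ)))
    (dilate (two_zpow_pos i).ne' (fatBump Ψ))

/-- The localized pieces of a dyadic sum. -/
theorem dyadicSum_mul_eq {Ψ : 𝓢(EuclideanSpace ℝ (Fin n), ℂ)} (hΨ : IsDyadicPartition Ψ)
    (J : Finset ℤ) (u : ℤ → 𝓢(EuclideanSpace ℝ (Fin n), ℂ)) (j : ℤ)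
    (ξ : EuclideanSpace ℝ (Fin n)) :
    dyadicSum Ψ J u ((2 : ℝ) ^ j • ξ) * 𝓕 Ψ ξ
      = ∑ i ∈ (Finset.Icc (-4 : ℤ) 4).filter (fun i ↦ j - i ∈ J),
        SchwartzMap.smulLeftCLM ℂ (cutoff Ψ i)
          (dilate (two_zpow_pos i).ne' (u (j - i))) ξ := by
  have e : ∀ i, SchwartzMap.smulLeftCLM ℂ (cutoff Ψ i)
          (dilate (two_zpow_pos i).ne' (u (j - i))) ξ
      = 𝓕 Ψ ξ * fatBump Ψ ((2 : ℝ) ^ i • ξ) * u (j - i) ((2 : ℝ) ^ i • ξ) := fun i ↦ by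
    rw [SchwartzMap.smulLeftCLM_apply_apply (SchwartzMap.hasTemperateGrowth _), cutoff,
      SchwartzMap.smulLeftCLM_apply_apply (SchwartzMap.hasTemperateGrowth _)]
    rfl
  simp only [e]
  rw [dyadicSum, Finset.sum_mul]
  -- The annuli `1/8 ≤ 2^{j-k}|ξ| ≤ 8` and `1/2 ≤ |ξ| ≤ 2` meet only if `|j - k| ≤ 4`.
  have hz : ∀ k ∈ J, j - k ∉ Finset.Icc (-4 : ℤ) 4 →
      u k ((2 : ℝ) ^ (-k) • (2 : ℝ) ^ j • ξ) * fatBump Ψ ((2 : ℝ) ^ (-k) • (2 : ℝ) ^ j • ξ)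
        * 𝓕 Ψ ξ = 0 := by
    intro k _ hk
    by_contra hne
    have n1 := right_ne_zero_of_mul hne
    have n2 := right_ne_zero_of_mul (left_ne_zero_of_mul hne)
    obtain ⟨h1, h2⟩ := hΨ.support_subset ξ n1
    obtain ⟨h3, h4⟩ := hΨ.fatBump_support n2
    rw [smul_smul, ← zpow_add₀ two_ne_zero, norm_smul, Real.norm_of_nonneg (by positivity)] at h3 h4
    have hξ0 : 0 < ‖ξ‖ := by linarith
    apply hk
    rw [Finset.mem_Icc]
    have a1 : -k + j ≤ 4 := zpow_le_of_mul_le hξ0 h4 (by norm_num; linarith)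
    have a2 : k - j ≤ 4 := by
      have h5 : (2 : ℝ) ^ (k - j) * (1 / 8) ≤ ‖ξ‖ := by
        calc (2 : ℝ) ^ (k - j) * (1 / 8) ≤ 2 ^ (k - j) * (2 ^ (-k + j) * ‖ξ‖) := by gcongr
          _ = ‖ξ‖ := by rw [← mul_assoc, ← zpow_add₀ two_ne_zero]; simp
      exact zpow_le_of_mul_le (by norm_num) h5 (by norm_num; linarith)
    constructor <;> omega
  symm
  refine Finset.sum_bij_ne_zero (fun i _ _ ↦ j - i) ?_ ?_ ?_ ?_
  · intro i hi _
    exact (Finset.mem_filter.1 hi).2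
  · intro a _ _ b _ _ hab
    omega
  · intro k hk hne
    have h1 : j - k ∈ Finset.Icc (-4 : ℤ) 4 := by
      by_contra h
      exact hne (hz k hk h)
    refine ⟨j - k, Finset.mem_filter.2 ⟨h1, by rwa [sub_sub_cancel]⟩, ?_, sub_sub_cancel _ _⟩
    rw [smul_smul, ← zpow_add₀ two_ne_zero] at hne
    rw [sub_sub_cancel, show j - k = -k + j by ring]
    intro h0
    apply hne
    rw [← h0]
    ring
  · intro i _ _
    rw [smul_smul, ← zpow_add₀ two_ne_zero, show -(j - i) + j = i by ring]
    ring

/-- At each scale `j` only the nine relative scales `i = j - k` in `[-4, 4]` interact. For each `i`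
the cutoff and the dilation are fixed, so `exists_lpNormReal_mul_dilate_le` applies with a constant
independent of `j`, `J` and `w`. -/
theorem exists_hormanderENorm_le {Ψ : 𝓢(EuclideanSpace ℝ (Fin n), ℂ)} (hΨ : IsDyadicPartition Ψ)
    {r r' : ℝ} (hr : r.HolderConjugate r') (s : ℝ) : ∃ C : ℝ, 0 ≤ C ∧
      ∀ (τ N : ℝ) (J : Finset ℤ) (w : ℤ → 𝓢(EuclideanSpace ℝ (Fin n), ℂ)), 0 ≤ N →
        (∀ k ∈ J, lpNormReal r (w k) ≤ N) →
        hormanderENorm Ψ r s (dyadicSum Ψ J fun k ↦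
          SchwartzMap.fourierMultiplierCLM ℂ (helmPow 1 (-((s / 2 : ℝ) : ℂ) + τ * I)) (w k))
          ≤ ENNReal.ofReal (C * Real.exp (Real.pi * |τ|) * N) := by
  have h := fun i : ℤ ↦ exists_lpNormReal_mul_dilate_le (cutoff Ψ i) (s / 2) (two_zpow_pos i) hr
  choose C hC0 hC using h
  refine ⟨∑ i ∈ Finset.Icc (-4 : ℤ) 4, C i, Finset.sum_nonneg fun i _ ↦ hC0 i,
    fun τ N J w hN hw ↦ iSup_le fun j ↦ ?_⟩
  set H := ∑ i ∈ (Finset.Icc (-4 : ℤ) 4).filter (fun i ↦ j - i ∈ J),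
        SchwartzMap.smulLeftCLM ℂ (cutoff Ψ i)
          (dilate (two_zpow_pos i).ne' (SchwartzMap.fourierMultiplierCLM ℂ
            (helmPow 1 (-((s / 2 : ℝ) : ℂ) + τ * I)) (w (j - i)))) with hH
  have e : (fun ξ ↦ dyadicSum Ψ J (fun k ↦
          SchwartzMap.fourierMultiplierCLM ℂ (helmPow 1 (-((s / 2 : ℝ) : ℂ) + τ * I)) (w k))
          ((2 : ℝ) ^ j • ξ) * 𝓕 Ψ ξ) = ⇑H := by
    ext ξ
    rw [dyadicSum_mul_eq hΨ, hH, sum_apply]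
  rw [e]
  refine (sobolevENorm_le r s H).trans ?_
  rw [hH, map_sum]
  have hsum : ∀ (S : Finset ℤ) (v : ℤ → 𝓢(EuclideanSpace ℝ (Fin n), ℂ)),
      ((∑ i ∈ S, v i : 𝓢(EuclideanSpace ℝ (Fin n), ℂ)) : EuclideanSpace ℝ (Fin n) → ℂ)
        = ∑ i ∈ S, ⇑(v i) := fun S v ↦ by
    ext x
    rw [sum_apply, Finset.sum_apply]
  rw [hsum]
  refine (eLpNorm_sum_le (fun i _ ↦ (SchwartzMap.continuous _).aestronglyMeasurable)
    (by simpa using hr.lt.le)).trans ?_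
  rw [Finset.sum_mul, Finset.sum_mul, ENNReal.ofReal_sum_of_nonneg fun i _ ↦ by
    have := hC0 i
    positivity]
  refine (Finset.sum_le_sum fun i hi ↦ ?_).trans
    (Finset.sum_le_sum_of_subset (Finset.filter_subset _ _))
  have h1 := hC i τ (w (j - i))
  have h2 := hw _ (Finset.mem_filter.1 hi).2
  rw [← ENNReal.ofReal_toReal (SchwartzMap.memLp _ (ENNReal.ofReal r) volume).eLpNorm_ne_top]
  refine ENNReal.ofReal_le_ofReal (h1.trans ?_)
  have := hC0 i
  gcongr

end Sobolev

/-! ### Approximation by smooth bumps with disjoint supports. -/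

section Bumps

variable {E : Type*} [NormedAddCommGroup E] [InnerProductSpace ℝ E] [FiniteDimensional ℝ E]
  [MeasurableSpace E] [BorelSpace E]

variable (E) in
/-- Finitely many disjointly supported smooth bumps, labelled by non-zero values, with upper bounds
for the measures of their supports. -/
structure BumpFamily where
  /-- the labels -/
  s : Finset ℂ
  /-- the bumps -/
  χ : ℂ → 𝓢(E, ℂ)
  /-- the bounds for the measures of the supports -/
  m : ℂ → ℝ
  ne_zero : ∀ c ∈ s, c ≠ 0
  m_nonneg : ∀ c ∈ s, 0 ≤ m c
  compact : ∀ c ∈ s, HasCompactSupport (χ c)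
  norm_le : ∀ c ∈ s, ∀ x, ‖χ c x‖ ≤ 1
  disjoint : ∀ c ∈ s, ∀ c' ∈ s, c ≠ c' → ∀ x, χ c x ≠ 0 → χ c' x = 0
  volume_le : ∀ c ∈ s, volume (Function.support (χ c)) ≤ ENNReal.ofReal (m c)

/-- The function taking the value `d c` on the bump labelled by `c`. -/
noncomputable def BumpFamily.comb (F : BumpFamily E) (d : ℂ → ℂ) : 𝓢(E, ℂ) :=
  ∑ c ∈ F.s, d c • F.χ c

/-- An upper bound for the integral of the `a`-th power of `F.comb id`. -/
noncomputable def BumpFamily.mass (F : BumpFamily E) (a : ℝ) : ℝ := ∑ c ∈ F.s, ‖c‖ ^ a * F.m c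

theorem BumpFamily.comb_apply (F : BumpFamily E) (d : ℂ → ℂ) (x : E) :
    F.comb d x = ∑ c ∈ F.s, d c * F.χ c x := by
  rw [BumpFamily.comb, sum_apply]
  rfl

theorem BumpFamily.mass_nonneg (F : BumpFamily E) (a : ℝ) : 0 ≤ F.mass a :=
  Finset.sum_nonneg fun c hc ↦ mul_nonneg (by positivity) (F.m_nonneg c hc)

theorem BumpFamily.hasCompactSupport_comb (F : BumpFamily E) (d : ℂ → ℂ) :
    HasCompactSupport (F.comb d) := by
  have e : ⇑(F.comb d) = ∑ c ∈ F.s, fun x ↦ d c * F.χ c x := by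
    ext x
    rw [F.comb_apply, Finset.sum_apply]
  rw [e]
  refine Finset.sum_induction _ (fun f : E → ℂ ↦ HasCompactSupport f)
    (fun f g hf hg ↦ hf.add hg) HasCompactSupport.zero fun c hc ↦ ?_
  exact (F.compact c hc).mul_left

/-- At each point at most one bump is nonzero, so the power of the sum splits for every `a > 0`,
also below `1`, and for arbitrary coefficients `d`. -/
theorem BumpFamily.lintegral_comb_le (F : BumpFamily E) (d : ℂ → ℂ) {a : ℝ} (ha : 0 < a) :
    ∫⁻ x, ‖F.comb d x‖ₑ ^ a ≤ ENNReal.ofReal (∑ c ∈ F.s, ‖d c‖ ^ a * F.m c) := by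
  have hp : ∀ x, ‖F.comb d x‖ₑ ^ a
      ≤ ∑ c ∈ F.s, (Function.support (F.χ c)).indicator (fun _ ↦ ‖d c‖ₑ ^ a) x := by
    intro x
    by_cases h : ∃ c ∈ F.s, F.χ c x ≠ 0
    · obtain ⟨c, hc, hne⟩ := h
      have e : F.comb d x = d c * F.χ c x := by
        rw [F.comb_apply]
        refine Finset.sum_eq_single_of_mem c hc fun c' hc' hcc ↦ ?_
        rw [F.disjoint c hc c' hc' hcc.symm x hne, mul_zero]
      refine le_trans ?_ (Finset.single_le_sum (f := fun c ↦
        (Function.support (F.χ c)).indicator (fun _ ↦ ‖d c‖ₑ ^ a) x) (fun _ _ ↦ zero_le) hc)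
      rw [Set.indicator_of_mem (by exact hne), e, enorm_mul]
      refine ENNReal.rpow_le_rpow (mul_le_of_le_one_right zero_le ?_) ha.le
      rw [← ofReal_norm]
      exact ENNReal.ofReal_le_one.2 (F.norm_le c hc x)
    · push Not at h
      have e : F.comb d x = 0 := by
        rw [F.comb_apply]
        exact Finset.sum_eq_zero fun c hc ↦ by rw [h c hc, mul_zero]
      rw [e, enorm_zero, ENNReal.zero_rpow_of_pos ha]
      exact zero_le
  have hm : ∀ c, MeasurableSet (Function.support (F.χ c)) := fun c ↦
    ((F.χ c).continuous.isOpen_support).measurableSet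
  refine (lintegral_mono hp).trans ?_
  rw [lintegral_finsetSum _ fun c _ ↦ (measurable_const.indicator (hm c)),
    ENNReal.ofReal_sum_of_nonneg fun c hc ↦ mul_nonneg (by positivity) (F.m_nonneg c hc)]
  refine Finset.sum_le_sum fun c hc ↦ ?_
  rw [lintegral_indicator_const (hm c), ENNReal.ofReal_mul (by positivity),
    ← ENNReal.ofReal_rpow_of_nonneg (norm_nonneg _) ha.le, ofReal_norm]
  gcongr
  exact F.volume_le c hc

theorem BumpFamily.eLpNorm_comb_le (F : BumpFamily E) (d : ℂ → ℂ) {a : ℝ} (ha : 0 < a) :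
    eLpNorm (F.comb d) (ENNReal.ofReal a)
      ≤ ENNReal.ofReal ((∑ c ∈ F.s, ‖d c‖ ^ a * F.m c) ^ a⁻¹) := by
  rw [eLpNorm_eq_lintegral_rpow_enorm_toReal (by simpa using ha) ENNReal.ofReal_ne_top,
    ENNReal.toReal_ofReal ha.le, one_div, ← ENNReal.ofReal_rpow_of_nonneg
      (Finset.sum_nonneg fun c hc ↦ mul_nonneg (by positivity) (F.m_nonneg c hc)) (by positivity)]
  exact ENNReal.rpow_le_rpow (F.lintegral_comb_le d ha) (by positivity)

theorem exists_schwartz_bump {K U : Set E} (hK : IsCompact K) (hU : IsOpen U) (hKU : K ⊆ U)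
    (hb : Bornology.IsBounded U) :
    ∃ χ : 𝓢(E, ℂ), HasCompactSupport χ ∧ (∀ x, ∃ t : ℝ, 0 ≤ t ∧ t ≤ 1 ∧ χ x = t) ∧
      (∀ x ∈ K, χ x = 1) ∧ Function.support χ ⊆ U := by
  obtain ⟨f, hf, hr, hs, h1⟩ := exists_contMDiff_support_eq_eq_one_iff (n := (⊤ : ℕ∞))
    (modelWithCornersSelf ℝ E) hU hK.isClosed hKU
  have hf' : ContDiff ℝ ∞ fun x ↦ (f x : ℂ) := Complex.ofRealCLM.contDiff.comp hf.contDiff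
  have hsup : Function.support (fun x ↦ (f x : ℂ)) = U := by
    rw [← hs]
    ext x
    simp
  have hc : HasCompactSupport fun x ↦ (f x : ℂ) := by
    rw [HasCompactSupport, tsupport, hsup]
    exact hb.isCompact_closure
  refine ⟨hc.toSchwartzMap hf', hc, fun x ↦ ⟨f x, ?_, ?_, rfl⟩, fun x hx ↦ ?_, hsup.le⟩
  · exact (hr ⟨x, rfl⟩).1
  · exact (hr ⟨x, rfl⟩).2
  · have := (h1 x).1 hx
    change (f x : ℂ) = 1
    rw [this, Complex.ofReal_one]

/-- Finitely many disjoint compact sets have disjoint thickenings of a common small radius; these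
are intersected with the given neighbourhoods. -/
theorem exists_disjoint_open {ι : Type*} (s : Finset ι) {K V : ι → Set E}
    (hK : ∀ i ∈ s, IsCompact (K i)) (hV : ∀ i ∈ s, IsOpen (V i)) (hKV : ∀ i ∈ s, K i ⊆ V i)
    (hd : ∀ i ∈ s, ∀ j ∈ s, i ≠ j → Disjoint (K i) (K j)) :
    ∃ U : ι → Set E, (∀ i ∈ s, IsOpen (U i) ∧ K i ⊆ U i ∧ U i ⊆ V i ∧
      Bornology.IsBounded (U i)) ∧ ∀ i ∈ s, ∀ j ∈ s, i ≠ j → Disjoint (U i) (U j) := by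
  have h : ∀ i ∈ s, ∀ j ∈ s, i ≠ j → ∀ᶠ ρ in nhdsWithin (0 : ℝ) (Set.Ioi 0),
      Disjoint (Metric.thickening ρ (K i)) (Metric.thickening ρ (K j)) := by
    intro i hi j hj hij
    obtain ⟨δ, hδ, h⟩ := (hd i hi j hj hij).exists_thickenings (hK i hi) (hK j hj).isClosed
    filter_upwards [Ioo_mem_nhdsGT hδ] with ρ hρ
    exact h.mono (Metric.thickening_mono hρ.2.le _) (Metric.thickening_mono hρ.2.le _)
  have h2 : ∀ᶠ ρ in nhdsWithin (0 : ℝ) (Set.Ioi 0), ∀ i ∈ s, ∀ j ∈ s, i ≠ j →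
      Disjoint (Metric.thickening ρ (K i)) (Metric.thickening ρ (K j)) := by
    rw [Filter.eventually_all_finset]
    intro i hi
    rw [Filter.eventually_all_finset]
    intro j hj
    by_cases hij : i = j
    · exact .of_forall fun ρ hne ↦ absurd hij hne
    · filter_upwards [h i hi j hj hij] with ρ hρ _ using hρ
  obtain ⟨ρ, hρ, hρ0⟩ := (h2.and self_mem_nhdsWithin).exists
  refine ⟨fun i ↦ V i ∩ Metric.thickening ρ (K i), fun i hi ↦
    ⟨(hV i hi).inter Metric.isOpen_thickening, Set.subset_inter (hKV i hi)
      (Metric.self_subset_thickening hρ0 _), Set.inter_subset_left,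
      (hK i hi).isBounded.thickening.subset Set.inter_subset_right⟩, fun i hi j hj hij ↦ ?_⟩
  exact (hρ i hi j hj hij).mono Set.inter_subset_right Set.inter_subset_right

/-- Each level set is approximated by a compact set from inside, and this compact set by an open set
from outside, with error `δ` in measure each time. A smooth bump between the two differs from the
indicator only on a set of measure at most `2δ`. -/
theorem exists_bumpFamily_of_simpleFunc (φ : SimpleFunc E ℂ)
    (hfin : ∀ c ≠ 0, volume (φ ⁻¹' {c}) ≠ ⊤) {δ : ℝ} (hδ : 0 < δ) :
    ∃ F : BumpFamily E, F.s = φ.range.filter (· ≠ 0) ∧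
      (∀ c ∈ F.s, F.m c = (volume (φ ⁻¹' {c})).toReal + δ) ∧
      ∀ c ∈ F.s, ∃ S : Set E, MeasurableSet S ∧ volume S ≤ ENNReal.ofReal (2 * δ) ∧
        ∀ x, ‖F.χ c x - (φ ⁻¹' {c}).indicator 1 x‖ ≤ S.indicator 1 x := by
  have hδ' : ENNReal.ofReal δ ≠ 0 := by simpa using hδ
  have hAm : ∀ c, MeasurableSet (φ ⁻¹' {c}) := fun c ↦ φ.measurableSet_fiber c
  have hK : ∀ c ∈ φ.range.filter (· ≠ 0), ∃ K ⊆ φ ⁻¹' {c}, IsCompact K ∧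
      volume (φ ⁻¹' {c}) < volume K + ENNReal.ofReal δ := fun c hc ↦
    (hAm c).exists_isCompact_lt_add (hfin c (Finset.mem_filter.1 hc).2) hδ'
  choose! K hKA hKc hKv using hK
  have hV : ∀ c ∈ φ.range.filter (· ≠ 0), ∃ V ⊇ K c, IsOpen V ∧
      volume V < volume (K c) + ENNReal.ofReal δ := fun c hc ↦
    (K c).exists_isOpen_lt_add (hKc c hc).measure_lt_top.ne hδ'
  choose! V hKV hVo hVv using hV
  obtain ⟨U, hU, hUd⟩ := exists_disjoint_open (φ.range.filter (· ≠ 0)) hKc hVo hKV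
    (fun c hc c' hc' hcc ↦ (Disjoint.preimage φ (Set.disjoint_singleton.2 hcc)).mono
      (hKA c hc) (hKA c' hc'))
  have hχ : ∀ c ∈ φ.range.filter (· ≠ 0), ∃ χ : 𝓢(E, ℂ), HasCompactSupport χ ∧
      (∀ x, ∃ t : ℝ, 0 ≤ t ∧ t ≤ 1 ∧ χ x = t) ∧ (∀ x ∈ K c, χ x = 1) ∧
      Function.support χ ⊆ U c := fun c hc ↦
    exists_schwartz_bump (hKc c hc) (hU c hc).1 (hU c hc).2.1 (hU c hc).2.2.2
  choose! χ hχc hχt hχ1 hχs using hχ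
  have hUv : ∀ c ∈ φ.range.filter (· ≠ 0), volume (U c) < volume (K c) + ENNReal.ofReal δ :=
    fun c hc ↦ (measure_mono (hU c hc).2.2.1).trans_lt (hVv c hc)
  refine ⟨⟨φ.range.filter (· ≠ 0), χ, fun c ↦ (volume (φ ⁻¹' {c})).toReal + δ,
    fun c hc ↦ (Finset.mem_filter.1 hc).2, fun c _ ↦ by positivity, hχc, fun c hc x ↦ ?_,
    fun c hc c' hc' hcc x hx ↦ ?_, fun c hc ↦ ?_⟩, rfl, fun c _ ↦ rfl, fun c hc ↦ ?_⟩
  · obtain ⟨t, h0, h1, ht⟩ := hχt c hc x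
    rw [ht, Complex.norm_real, Real.norm_of_nonneg h0]
    exact h1
  · by_contra hx'
    exact Set.disjoint_left.1 (hUd c hc c' hc' hcc) (hχs c hc hx) (hχs c' hc' hx')
  · rw [ENNReal.ofReal_add ENNReal.toReal_nonneg hδ.le,
      ENNReal.ofReal_toReal (hfin c (Finset.mem_filter.1 hc).2)]
    exact (measure_mono (hχs c hc)).trans ((hUv c hc).le.trans (by
      gcongr
      exact hKA c hc))
  · have hKm : MeasurableSet (K c) := (hKc c hc).isClosed.measurableSet
    have hKf : volume (K c) ≠ ⊤ := (hKc c hc).measure_lt_top.ne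
    refine ⟨(φ ⁻¹' {c} \ K c) ∪ (U c \ K c), ((hAm c).diff hKm).union
      ((hU c hc).1.measurableSet.diff hKm), ?_, fun x ↦ ?_⟩
    · refine (measure_union_le _ _).trans ?_
      rw [two_mul, ENNReal.ofReal_add hδ.le hδ.le]
      exact add_le_add (measure_sdiff_lt_of_lt_add hKm.nullMeasurableSet (hKA c hc) hKf
        (hKv c hc)).le (measure_sdiff_lt_of_lt_add hKm.nullMeasurableSet (hU c hc).2.1 hKf
        (hUv c hc)).le
    · by_cases hxK : x ∈ K c
      · rw [Set.indicator_of_mem (hKA c hc hxK), hχ1 c hc x hxK]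
        simp only [Pi.one_apply, sub_self, norm_zero]
        exact Set.indicator_nonneg (fun _ _ ↦ zero_le_one) _
      · obtain ⟨t, h0, h1, ht⟩ := hχt c hc x
        by_cases hxS : x ∈ (φ ⁻¹' {c} \ K c) ∪ (U c \ K c)
        · rw [Set.indicator_of_mem hxS, Pi.one_apply, ht]
          by_cases hxA : x ∈ φ ⁻¹' {c}
          · rw [Set.indicator_of_mem hxA, Pi.one_apply, ← Complex.ofReal_one,
              ← Complex.ofReal_sub, Complex.norm_real, Real.norm_eq_abs, abs_le]
            constructor <;> linarith
          · rw [Set.indicator_of_notMem hxA, sub_zero, Complex.norm_real,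
              Real.norm_of_nonneg h0]
            exact h1
        · have hxA : x ∉ φ ⁻¹' {c} := fun h ↦ hxS (Or.inl ⟨h, hxK⟩)
          have hxU : x ∉ U c := fun h ↦ hxS (Or.inr ⟨h, hxK⟩)
          have hx0 : χ c x = 0 := by
            by_contra h
            exact hxU (hχs c hc h)
          rw [Set.indicator_of_notMem hxA, Set.indicator_of_notMem hxS, hx0, sub_zero, norm_zero]

theorem simpleFunc_eq_sum (φ : SimpleFunc E ℂ) (x : E) :
    φ x = ∑ c ∈ φ.range.filter (· ≠ 0), c * (φ ⁻¹' {c}).indicator 1 x := by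
  by_cases h : φ x = 0
  · rw [Finset.sum_eq_zero, h]
    intro c hc
    rw [Set.indicator_of_notMem, mul_zero]
    intro hx
    rw [Set.mem_preimage, Set.mem_singleton_iff] at hx
    exact (Finset.mem_filter.1 hc).2 (hx.symm.trans h)
  · rw [Finset.sum_eq_single_of_mem (φ x) (Finset.mem_filter.2 ⟨φ.mem_range_self x, h⟩)]
    · rw [Set.indicator_of_mem (by simp), Pi.one_apply, mul_one]
    · intro c _ hne
      rw [Set.indicator_of_notMem, mul_zero]
      intro hx
      exact hne hx.symm

theorem eLpNorm_comb_sub_simpleFunc_le (φ : SimpleFunc E ℂ) (F : BumpFamily E)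
    (hF : F.s = φ.range.filter (· ≠ 0)) {δ b : ℝ} (hδ : 0 < δ) (hb : 1 ≤ b)
    (h : ∀ c ∈ F.s, ∃ S : Set E, MeasurableSet S ∧ volume S ≤ ENNReal.ofReal (2 * δ) ∧
        ∀ x, ‖F.χ c x - (φ ⁻¹' {c}).indicator 1 x‖ ≤ S.indicator 1 x) :
    eLpNorm (⇑(F.comb id) - ⇑φ) (ENNReal.ofReal b)
      ≤ ENNReal.ofReal ((∑ c ∈ F.s, ‖c‖) * (2 * δ) ^ b⁻¹) := by
  have e : ⇑(F.comb id) - ⇑φ = ∑ c ∈ F.s, c • fun x ↦ (F.χ c x - (φ ⁻¹' {c}).indicator 1 x) := by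
    ext x
    rw [Pi.sub_apply, F.comb_apply, simpleFunc_eq_sum φ x, ← hF, ← Finset.sum_sub_distrib,
      Finset.sum_apply]
    simp only [id, Pi.smul_apply, smul_eq_mul, mul_sub]
  have hm : ∀ c, AEStronglyMeasurable (fun x ↦ F.χ c x - (φ ⁻¹' {c}).indicator 1 x)
      (volume : Measure E) := fun c ↦
    (F.χ c).continuous.aestronglyMeasurable.sub
      ((aestronglyMeasurable_const (b := (1 : ℂ))).indicator (φ.measurableSet_fiber c))
  rw [e]
  refine (eLpNorm_sum_le (fun c _ ↦ (hm c).const_smul c) (by simpa using hb)).trans ?_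
  rw [Finset.sum_mul, ENNReal.ofReal_sum_of_nonneg fun c _ ↦ by positivity]
  refine Finset.sum_le_sum fun c hc ↦ ?_
  obtain ⟨S, hS, hSv, hSb⟩ := h c hc
  rw [eLpNorm_const_smul, ENNReal.ofReal_mul (norm_nonneg _), ofReal_norm]
  gcongr
  refine (eLpNorm_mono_real (g := S.indicator 1) hSb).trans ?_
  have e1 : (S.indicator 1 : E → ℝ) = S.indicator fun _ ↦ (1 : ℝ) := rfl
  rw [e1, eLpNorm_indicator_const hS (by simpa using (by linarith : 0 < b)) ENNReal.ofReal_ne_top,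
    ENNReal.toReal_ofReal (by linarith), ← ENNReal.ofReal_rpow_of_nonneg (by positivity)
    (by positivity), enorm_one, one_mul, one_div]
  gcongr

theorem lintegral_simpleFunc_rpow (φ : SimpleFunc E ℂ) {a : ℝ} (ha : 0 < a) :
    ∫⁻ x, ‖φ x‖ₑ ^ a
      = ∑ c ∈ φ.range.filter (· ≠ 0), ‖c‖ₑ ^ a * volume (φ ⁻¹' {c}) := by
  have h := (φ.map fun c ↦ ‖c‖ₑ ^ a).lintegral_eq_lintegral (volume : Measure E)
  rw [SimpleFunc.map_lintegral] at h
  simp only [SimpleFunc.coe_map, Function.comp] at h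
  rw [h, Finset.sum_filter]
  refine Finset.sum_congr rfl fun c _ ↦ ?_
  by_cases hc : c = 0
  · rw [if_neg (by simpa using hc), hc, enorm_zero, ENNReal.zero_rpow_of_pos ha, zero_mul]
  · rw [if_pos hc]

/-- Approximation of functions by bump families. -/
theorem exists_bumpFamily_approx {a b : ℝ} (ha : 0 < a) (hb : 1 ≤ b) {w : E → ℂ}
    (hwa : MemLp w (ENNReal.ofReal a)) (hwb : MemLp w (ENNReal.ofReal b)) {ε : ℝ} (hε : 0 < ε) :
    ∃ F : BumpFamily E, eLpNorm (⇑(F.comb id) - w) (ENNReal.ofReal b) ≤ ENNReal.ofReal ε ∧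
      F.mass a ≤ (∫ x, ‖w x‖ ^ a) + ε := by
  have hb0 : 0 < b := by linarith
  wlog hmeas : Measurable w generalizing w
  · obtain ⟨w', hw'm, hw'⟩ := hwa.1
    obtain ⟨F, h1, h2⟩ := this (hwa.ae_eq hw') (hwb.ae_eq hw') hw'm.measurable
    refine ⟨F, ?_, ?_⟩
    · refine (le_of_eq (eLpNorm_congr_ae ?_)).trans h1
      filter_upwards [hw'] with x hx
      simp [hx]
    · refine h2.trans (le_of_eq ?_)
      congr 1
      refine integral_congr_ae ?_
      filter_upwards [hw'] with x hx
      simp [hx]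
  -- These simple functions are dominated by `2‖w‖` and converge pointwise, so their `a`-th power
  -- integrals converge as well. No triangle inequality in `L^a` is used, so `a` may be below `1`.
  set f := fun k ↦ SimpleFunc.approxOn w hmeas Set.univ 0 (Set.mem_univ _) k with hf
  have l1 : Filter.Tendsto (fun k ↦ eLpNorm (⇑(f k) - w) (ENNReal.ofReal b)) Filter.atTop
      (nhds 0) := SimpleFunc.tendsto_approxOn_Lp_eLpNorm hmeas (Set.mem_univ 0) ENNReal.ofReal_ne_top
    (.of_forall fun x ↦ by simp) (by simpa using hwb.2)
  have hfn : ∀ k x, ‖f k x‖ ≤ 2 * ‖w x‖ := fun k x ↦ by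
    rw [two_mul]
    exact SimpleFunc.norm_approxOn_zero_le hmeas (Set.mem_univ 0) x k
  have hwi : Integrable fun x ↦ ‖w x‖ ^ a := by
    have := hwa.integrable_norm_rpow (by simpa using ha) ENNReal.ofReal_ne_top
    rwa [ENNReal.toReal_ofReal ha.le] at this
  have hfa : ∀ k x, ‖f k x‖ ^ a ≤ 2 ^ a * ‖w x‖ ^ a := fun k x ↦ by
    rw [← Real.mul_rpow (by norm_num) (norm_nonneg _)]
    exact Real.rpow_le_rpow (norm_nonneg _) (hfn k x) ha.le
  have hfm : ∀ k, AEStronglyMeasurable (fun x ↦ ‖f k x‖ ^ a) (volume : Measure E) := fun k ↦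
    ((f k).measurable.norm.pow_const a).aestronglyMeasurable
  have l2 : Filter.Tendsto (fun k ↦ ∫ x, ‖f k x‖ ^ a) Filter.atTop
      (nhds (∫ x, ‖w x‖ ^ a)) := by
    refine tendsto_integral_of_dominated_convergence (fun x ↦ 2 ^ a * ‖w x‖ ^ a) hfm
      (hwi.const_mul _) (fun k ↦ .of_forall fun x ↦ ?_) (.of_forall fun x ↦ ?_)
    · rw [Real.norm_of_nonneg (by positivity)]
      exact hfa k x
    · have := SimpleFunc.tendsto_approxOn hmeas (Set.mem_univ 0) (x := x) (by simp)
      exact (this.norm).rpow_const (Or.inr ha.le)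
  have hε2 : 0 < ε / 2 := by linarith
  obtain ⟨k, hk1, hk2⟩ := ((l1.eventually (Iic_mem_nhds
    (show 0 < ENNReal.ofReal (ε / 2) by simpa using hε))).and
    (l2.eventually (Iic_mem_nhds (lt_add_of_pos_right _ hε2)))).exists
  set φ := f k with hφ
  have hφi : Integrable fun x ↦ ‖φ x‖ ^ a :=
    (hwi.const_mul (2 ^ a)).mono' (hfm k) (.of_forall fun x ↦ by
      rw [Real.norm_of_nonneg (by positivity)]
      exact hfa k x)
  have hφl : ENNReal.ofReal (∫ x, ‖φ x‖ ^ a)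
      = ∑ c ∈ φ.range.filter (· ≠ 0), ‖c‖ₑ ^ a * volume (φ ⁻¹' {c}) := by
    rw [← lintegral_simpleFunc_rpow φ ha, ofReal_integral_eq_lintegral_ofReal hφi
      (.of_forall fun x ↦ by positivity)]
    congr 1 with x
    rw [← ENNReal.ofReal_rpow_of_nonneg (norm_nonneg _) ha.le, ofReal_norm]
  have hfin : ∀ c ≠ 0, volume (φ ⁻¹' {c}) ≠ ⊤ := by
    intro c hc htop
    by_cases hcr : c ∈ φ.range
    · have h1 := Finset.single_le_sum (s := φ.range.filter (· ≠ 0))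
        (f := fun c ↦ ‖c‖ₑ ^ a * volume (φ ⁻¹' {c}))
        (fun _ _ ↦ zero_le) (Finset.mem_filter.2 ⟨hcr, hc⟩)
      rw [← hφl] at h1
      have h2 : ‖c‖ₑ ^ a ≠ 0 := by
        rw [Ne, ENNReal.rpow_eq_zero_iff]
        simp [hc]
      simp only [htop, ENNReal.mul_top h2, top_le_iff, ENNReal.ofReal_ne_top] at h1
    · have : φ ⁻¹' {c} = ∅ := by
        rw [Set.eq_empty_iff_forall_notMem]
        intro x hx
        rw [Set.mem_preimage, Set.mem_singleton_iff] at hx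
        exact hcr (hx ▸ φ.mem_range_self x)
      rw [this, measure_empty] at htop
      exact ENNReal.zero_ne_top htop
  have hφr : ∫ x, ‖φ x‖ ^ a
      = ∑ c ∈ φ.range.filter (· ≠ 0), ‖c‖ ^ a * (volume (φ ⁻¹' {c})).toReal := by
    rw [← ENNReal.toReal_ofReal (integral_nonneg fun x ↦ by positivity :
      0 ≤ ∫ x, ‖φ x‖ ^ a), hφl, ENNReal.toReal_sum]
    · refine Finset.sum_congr rfl fun c _ ↦ ?_
      rw [ENNReal.toReal_mul, ← ENNReal.toReal_rpow, toReal_enorm]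
    · intro c hc
      exact ENNReal.mul_ne_top (ENNReal.rpow_ne_top_of_nonneg ha.le enorm_ne_top)
        (hfin c (Finset.mem_filter.1 hc).2)
  set S := φ.range.filter (· ≠ 0) with hS
  -- The simple function is now fixed with finitely many values, so the errors of its smoothing
  -- vanish with `δ`.
  have t1 : Filter.Tendsto (fun δ : ℝ ↦ (∑ c ∈ S, ‖c‖) * (2 * δ) ^ b⁻¹)
      (nhdsWithin 0 (Set.Ioi 0)) (nhds 0) := by
    have hc : Continuous fun δ : ℝ ↦ (∑ c ∈ S, ‖c‖) * (2 * δ) ^ b⁻¹ :=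
      continuous_const.mul ((continuous_const.mul continuous_id).rpow_const
        fun _ ↦ Or.inr (by positivity))
    have := hc.tendsto 0
    rw [mul_zero, Real.zero_rpow (by positivity), mul_zero] at this
    exact this.mono_left nhdsWithin_le_nhds
  have t2 : Filter.Tendsto (fun δ : ℝ ↦ (∑ c ∈ S, ‖c‖ ^ a) * δ)
      (nhdsWithin 0 (Set.Ioi 0)) (nhds 0) := by
    have hc : Continuous fun δ : ℝ ↦ (∑ c ∈ S, ‖c‖ ^ a) * δ := by fun_prop
    have := hc.tendsto 0
    rw [mul_zero] at this
    exact this.mono_left nhdsWithin_le_nhds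
  obtain ⟨δ, ⟨hδ1, hδ2⟩, hδ0⟩ := (((t1.eventually (Iic_mem_nhds hε2)).and
    (t2.eventually (Iic_mem_nhds hε2))).and self_mem_nhdsWithin).exists
  obtain ⟨F, hFs, hFm, hFS⟩ := exists_bumpFamily_of_simpleFunc φ hfin hδ0
  refine ⟨F, ?_, ?_⟩
  · have h1 := eLpNorm_comb_sub_simpleFunc_le φ F hFs hδ0 hb hFS
    have e : ⇑(F.comb id) - w = (⇑(F.comb id) - ⇑φ) + (⇑φ - w) := by
      ext x
      simp
    rw [e, show ε = ε / 2 + ε / 2 by ring, ENNReal.ofReal_add hε2.le hε2.le]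
    refine (eLpNorm_add_le ((F.comb id).continuous.aestronglyMeasurable.sub
      φ.aestronglyMeasurable) (φ.aestronglyMeasurable.sub hwb.1) (by simpa using hb)).trans
      (add_le_add (h1.trans (ENNReal.ofReal_le_ofReal ?_)) hk1)
    rw [hFs]
    exact hδ1
  · have h3 : F.mass a = (∫ x, ‖φ x‖ ^ a) + (∑ c ∈ S, ‖c‖ ^ a) * δ := by
      rw [BumpFamily.mass, hφr, Finset.sum_mul, ← Finset.sum_add_distrib, hFs]
      refine Finset.sum_congr rfl fun c hc ↦ ?_
      rw [hFm c (hFs ▸ hc)]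
      ring
    rw [h3]
    linarith

theorem lintegral_rpow_le_of_forall_closedBall {h : E → ℂ} (hm : AEStronglyMeasurable h) {q : ℝ}
    {X : ℝ≥0∞} (H : ∀ R : ℕ, ∫⁻ x in Metric.closedBall (0 : E) R, ‖h x‖ₑ ^ q ≤ X) :
    ∫⁻ x, ‖h x‖ₑ ^ q ≤ X :=
  le_of_tendsto ((aecover_closedBall (x := (0 : E))
    tendsto_natCast_atTop_atTop).lintegral_tendsto_of_countably_generated
    (hm.enorm.pow_const q)) (.of_forall H)

/-- The converse of Hölder's inequality, tested on bump families. -/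
theorem eLpNorm_le_of_forall_bumpFamily {q q' : ℝ} (hq : q.HolderConjugate q') {h : E → ℂ}
    (hm : AEStronglyMeasurable h) {B : ℝ} (hB : ∀ x, ‖h x‖ ≤ B) {A : ℝ} (hA : 0 ≤ A)
    (H : ∀ G : BumpFamily E, ‖∫ x, h x * G.comb id x‖ ≤ A * G.mass q' ^ q'⁻¹) :
    eLpNorm h (ENNReal.ofReal q) ≤ ENNReal.ofReal A := by
  have hq0 := hq.pos
  have hq0' := hq.symm.pos
  have hB0 : 0 ≤ B := (norm_nonneg _).trans (hB 0)
  -- The `L^q` norm of `h` may be infinite a priori. On a ball `h` is bounded, so the integral `X`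
  -- is finite and a power of it can be cancelled from `X ≤ A * X ^ q'⁻¹`.
  have key : ∀ R : ℕ, ∫⁻ x in Metric.closedBall (0 : E) R, ‖h x‖ₑ ^ q
      ≤ ENNReal.ofReal (A ^ q) := by
    intro R
    set S := Metric.closedBall (0 : E) R with hS
    have hSm : MeasurableSet S := measurableSet_closedBall
    have hSf : volume S ≠ ⊤ := (isCompact_closedBall (0 : E) R).measure_lt_top.ne
    set v : E → ℂ := S.indicator fun x ↦ (‖h x‖ ^ (q - 2) : ℝ) * (starRingEnd ℂ) (h x) with hv
    have hvn : ∀ x ∈ S, ‖v x‖ = ‖h x‖ ^ (q - 1) := fun x hx ↦ by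
      rw [hv, Set.indicator_of_mem hx]
      simp only [norm_mul, Complex.norm_real, RCLike.norm_conj]
      rw [Real.norm_of_nonneg (by positivity)]
      rcases (norm_nonneg (h x)).eq_or_lt with h1 | h1
      · rw [← h1, mul_zero, Real.zero_rpow (by linarith [hq.lt])]
      · rw [← Real.rpow_add_one h1.ne']
        ring_nf
    have hvh : ∀ x, h x * v x = S.indicator (fun x ↦ ((‖h x‖ ^ q : ℝ) : ℂ)) x := fun x ↦ by
      by_cases hx : x ∈ S
      · rw [hv, Set.indicator_of_mem hx, Set.indicator_of_mem hx]
        rw [mul_left_comm, Complex.mul_conj, Complex.normSq_eq_norm_sq, ← Complex.ofReal_mul]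
        congr 1
        rcases (norm_nonneg (h x)).eq_or_lt with h1 | h1
        · rw [← h1, Real.zero_rpow hq0.ne']; simp
        · rw [← Real.rpow_natCast ‖h x‖ 2, ← Real.rpow_add h1]
          norm_num
      · rw [hv, Set.indicator_of_notMem hx, Set.indicator_of_notMem hx, mul_zero]
    have hvm : AEStronglyMeasurable v := by
      have h1 := hm.norm.aemeasurable.pow_const (q - 2)
      exact (((Complex.measurable_ofReal.comp_aemeasurable h1).aestronglyMeasurable).mul
        (Complex.continuous_conj.comp_aestronglyMeasurable hm)).indicator hSm
    have hvb : ∀ x, ‖v x‖ ≤ S.indicator (fun _ ↦ B ^ (q - 1)) x := fun x ↦ by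
      by_cases hx : x ∈ S
      · rw [hvn x hx, Set.indicator_of_mem hx]
        exact Real.rpow_le_rpow (norm_nonneg _) (hB x) (by linarith [hq.lt])
      · rw [hv, Set.indicator_of_notMem hx, Set.indicator_of_notMem hx, norm_zero]
    have hvL : ∀ a : ℝ≥0∞, MemLp v a := fun a ↦
      (memLp_indicator_const a hSm (B ^ (q - 1)) (Or.inr hSf)).mono' hvm (.of_forall hvb)
    have hvq : ∀ x, ‖v x‖ ^ q' = S.indicator (fun x ↦ ‖h x‖ ^ q) x := fun x ↦ by
      by_cases hx : x ∈ S
      · rw [hvn x hx, ← Real.rpow_mul (norm_nonneg _), hq.sub_one_mul_conj,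
          Set.indicator_of_mem hx]
      · rw [hv, Set.indicator_of_notMem hx, Set.indicator_of_notMem hx, norm_zero,
          Real.zero_rpow hq0'.ne']
    have hhi : IntegrableOn (fun x ↦ ‖h x‖ ^ q) S := by
      refine Measure.integrableOn_of_bounded (M := B ^ q) hSf
        (hm.norm.aemeasurable.pow_const q).aestronglyMeasurable (.of_forall fun x ↦ ?_)
      rw [Real.norm_of_nonneg (by positivity)]
      exact Real.rpow_le_rpow (norm_nonneg _) (hB x) hq0.le
    set X := ∫ x in S, ‖h x‖ ^ q with hX
    have hX0 : 0 ≤ X := integral_nonneg fun x ↦ by positivity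
    have e1 : ∫ x, ‖v x‖ ^ q' = X := by
      simp only [hvq]
      rw [integral_indicator hSm]
    have e2 : ∫ x, h x * v x = (X : ℂ) := by
      simp only [hvh]
      rw [integral_indicator hSm, integral_complex_ofReal]
    have est : ∀ ε : ℝ, 0 < ε → X ≤ A * (X + ε) ^ q'⁻¹ + B * ε := by
      intro ε hε
      obtain ⟨G, hG1, hG2⟩ := exists_bumpFamily_approx hq0' le_rfl (hvL _) (hvL _) hε
      rw [e1] at hG2
      rw [ENNReal.ofReal_one] at hG1
      have hd : Integrable (⇑(G.comb id) - v) :=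
        (G.comb id).integrable.sub (memLp_one_iff_integrable.1 (hvL 1))
      have hd1 : ∫ x, ‖(⇑(G.comb id) - v) x‖ ≤ ε := by
        rw [eLpNorm_one_eq_lintegral_enorm, ← ofReal_integral_norm_eq_lintegral_enorm hd] at hG1
        exact (ENNReal.ofReal_le_ofReal_iff hε.le).1 hG1
      have e3 : ∫ x, h x * v x = (∫ x, h x * G.comb id x) - ∫ x, h x * (⇑(G.comb id) - v) x := by
        rw [← integral_sub]
        · congr 1 with x
          simp only [Pi.sub_apply]
          ring
        · exact (G.comb id).integrable.bdd_mul hm (.of_forall hB)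
        · exact hd.bdd_mul hm (.of_forall hB)
      have h1 : X = ‖∫ x, h x * v x‖ := by
        rw [e2, Complex.norm_real, Real.norm_of_nonneg hX0]
      rw [h1, e3]
      refine (norm_sub_le _ _).trans (add_le_add ((H G).trans ?_) ?_)
      · rw [← e3, ← h1]
        have := G.mass_nonneg q'
        gcongr
      · refine (norm_integral_le_of_norm_le (hd.norm.const_mul B) (.of_forall fun x ↦ ?_)).trans ?_
        · rw [norm_mul]
          gcongr
          exact hB x
        · rw [integral_const_mul]
          gcongr
    have hl : Filter.Tendsto (fun ε : ℝ ↦ A * (X + ε) ^ q'⁻¹ + B * ε)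
        (nhdsWithin 0 (Set.Ioi 0)) (nhds (A * X ^ q'⁻¹)) := by
      have hc : Continuous fun ε : ℝ ↦ A * (X + ε) ^ q'⁻¹ + B * ε :=
        (continuous_const.mul ((continuous_const.add continuous_id).rpow_const
          fun _ ↦ Or.inr (by positivity))).add (continuous_const.mul continuous_id)
      have h := hc.tendsto 0
      simp only [add_zero, mul_zero] at h
      exact h.mono_left nhdsWithin_le_nhds
    have h2 : X ≤ A * X ^ q'⁻¹ := by
      refine ge_of_tendsto hl ?_
      filter_upwards [self_mem_nhdsWithin] with ε hε using est ε hε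
    have h3 : X ≤ A ^ q := by
      rcases hX0.eq_or_lt with h0 | hXpos
      · rw [← h0]; positivity
      · have h4 : X = X ^ q⁻¹ * X ^ q'⁻¹ := by
          rw [← Real.rpow_add hXpos, hq.inv_add_inv_eq_one, Real.rpow_one]
        rw [h4] at h2
        have h5 : X ^ q⁻¹ ≤ A := by
          refine le_of_mul_le_mul_right ?_ (Real.rpow_pos_of_pos hXpos q'⁻¹)
          rwa [← h4] at h2 ⊢
        calc X = (X ^ q⁻¹) ^ q := by
              rw [← Real.rpow_mul hX0, inv_mul_cancel₀ hq0.ne', Real.rpow_one]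
          _ ≤ _ := by gcongr
    have h5 : ∫⁻ x in S, ‖h x‖ₑ ^ q = ENNReal.ofReal X := by
      rw [hX, ofReal_integral_eq_lintegral_ofReal hhi (.of_forall fun x ↦ by positivity)]
      congr 1 with x
      rw [← ENNReal.ofReal_rpow_of_nonneg (norm_nonneg _) hq0.le, ofReal_norm]
    rw [h5]
    exact ENNReal.ofReal_le_ofReal h3
  have h1 := lintegral_rpow_le_of_forall_closedBall hm key
  rw [eLpNorm_eq_lintegral_rpow_enorm_toReal (by simpa using hq0) ENNReal.ofReal_ne_top,
    ENNReal.toReal_ofReal hq0.le]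
  calc _ ≤ (ENNReal.ofReal (A ^ q)) ^ (1 / q) := by gcongr
    _ = _ := by
      rw [ENNReal.ofReal_rpow_of_nonneg (by positivity) (by positivity), ← Real.rpow_mul hA,
        mul_one_div_cancel hq0.ne', Real.rpow_one]

end Bumps

/-! ### The bilinear form of the multiplier operator. -/

section MultiplierForm

variable {n : ℕ}

/-- The bilinear form of the multiplier operator with symbol `σ`. -/
noncomputable def symbolForm (σ : EuclideanSpace ℝ (Fin n) → ℂ)
    (f g : 𝓢(EuclideanSpace ℝ (Fin n), ℂ)) : ℂ :=
  ∫ ξ, σ ξ * (𝓕 f ξ * 𝓕⁻ g ξ)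

theorem integrable_symbol_mul {σ : EuclideanSpace ℝ (Fin n) → ℂ} (hσ : MemLp σ (⊤ : ℝ≥0∞))
    {K : EuclideanSpace ℝ (Fin n) → ℂ} (hK : Integrable K) : Integrable fun ξ ↦ σ ξ * K ξ :=
  hK.bdd_mul hσ.1 (ae_le_lpNormTop hσ)
where
  ae_le_lpNormTop {σ : EuclideanSpace ℝ (Fin n) → ℂ} (hσ : MemLp σ (⊤ : ℝ≥0∞)) :
      ∀ᵐ ξ, ‖σ ξ‖ ≤ (eLpNorm σ ⊤ volume).toReal := by
    have h := ae_le_eLpNormEssSup (f := σ) (μ := volume)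
    filter_upwards [h] with ξ hξ
    rw [← toReal_enorm]
    refine ENNReal.toReal_mono hσ.2.ne ?_
    rwa [eLpNorm_exponent_top]

theorem continuous_multiplierOp {σ : EuclideanSpace ℝ (Fin n) → ℂ} (hσ : MemLp σ (⊤ : ℝ≥0∞))
    (f : 𝓢(EuclideanSpace ℝ (Fin n), ℂ)) : Continuous (multiplierOp σ f) := by
  have hi := integrable_symbol_mul hσ (𝓕 f).integrable
  unfold multiplierOp
  refine continuous_of_dominated (bound := fun ξ ↦ ‖σ ξ * 𝓕 f ξ‖) (fun x ↦ ?_)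
    (fun x ↦ .of_forall fun ξ ↦ ?_) hi.norm (.of_forall fun ξ ↦ ?_)
  · refine AEStronglyMeasurable.mul ?_ (by fun_prop : Continuous fun ξ ↦
      cexp (2 * Real.pi * I * (inner ℝ x ξ : ℝ))).aestronglyMeasurable
    exact (𝓕 f).continuous.aestronglyMeasurable.mul hσ.1
  · rw [norm_mul, show (2 * Real.pi * I * (inner ℝ x ξ : ℝ) : ℂ)
      = ((2 * Real.pi * inner ℝ x ξ : ℝ) : ℂ) * I by push_cast; ring,
      Complex.norm_exp_ofReal_mul_I, mul_one, mul_comm]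
    rfl
  · fun_prop

theorem norm_multiplierOp_le (σ : EuclideanSpace ℝ (Fin n) → ℂ)
    (f : 𝓢(EuclideanSpace ℝ (Fin n), ℂ)) (x : EuclideanSpace ℝ (Fin n)) :
    ‖multiplierOp σ f x‖ ≤ ∫ ξ, ‖σ ξ * 𝓕 f ξ‖ := by
  refine (norm_integral_le_integral_norm _).trans (le_of_eq ?_)
  congr 1 with ξ
  rw [norm_mul, show (2 * Real.pi * I * (inner ℝ x ξ : ℝ) : ℂ)
    = ((2 * Real.pi * inner ℝ x ξ : ℝ) : ℂ) * I by push_cast; ring,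
    Complex.norm_exp_ofReal_mul_I, mul_one, mul_comm]
  rfl

theorem integral_multiplierOp_mul {σ : EuclideanSpace ℝ (Fin n) → ℂ} (hσ : MemLp σ (⊤ : ℝ≥0∞))
    (f g : 𝓢(EuclideanSpace ℝ (Fin n), ℂ)) :
    ∫ x, multiplierOp σ f x * g x = symbolForm σ f g := by
  have hi := integrable_symbol_mul hσ (𝓕 f).integrable
  have hint : Integrable (fun z : EuclideanSpace ℝ (Fin n) × EuclideanSpace ℝ (Fin n) ↦
      cexp ((2 * Real.pi * inner ℝ z.1 z.2 : ℝ) * I) * (g z.1 * (σ z.2 * 𝓕 f z.2)))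
      (volume.prod volume) := by
    refine Integrable.bdd_mul (c := 1) (g.integrable.mul_prod hi)
      (by fun_prop : Continuous fun z : EuclideanSpace ℝ (Fin n) × EuclideanSpace ℝ (Fin n) ↦
        cexp ((2 * Real.pi * inner ℝ z.1 z.2 : ℝ) * I)).aestronglyMeasurable (.of_forall fun z ↦ ?_)
    rw [Complex.norm_exp_ofReal_mul_I]
  calc _ = ∫ x, ∫ ξ, cexp ((2 * Real.pi * inner ℝ x ξ : ℝ) * I) * (g x * (σ ξ * 𝓕 f ξ)) := by
        congr 1 with x
        rw [multiplierOp, ← integral_mul_const]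
        congr 1 with ξ
        rw [show (2 * Real.pi * I * (inner ℝ x ξ : ℝ) : ℂ)
          = ((2 * Real.pi * inner ℝ x ξ : ℝ) : ℂ) * I by push_cast; ring]
        change 𝓕 f ξ * σ ξ * _ * g x = _
        ring
    _ = ∫ ξ, ∫ x, cexp ((2 * Real.pi * inner ℝ x ξ : ℝ) * I) * (g x * (σ ξ * 𝓕 f ξ)) :=
        integral_integral_swap hint
    _ = _ := by
        rw [symbolForm]
        congr 1 with ξ
        rw [SchwartzMap.fourierInv_coe, Real.fourierInv_eq', ← integral_const_mul,
          ← integral_const_mul]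
        congr 1 with x
        rw [smul_eq_mul]
        ring

/-- The assumed multiplier estimates enter the argument only through this lemma, by Hölder's
inequality. -/
theorem norm_symbolForm_le {Ψ : 𝓢(EuclideanSpace ℝ (Fin n), ℂ)} {p q q' r s : ℝ}
    (hq : q.HolderConjugate q') {K : ℝ≥0} (hK : MultiplierBound Ψ p q r s K)
    {σ : EuclideanSpace ℝ (Fin n) → ℂ} (hσ : MemLp σ (⊤ : ℝ≥0∞)) {H a b : ℝ}
    (hH0 : 0 ≤ H) (ha0 : 0 ≤ a) (hb0 : 0 ≤ b)
    (hH : hormanderENorm Ψ r s σ ≤ ENNReal.ofReal H) (f g : 𝓢(EuclideanSpace ℝ (Fin n), ℂ))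
    (hf : HasCompactSupport f) (ha : eLpNorm f (ENNReal.ofReal p) ≤ ENNReal.ofReal a)
    (hb : eLpNorm g (ENNReal.ofReal q') ≤ ENNReal.ofReal b) :
    ‖symbolForm σ f g‖ ≤ K * H * a * b := by
  have h1 := hK σ hσ (hH.trans_lt ENNReal.ofReal_lt_top) f f.smooth' hf
  rw [← integral_multiplierOp_mul hσ]
  have h2 := enorm_integral_mul_le_eLpNorm hq
    (continuous_multiplierOp hσ f).aestronglyMeasurable (μ := volume)
    g.continuous.aestronglyMeasurable
  rw [← ENNReal.ofReal_le_ofReal_iff (by positivity), ofReal_norm]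
  refine h2.trans ((mul_le_mul' h1 le_rfl).trans ?_)
  rw [ENNReal.ofReal_mul (by positivity), ENNReal.ofReal_mul (by positivity),
    ENNReal.ofReal_mul (by positivity), ENNReal.ofReal_coe_nnreal]
  gcongr

end MultiplierForm

/-! ### Entire functions bounded on the strip. -/

section Strip

/-- Entire functions which are bounded on the strip `0 ≤ Re z ≤ 1`. -/
def StripBounded (f : ℂ → ℂ) : Prop :=
  Differentiable ℂ f ∧ ∃ M : ℝ, ∀ z : ℂ, 0 ≤ z.re → z.re ≤ 1 → ‖f z‖ ≤ M

theorem StripBounded.mul {f g : ℂ → ℂ} (hf : StripBounded f) (hg : StripBounded g) :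
    StripBounded fun z ↦ f z * g z := by
  obtain ⟨M, hM⟩ := hf.2
  obtain ⟨M', hM'⟩ := hg.2
  refine ⟨hf.1.mul hg.1, M * M', fun z h0 h1 ↦ ?_⟩
  rw [norm_mul]
  exact mul_le_mul (hM z h0 h1) (hM' z h0 h1) (norm_nonneg _) ((norm_nonneg _).trans (hM z h0 h1))

theorem StripBounded.sum {ι : Type*} (s : Finset ι) {f : ι → ℂ → ℂ}
    (h : ∀ i ∈ s, StripBounded (f i)) : StripBounded fun z ↦ ∑ i ∈ s, f i z := by
  refine ⟨Differentiable.fun_sum fun i hi ↦ (h i hi).1, ?_⟩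
  have h2 : ∀ i ∈ s, ∃ M : ℝ, ∀ z : ℂ, 0 ≤ z.re → z.re ≤ 1 → ‖f i z‖ ≤ M := fun i hi ↦ (h i hi).2
  choose! M hM using h2
  exact ⟨∑ i ∈ s, M i, fun z h0 h1 ↦ (norm_sum_le _ _).trans
    (Finset.sum_le_sum fun i hi ↦ hM i hi z h0 h1)⟩

theorem stripBounded_const (c : ℂ) : StripBounded fun _ ↦ c :=
  ⟨differentiable_const c, ‖c‖, fun _ _ _ ↦ le_rfl⟩

theorem stripBounded_cexp_affine (a b t : ℝ) :
    StripBounded fun z ↦ cexp ((a + b * z) * t) := by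
  refine ⟨by fun_prop, Real.exp (|a * t| + |b * t|), fun z h0 h1 ↦ ?_⟩
  rw [Complex.norm_exp]
  refine Real.exp_le_exp.2 ?_
  rw [Complex.re_mul_ofReal]
  simp only [add_re, ofReal_re, re_ofReal_mul]
  have h2 : b * t * z.re ≤ |b * t| := by
    calc b * t * z.re ≤ |b * t| * z.re := by gcongr; exact le_abs_self _
      _ ≤ |b * t| := mul_le_of_le_one_right (abs_nonneg _) h1
  have := le_abs_self (a * t)
  nlinarith

theorem stripBounded_cexp_sq : StripBounded fun z ↦ cexp (z ^ 2) := by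
  refine ⟨by fun_prop, Real.exp 1, fun z h0 h1 ↦ ?_⟩
  rw [Complex.norm_exp]
  refine Real.exp_le_exp.2 ?_
  rw [sq, mul_re]
  nlinarith [sq_nonneg z.im]

variable {E : Type*} [NormedAddCommGroup E] [InnerProductSpace ℝ E] [FiniteDimensional ℝ E]
  [MeasurableSpace E] [BorelSpace E]

theorem integrable_helmPow_mul (z : ℂ) (w g : 𝓢(E, ℂ)) :
    Integrable fun ξ ↦ helmPow 1 z ξ * 𝓕 w ξ * 𝓕⁻ g ξ := by
  have h := integrable_fourier_mul (SchwartzMap.fourierMultiplierCLM ℂ (helmPow 1 z) w) g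
  simpa only [fourier_fourierMultiplierCLM_apply (hasTemperateGrowth_helmPow zero_le_one z)] using h

/-- Differentiation brings down a logarithm of the symbol, which is dominated by one more power of
it. For `z` near `z₀` everything is bounded by the fixed real power `‖z₀‖ + 2`, integrable against
Schwartz functions. -/
theorem differentiable_integral_helmPow (w g : 𝓢(E, ℂ)) :
    Differentiable ℂ fun z ↦ ∫ ξ, helmPow 1 z ξ * 𝓕 w ξ * 𝓕⁻ g ξ := by
  intro z₀
  have hL : ∀ ξ : E, 0 ≤ Real.log (helmholtz 1 ξ) := fun ξ ↦
    Real.log_nonneg (one_le_helmholtz zero_le_one ξ)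
  have hc : Continuous fun ξ : E ↦ Real.log (helmholtz 1 ξ) :=
    (hasTemperateGrowth_log_helmholtz zero_le_one).1.continuous
  refine (hasDerivAt_integral_of_dominated_loc_of_deriv_le (μ := (volume : Measure E))
    (s := Metric.ball z₀ 1) (x₀ := z₀)
    (F := fun z ξ ↦ helmPow 1 z ξ * 𝓕 w ξ * 𝓕⁻ g ξ)
    (F' := fun z ξ ↦ Real.log (helmholtz 1 ξ) * (helmPow 1 z ξ * 𝓕 w ξ * 𝓕⁻ g ξ))
    (bound := fun ξ ↦ ‖helmPow 1 ((‖z₀‖ + 2 : ℝ) : ℂ) ξ * 𝓕 w ξ * 𝓕⁻ g ξ‖)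
    (Metric.ball_mem_nhds z₀ one_pos) (.of_forall fun z ↦ (integrable_helmPow_mul z w g).1)
    (integrable_helmPow_mul z₀ w g) ?_ (.of_forall fun ξ z hz ↦ ?_)
    (integrable_helmPow_mul _ w g).norm (.of_forall fun ξ z hz ↦ ?_)).2.differentiableAt
  · exact (by fun_prop : Continuous fun ξ : E ↦
      (Real.log (helmholtz 1 ξ) : ℂ)).aestronglyMeasurable.mul (integrable_helmPow_mul z₀ w g).1
  · rw [mul_assoc, mul_assoc, norm_mul, norm_mul, norm_mul (helmPow 1 _ ξ), ← mul_assoc,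
      norm_helmPow, norm_helmPow, Complex.norm_real, Real.norm_of_nonneg (hL ξ)]
    refine mul_le_mul_of_nonneg_right ?_ (norm_nonneg _)
    have h1 : Real.log (helmholtz 1 ξ) ≤ Real.exp (1 * Real.log (helmholtz 1 ξ)) := by
      rw [one_mul]
      linarith [Real.add_one_le_exp (Real.log (helmholtz 1 ξ))]
    have h2 : z.re ≤ ‖z₀‖ + 1 := by
      have h3 : ‖z‖ ≤ ‖z₀‖ + 1 := by
        have h4 := norm_le_norm_add_norm_sub' z z₀
        rw [Metric.mem_ball, dist_eq_norm] at hz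
        linarith
      exact (Complex.re_le_norm z).trans h3
    calc _ ≤ Real.exp (1 * Real.log (helmholtz 1 ξ))
          * Real.exp ((‖z₀‖ + 1) * Real.log (helmholtz 1 ξ)) := by
          gcongr
          exact hL ξ
      _ = _ := by
          rw [← Real.exp_add, Complex.ofReal_re]
          ring_nf
  · have h1 : HasDerivAt (fun z : ℂ ↦ z * Real.log (helmholtz 1 ξ)) (Real.log (helmholtz 1 ξ)) z :=
      hasDerivAt_mul_const _
    have h2 := (h1.cexp.mul_const (𝓕 w ξ)).mul_const (𝓕⁻ g ξ)
    refine h2.congr_deriv ?_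
    rw [helmPow]
    ring

/-- On the strip the exponent has nonpositive real part and the symbol is at least `1`, so the power
has modulus at most `1`. -/
theorem stripBounded_integral_helmPow (w g : 𝓢(E, ℂ)) {a b : ℝ} (ha : 0 ≤ a) (hb : 0 ≤ b) :
    StripBounded fun z ↦ ∫ ξ, helmPow 1 (-(a * (1 - z) + b * z)) ξ * 𝓕 w ξ * 𝓕⁻ g ξ := by
  refine ⟨(differentiable_integral_helmPow w g).comp (by fun_prop),
    ∫ ξ, ‖𝓕 w ξ * 𝓕⁻ g ξ‖, fun z h0 h1 ↦ ?_⟩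
  refine norm_integral_le_of_norm_le (integrable_fourier_mul w g).norm (.of_forall fun ξ ↦ ?_)
  rw [mul_assoc, norm_mul]
  refine mul_le_of_le_one_left (norm_nonneg _) ?_
  rw [norm_helmPow, Real.exp_le_one_iff]
  refine mul_nonpos_of_nonpos_of_nonneg ?_
    (Real.log_nonneg (one_le_helmholtz zero_le_one ξ))
  simp only [neg_re, add_re, re_ofReal_mul, sub_re, one_re]
  have : 0 ≤ a * (1 - z.re) := mul_nonneg ha (by linarith)
  have : 0 ≤ b * z.re := mul_nonneg hb h0
  linarith

end Strip

/-! ### Analytic powers of the coefficients. -/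

section PowerCoefficients

/-- The phase-preserving power `c ↦ (c / |c|) |c|^e`. -/
noncomputable def phasePow (e c : ℂ) : ℂ := c / ‖c‖ * cexp (e * Real.log ‖c‖)

theorem norm_phasePow {c : ℂ} (hc : c ≠ 0) (e : ℂ) : ‖phasePow e c‖ = ‖c‖ ^ e.re := by
  have h : 0 < ‖c‖ := norm_pos_iff.2 hc
  rw [phasePow, norm_mul, norm_div, Complex.norm_real, norm_norm, div_self h.ne', one_mul,
    Complex.norm_exp, Complex.re_mul_ofReal, Real.rpow_def_of_pos h, mul_comm]

theorem phasePow_one {c : ℂ} (hc : c ≠ 0) : phasePow 1 c = c := by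
  have h : 0 < ‖c‖ := norm_pos_iff.2 hc
  rw [phasePow, one_mul, ← Complex.ofReal_exp, Real.exp_log h,
    div_mul_cancel₀ _ (Complex.ofReal_ne_zero.2 h.ne')]

theorem stripBounded_phasePow (c : ℂ) (a b : ℝ) : StripBounded fun z ↦ phasePow (a + b * z) c :=
  (stripBounded_const _).mul (stripBounded_cexp_affine a b _)

variable {E : Type*} [NormedAddCommGroup E] [InnerProductSpace ℝ E] [FiniteDimensional ℝ E]
  [MeasurableSpace E] [BorelSpace E]

theorem BumpFamily.comb_phasePow_one (F : BumpFamily E) : F.comb (phasePow 1) = F.comb id :=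
  Finset.sum_congr rfl fun c hc ↦ by rw [phasePow_one (F.ne_zero c hc), id]

/-- The moduli depend only on the real part of the exponent, so along a vertical line the bound is a
fixed power of one and the same mass. -/
theorem BumpFamily.eLpNorm_comb_phasePow_le (F : BumpFamily E) {e : ℂ} {a p : ℝ} (ha : 0 < a)
    (h : e.re * a = p) :
    eLpNorm (F.comb (phasePow e)) (ENNReal.ofReal a) ≤ ENNReal.ofReal (F.mass p ^ a⁻¹) := by
  refine (F.eLpNorm_comb_le (phasePow e) ha).trans (le_of_eq ?_)
  congr 2
  refine Finset.sum_congr rfl fun c hc ↦ ?_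
  rw [norm_phasePow (F.ne_zero c hc), ← Real.rpow_mul (norm_nonneg _), h]

end PowerCoefficients

/-! ### Expansion of the form over all bumps. -/

section Expansion

variable {n : ℕ}

theorem dyadicSum_comb_apply (Ψ : 𝓢(EuclideanSpace ℝ (Fin n), ℂ)) (J : Finset ℤ)
    (W : ℤ → BumpFamily (EuclideanSpace ℝ (Fin n))) (d : ℂ → ℂ)
    (m : EuclideanSpace ℝ (Fin n) → ℂ) (ξ : EuclideanSpace ℝ (Fin n)) :
    dyadicSum Ψ J (fun k ↦ SchwartzMap.fourierMultiplierCLM ℂ m ((W k).comb d)) ξ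
      = ∑ k ∈ J, ∑ c ∈ (W k).s, d c * (SchwartzMap.fourierMultiplierCLM ℂ m ((W k).χ c)
          ((2 : ℝ) ^ (-k) • ξ) * fatBump Ψ ((2 : ℝ) ^ (-k) • ξ)) := by
  refine Finset.sum_congr rfl fun k _ ↦ ?_
  have h : (W k).comb d = ∑ c ∈ (W k).s, d c • (W k).χ c := rfl
  beta_reduce
  rw [h, map_sum, sum_apply, Finset.sum_mul]
  refine Finset.sum_congr rfl fun c _ ↦ ?_
  have h' : SchwartzMap.fourierMultiplierCLM ℂ m (d c • (W k).χ c)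
      = d c • SchwartzMap.fourierMultiplierCLM ℂ m ((W k).χ c) := map_smul _ _ _
  rw [h', smul_apply, smul_eq_mul, mul_assoc]

theorem fourier_comb_apply (F : BumpFamily (EuclideanSpace ℝ (Fin n))) (d : ℂ → ℂ)
    (ξ : EuclideanSpace ℝ (Fin n)) :
    𝓕 (F.comb d) ξ = ∑ c ∈ F.s, d c * 𝓕 (F.χ c) ξ := by
  have h : 𝓕 (F.comb d) = ∑ c ∈ F.s, d c • 𝓕 (F.χ c) := by
    have := map_sum (FourierTransform.fourierCLE ℂ 𝓢(EuclideanSpace ℝ (Fin n), ℂ))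
      (fun c ↦ d c • F.χ c) F.s
    simp only [map_smul, FourierTransform.fourierCLE_apply] at this
    exact this
  rw [h, sum_apply]
  rfl

theorem fourierInv_comb_apply (F : BumpFamily (EuclideanSpace ℝ (Fin n))) (d : ℂ → ℂ)
    (ξ : EuclideanSpace ℝ (Fin n)) :
    𝓕⁻ (F.comb d) ξ = ∑ c ∈ F.s, d c * 𝓕⁻ (F.χ c) ξ := by
  have h : 𝓕⁻ (F.comb d) = ∑ c ∈ F.s, d c • 𝓕⁻ (F.χ c) := by
    have := map_sum (FourierTransform.fourierCLE ℂ 𝓢(EuclideanSpace ℝ (Fin n), ℂ)).symm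
      (fun c ↦ d c • F.χ c) F.s
    simp only [map_smul, FourierTransform.fourierCLE_symm_apply] at this
    exact this
  rw [h, sum_apply]
  rfl

/-- The Schwartz function `fatBump · (𝓕 f · 𝓕⁻ g)(2^k ·)`. -/
noncomputable def dyadicKernel (Ψ f g : 𝓢(EuclideanSpace ℝ (Fin n), ℂ)) (k : ℤ) :
    𝓢(EuclideanSpace ℝ (Fin n), ℂ) :=
  SchwartzMap.smulLeftCLM ℂ (⇑(fatBump Ψ)) (dilate (two_zpow_pos k).ne'
    (SchwartzMap.smulLeftCLM ℂ (⇑(𝓕 f : 𝓢(EuclideanSpace ℝ (Fin n), ℂ))) (𝓕⁻ g)))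

theorem dyadicKernel_apply (Ψ f g : 𝓢(EuclideanSpace ℝ (Fin n), ℂ)) (k : ℤ)
    (ξ : EuclideanSpace ℝ (Fin n)) : dyadicKernel Ψ f g k ξ
      = fatBump Ψ ξ * (𝓕 f ((2 : ℝ) ^ k • ξ) * 𝓕⁻ g ((2 : ℝ) ^ k • ξ)) := by
  rw [dyadicKernel, SchwartzMap.smulLeftCLM_apply_apply (SchwartzMap.hasTemperateGrowth _),
    dilate_apply, SchwartzMap.smulLeftCLM_apply_apply (SchwartzMap.hasTemperateGrowth _)]
  rfl

theorem integral_dilate_mul_fatBump (Ψ f g : 𝓢(EuclideanSpace ℝ (Fin n), ℂ)) (k : ℤ)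
    (u : EuclideanSpace ℝ (Fin n) → ℂ) :
    ∫ ξ, u ((2 : ℝ) ^ (-k) • ξ) * fatBump Ψ ((2 : ℝ) ^ (-k) • ξ) * (𝓕 f ξ * 𝓕⁻ g ξ)
      = ((((2 : ℝ) ^ (-k)) ^ n)⁻¹ : ℝ) * ∫ ξ, u ξ * dyadicKernel Ψ f g k ξ := by
  have h := Measure.integral_comp_smul_of_nonneg (volume : Measure (EuclideanSpace ℝ (Fin n)))
    (fun ξ ↦ u ξ * dyadicKernel Ψ f g k ξ) ((2 : ℝ) ^ (-k)) (hR := by positivity)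
  rw [Complex.real_smul, finrank_euclideanSpace, Fintype.card_fin] at h
  rw [← h]
  congr 1 with ξ
  rw [dyadicKernel_apply, smul_smul, ← zpow_add₀ two_ne_zero, add_neg_cancel, zpow_zero, one_smul]
  ring

/-- The bilinear form of a dyadic sum, expanded over all bumps. -/
theorem symbolForm_dyadicSum_comb (Ψ : 𝓢(EuclideanSpace ℝ (Fin n), ℂ)) (J : Finset ℤ)
    (W : ℤ → BumpFamily (EuclideanSpace ℝ (Fin n))) (F G : BumpFamily (EuclideanSpace ℝ (Fin n)))
    (d d₁ d₂ : ℂ → ℂ) (z : ℂ) :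
    symbolForm (dyadicSum Ψ J fun k ↦ SchwartzMap.fourierMultiplierCLM ℂ (helmPow 1 z)
      ((W k).comb d)) (F.comb d₁) (G.comb d₂)
      = ∑ k ∈ J, ∑ c ∈ (W k).s, ∑ a ∈ F.s, ∑ b ∈ G.s, d c * (d₁ a * d₂ b) *
        (((((2 : ℝ) ^ (-k)) ^ n)⁻¹ : ℝ) * ∫ ξ, helmPow 1 z ξ * 𝓕 ((W k).χ c) ξ
          * 𝓕⁻ (dyadicKernel Ψ (F.χ a) (G.χ b) k) ξ) := by
  have hz := hasTemperateGrowth_helmPow (E := EuclideanSpace ℝ (Fin n)) zero_le_one z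
  have hi : ∀ k c a b, Integrable fun ξ ↦
      SchwartzMap.fourierMultiplierCLM ℂ (helmPow 1 z) ((W k).χ c) ((2 : ℝ) ^ (-k) • ξ)
        * fatBump Ψ ((2 : ℝ) ^ (-k) • ξ) * (𝓕 (F.χ a) ξ * 𝓕⁻ (G.χ b) ξ) := by
    intro k c a b
    have h1 := memLp_top_dyadicSum Ψ {k} fun k ↦
      SchwartzMap.fourierMultiplierCLM ℂ (helmPow 1 z) ((W k).χ c)
    have h2 := integrable_symbol_mul h1 (integrable_fourier_mul (F.χ a) (G.χ b))
    simpa only [dyadicSum, Finset.sum_singleton] using h2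
  have e : ∀ ξ, dyadicSum Ψ J (fun k ↦ SchwartzMap.fourierMultiplierCLM ℂ (helmPow 1 z)
      ((W k).comb d)) ξ * (𝓕 (F.comb d₁) ξ * 𝓕⁻ (G.comb d₂) ξ)
      = ∑ k ∈ J, ∑ c ∈ (W k).s, ∑ a ∈ F.s, ∑ b ∈ G.s, d c * (d₁ a * d₂ b) *
        (SchwartzMap.fourierMultiplierCLM ℂ (helmPow 1 z) ((W k).χ c) ((2 : ℝ) ^ (-k) • ξ)
        * fatBump Ψ ((2 : ℝ) ^ (-k) • ξ) * (𝓕 (F.χ a) ξ * 𝓕⁻ (G.χ b) ξ)) := fun ξ ↦ by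
    rw [dyadicSum_comb_apply, fourier_comb_apply, fourierInv_comb_apply, Finset.sum_mul_sum,
      Finset.sum_mul]
    refine Finset.sum_congr rfl fun k _ ↦ ?_
    rw [Finset.sum_mul]
    refine Finset.sum_congr rfl fun c _ ↦ ?_
    rw [Finset.mul_sum]
    refine Finset.sum_congr rfl fun a _ ↦ ?_
    rw [Finset.mul_sum]
    refine Finset.sum_congr rfl fun b _ ↦ ?_
    ring
  rw [symbolForm]
  simp only [e]
  rw [integral_finsetSum _ fun k _ ↦ integrable_finsetSum _ fun c _ ↦ integrable_finsetSum _
    fun a _ ↦ integrable_finsetSum _ fun b _ ↦ (hi k c a b).const_mul _]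
  refine Finset.sum_congr rfl fun k _ ↦ ?_
  rw [integral_finsetSum _ fun c _ ↦ integrable_finsetSum _
    fun a _ ↦ integrable_finsetSum _ fun b _ ↦ (hi k c a b).const_mul _]
  refine Finset.sum_congr rfl fun c _ ↦ ?_
  rw [integral_finsetSum _ fun a _ ↦ integrable_finsetSum _ fun b _ ↦ (hi k c a b).const_mul _]
  refine Finset.sum_congr rfl fun a _ ↦ ?_
  rw [integral_finsetSum _ fun b _ ↦ (hi k c a b).const_mul _]
  refine Finset.sum_congr rfl fun b _ ↦ ?_
  rw [integral_const_mul, integral_dilate_mul_fatBump, integral_fourierMultiplierCLM_mul hz]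

end Expansion

/-! ### Complex interpolation. -/

section ThreeLines

variable {n : ℕ}

/-- The estimate for the bilinear form on a boundary line of the strip. -/
theorem exists_norm_symbolForm_boundary_le {Ψ : 𝓢(EuclideanSpace ℝ (Fin n), ℂ)}
    (hΨ : IsDyadicPartition Ψ) {r : ℝ} (hr : 1 < r) (s : ℝ) :
    ∃ C : ℝ, 0 ≤ C ∧ ∀ (p q q' : ℝ) (K : ℝ≥0), 0 < p → q.HolderConjugate q' →
      MultiplierBound Ψ p q r s K → ∀ (P Q R N τ : ℝ) (eP eQ eR : ℂ), eP.re * p = P →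
      eQ.re * q' = Q → eR.re * r = R → 0 ≤ N → ∀ (J : Finset ℤ)
      (W : ℤ → BumpFamily (EuclideanSpace ℝ (Fin n))), (∀ k ∈ J, (W k).mass R ≤ N ^ R) →
      ∀ F G : BumpFamily (EuclideanSpace ℝ (Fin n)),
      ‖symbolForm (dyadicSum Ψ J fun k ↦ SchwartzMap.fourierMultiplierCLM ℂ
          (helmPow 1 (-((s / 2 : ℝ) : ℂ) + τ * I)) ((W k).comb (phasePow eR)))
          (F.comb (phasePow eP)) (G.comb (phasePow eQ))‖
        ≤ K * (C * Real.exp (Real.pi * |τ|) * N ^ (R / r)) * F.mass P ^ p⁻¹ * G.mass Q ^ q'⁻¹ := by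
  obtain ⟨C, hC0, hC⟩ := exists_hormanderENorm_le hΨ (Real.HolderConjugate.conjExponent hr) s
  refine ⟨C, hC0, fun p q q' K hp hq hK P Q R N τ eP eQ eR hP hQ hR hN J W hW F G ↦ ?_⟩
  have hr0 : 0 < r := by linarith
  refine norm_symbolForm_le hq hK (memLp_top_dyadicSum Ψ J _) (by positivity)
    (Real.rpow_nonneg (F.mass_nonneg _) _) (Real.rpow_nonneg (G.mass_nonneg _) _)
    (hC τ (N ^ (R / r)) J _ (by positivity) fun k hk ↦ ?_) _ _ (F.hasCompactSupport_comb _)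
    (F.eLpNorm_comb_phasePow_le hp hP) (G.eLpNorm_comb_phasePow_le hq.symm.pos hQ)
  refine ENNReal.toReal_le_of_le_ofReal (by positivity)
    (((W k).eLpNorm_comb_phasePow_le hr0 hR).trans (ENNReal.ofReal_le_ofReal ?_))
  rw [div_eq_mul_inv, Real.rpow_mul hN]
  exact Real.rpow_le_rpow ((W k).mass_nonneg _) (hW k hk) (by positivity)

theorem Real.rpow_interp {x a b θ c : ℝ} (hx : 0 ≤ x) (ha : 0 ≤ a) (hb : 0 ≤ b) (h0 : 0 < θ)
    (h1 : θ < 1) (hc : c = (1 - θ) * a + θ * b) : (x ^ a) ^ (1 - θ) * (x ^ b) ^ θ = x ^ c := by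
  rw [← Real.rpow_mul hx, ← Real.rpow_mul hx, ← Real.rpow_add_of_nonneg hx
    (mul_nonneg ha (by linarith)) (mul_nonneg hb h0.le), hc]
  ring_nf

/-- The complex interpolation of the bilinear forms of dyadic sums. -/
theorem exists_norm_symbolForm_interp_le {Ψ : 𝓢(EuclideanSpace ℝ (Fin n), ℂ)}
    (hΨ : IsDyadicPartition Ψ) {r₀ r₁ : ℝ} (hr₀ : 1 < r₀) (hr₁ : 1 < r₁) (s₀ s₁ : ℝ) :
    ∃ C : ℝ, 0 ≤ C ∧ ∀ (p₀ p₁ q₀ q₁ q₀' q₁' : ℝ) (K₀ K₁ : ℝ≥0), 0 < p₀ → 0 < p₁ →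
      q₀.HolderConjugate q₀' → q₁.HolderConjugate q₁' →
      MultiplierBound Ψ p₀ q₀ r₀ s₀ K₀ → MultiplierBound Ψ p₁ q₁ r₁ s₁ K₁ →
      ∀ θ p q' r s : ℝ, 0 < θ → θ < 1 → 0 < p → 0 < q' → 0 < r →
      1 / p = (1 - θ) / p₀ + θ / p₁ → 1 / q' = (1 - θ) / q₀' + θ / q₁' →
      1 / r = (1 - θ) / r₀ + θ / r₁ → s = (1 - θ) * s₀ + θ * s₁ →
      0 ≤ s₀ → 0 ≤ s₁ → ∀ N : ℝ, 0 ≤ N → ∀ (J : Finset ℤ)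
      (W : ℤ → BumpFamily (EuclideanSpace ℝ (Fin n))), (∀ k ∈ J, (W k).mass r ≤ N ^ r) →
      ∀ F G : BumpFamily (EuclideanSpace ℝ (Fin n)),
      ‖symbolForm (dyadicSum Ψ J fun k ↦ SchwartzMap.fourierMultiplierCLM ℂ
          (helmPow 1 (-((s / 2 : ℝ) : ℂ))) ((W k).comb id)) (F.comb id) (G.comb id)‖
        ≤ C * (K₀ : ℝ) ^ (1 - θ) * (K₁ : ℝ) ^ θ * N * F.mass p ^ p⁻¹ * G.mass q' ^ q'⁻¹ := by
  obtain ⟨C₀, hC₀, H₀⟩ := exists_norm_symbolForm_boundary_le hΨ hr₀ s₀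
  obtain ⟨C₁, hC₁, H₁⟩ := exists_norm_symbolForm_boundary_le hΨ hr₁ s₁
  -- The rate of growth on the boundary lines: there the imaginary exponent is `τ = -(Im z) (s₁ -
  -- s₀) / 2`, at a cost of `e^{π|τ|} = e^{κ|Im z|}`.
  set κ : ℝ := Real.pi * |s₁ - s₀| / 2 with hκ
  set C : ℝ := max C₀ C₁
  have hC : 0 ≤ C := hC₀.trans (le_max_left _ _)
  -- On the boundary lines `|e^{z²}| ≤ e^{1 - (Im z)²}`, and `κ|y| - y² ≤ κ²/4`.
  set D : ℝ := Real.exp (1 + κ ^ 2 / 4) with hD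
  refine ⟨D * C, by positivity, fun p₀ p₁ q₀ q₁ q₀' q₁' K₀ K₁ hp₀ hp₁ hq₀ hq₁ hK₀ hK₁ θ p q' r s
    h0 h1 hp hq' hr hpe hqe hre hse hs₀ hs₁ N hN J W hW F G ↦ ?_⟩
  have hr₀' : 0 < r₀ := by linarith
  have hr₁' : 0 < r₁ := by linarith
  have hq₀' := hq₀.symm.pos
  have hq₁' := hq₁.symm.pos
  -- The affine function with value `a` at `0` and `b` at `1`. For the exponents used below its
  -- value at `θ` is `1`, which recovers the original functions.
  let lin : ℝ → ℝ → ℂ → ℂ := fun a b z ↦ (a : ℂ) + ((b - a : ℝ) : ℂ) * z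
  have lin_re : ∀ a b (z : ℂ), (lin a b z).re = a + (b - a) * z.re := fun a b z ↦ by
    simp only [lin, add_re, ofReal_re, re_ofReal_mul]
  have lin_θ : ∀ u u₀ u₁ : ℝ, 0 < u → 1 / u = (1 - θ) / u₀ + θ / u₁ →
      lin (u / u₀) (u / u₁) θ = 1 := fun u u₀ u₁ hu h ↦ by
    simp only [lin]
    rw [← ofReal_mul, ← ofReal_add, ← ofReal_one]
    congr 1
    have h2 : u * (1 / u) = 1 := by field_simp
    rw [h] at h2
    rw [← h2]
    ring
  let Φ : ℂ → ℂ := fun z ↦ cexp (z ^ 2) * symbolForm (dyadicSum Ψ J fun k ↦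
    SchwartzMap.fourierMultiplierCLM ℂ
      (helmPow 1 (-(((s₀ / 2 : ℝ) : ℂ) * (1 - z) + ((s₁ / 2 : ℝ) : ℂ) * z)))
      ((W k).comb (phasePow (lin (r / r₀) (r / r₁) z))))
    (F.comb (phasePow (lin (p / p₀) (p / p₁) z))) (G.comb (phasePow (lin (q' / q₀') (q' / q₁') z)))
  have hΦ : StripBounded Φ := by
    refine stripBounded_cexp_sq.mul ?_
    -- After the expansion, `z` enters only through finitely many phase powers and integrals of
    -- `helmPow`, all entire and bounded on the strip.
    simp only [symbolForm_dyadicSum_comb]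
    refine .sum _ fun k _ ↦ .sum _ fun c _ ↦ .sum _ fun a _ ↦ .sum _ fun b _ ↦ ?_
    refine .mul (.mul (stripBounded_phasePow _ _ _) (.mul (stripBounded_phasePow _ _ _)
      (stripBounded_phasePow _ _ _))) (.mul (stripBounded_const _)
      (stripBounded_integral_helmPow _ _ (by positivity) (by positivity)))
  have hexp : ∀ (z : ℂ), z.re ^ 2 ≤ 1 → ‖cexp (z ^ 2)‖ *
      Real.exp (Real.pi * |-(z.im * (s₁ - s₀) / 2)|) ≤ D := fun z hz ↦ by
    rw [Complex.norm_exp, ← Real.exp_add, hD]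
    refine Real.exp_le_exp.2 ?_
    have h2 : Real.pi * |-(z.im * (s₁ - s₀) / 2)| = κ * |z.im| := by
      rw [abs_neg, abs_div, abs_mul, abs_two, hκ]
      ring
    rw [h2, sq z, mul_re]
    nlinarith [sq_nonneg (|z.im| - κ / 2), sq_abs z.im]
  have hexpo : ∀ (z : ℂ) (u : ℝ), z.re = 0 ∧ u = s₀ ∨ z.re = 1 ∧ u = s₁ →
      -(((s₀ / 2 : ℝ) : ℂ) * (1 - z) + ((s₁ / 2 : ℝ) : ℂ) * z)
        = -((u / 2 : ℝ) : ℂ) + ((-(z.im * (s₁ - s₀) / 2) : ℝ) : ℂ) * I := by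
    intro z u h
    rcases h with ⟨h, rfl⟩ | ⟨h, rfl⟩ <;> apply Complex.ext <;> simp [h] <;> ring
  have hbd : ∀ (z : ℂ) (c k m x : ℝ), z.re ^ 2 ≤ 1 → 0 ≤ c → c ≤ C → 0 ≤ k → 0 ≤ m → 0 ≤ x →
      ‖cexp (z ^ 2)‖ * (k * (c * Real.exp (Real.pi * |-(z.im * (s₁ - s₀) / 2)|) * m) * x)
        ≤ (D * C) * k * m * x := by
    intro z c k m x hz hc hcC hk hm hx
    calc _ = (‖cexp (z ^ 2)‖ * Real.exp (Real.pi * |-(z.im * (s₁ - s₀) / 2)|)) * c * k * m * x := by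
          ring
      _ ≤ D * C * k * m * x := by
          gcongr
          exact hexp z hz
  have mF := F.mass_nonneg p
  have mG := G.mass_nonneg q'
  have key := Complex.HadamardThreeLines.norm_le_interp_of_mem_verticalClosedStrip₀₁' Φ
    (z := (θ : ℂ))
    (a := (D * C) * K₀ * N ^ (r / r₀) * (F.mass p ^ p₀⁻¹ * G.mass q' ^ q₀'⁻¹))
    (b := (D * C) * K₁ * N ^ (r / r₁) * (F.mass p ^ p₁⁻¹ * G.mass q' ^ q₁'⁻¹))
    ⟨h0.le, h1.le⟩ hΦ.1.diffContOnCl ?_ ?_ ?_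
  · have e : ‖symbolForm (dyadicSum Ψ J fun k ↦ SchwartzMap.fourierMultiplierCLM ℂ
          (helmPow 1 (-((s / 2 : ℝ) : ℂ))) ((W k).comb id)) (F.comb id) (G.comb id)‖ ≤ ‖Φ θ‖ := by
      have e1 : -(((s₀ / 2 : ℝ) : ℂ) * (1 - θ) + ((s₁ / 2 : ℝ) : ℂ) * θ)
          = -((s / 2 : ℝ) : ℂ) := by
        rw [hse]
        push_cast
        ring
      simp only [Φ]
      rw [lin_θ r r₀ r₁ hr hre, lin_θ p p₀ p₁ hp hpe, lin_θ q' q₀' q₁' hq' hqe, e1]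
      simp only [BumpFamily.comb_phasePow_one]
      rw [norm_mul]
      -- The damping factor `e^{z²}` is at least `1` at the real point `θ` and can be dropped.
      refine le_mul_of_one_le_left (norm_nonneg _) ?_
      rw [← ofReal_pow, Complex.norm_exp, ofReal_re]
      exact Real.one_le_exp (by positivity)
    refine (e.trans key).trans (le_of_eq ?_)
    rw [ofReal_re]
    have h1' : 0 ≤ 1 - θ := by linarith
    have hA : 0 ≤ D * C := by positivity
    generalize D * C = A at hA ⊢
    rw [Real.mul_rpow, Real.mul_rpow, Real.mul_rpow, Real.mul_rpow, Real.mul_rpow, Real.mul_rpow,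
      Real.mul_rpow, Real.mul_rpow] <;> try positivity
    have iD : A ^ (1 - θ) * A ^ θ = A := by
      rw [← Real.rpow_add_of_nonneg hA h1' h0.le, sub_add_cancel, Real.rpow_one]
    have iN := Real.rpow_interp (c := 1) hN (a := r / r₀) (b := r / r₁) (by positivity)
      (by positivity) h0 h1 (by
        have h2 : r * (1 / r) = 1 := by field_simp
        rw [hre] at h2
        linear_combination -h2)
    have iF := Real.rpow_interp (c := p⁻¹) mF (a := p₀⁻¹) (b := p₁⁻¹) (by positivity)
      (by positivity) h0 h1 (by rw [← one_div, hpe]; ring)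
    have iG := Real.rpow_interp (c := q'⁻¹) mG (a := q₀'⁻¹) (b := q₁'⁻¹) (by positivity)
      (by positivity) h0 h1 (by rw [← one_div, hqe]; ring)
    rw [Real.rpow_one] at iN
    calc _ = (A ^ (1 - θ) * A ^ θ) * (K₀ : ℝ) ^ (1 - θ) * (K₁ : ℝ) ^ θ
          * ((N ^ (r / r₀)) ^ (1 - θ) * (N ^ (r / r₁)) ^ θ)
          * ((F.mass p ^ p₀⁻¹) ^ (1 - θ) * (F.mass p ^ p₁⁻¹) ^ θ)
          * ((G.mass q' ^ q₀'⁻¹) ^ (1 - θ) * (G.mass q' ^ q₁'⁻¹) ^ θ) := by ring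
      _ = _ := by
          rw [iD, iN, iF, iG]
  · obtain ⟨M, hM⟩ := hΦ.2
    refine ⟨M, ?_⟩
    rintro _ ⟨z, hz, rfl⟩
    exact hM z hz.1 hz.2
  · intro z hz
    have hz0 : z.re = 0 := hz
    simp only [Φ]
    rw [hexpo z s₀ (.inl ⟨hz0, rfl⟩), norm_mul]
    refine (mul_le_mul_of_nonneg_left (H₀ p₀ q₀ q₀' K₀ hp₀ hq₀ hK₀ p q' r N _ _ _ _ ?_ ?_ ?_
      hN J W hW F G) (norm_nonneg _)).trans ?_
    · rw [lin_re, hz0]; field_simp; ring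
    · rw [lin_re, hz0]; field_simp; ring
    · rw [lin_re, hz0]; field_simp; ring
    rw [mul_assoc (_ * _)]
    exact hbd z C₀ K₀ _ _ (by rw [hz0]; norm_num) hC₀ (le_max_left _ _) K₀.2 (by positivity)
      (by positivity)
  · intro z hz
    have hz1 : z.re = 1 := hz
    simp only [Φ]
    rw [hexpo z s₁ (.inr ⟨hz1, rfl⟩), norm_mul]
    refine (mul_le_mul_of_nonneg_left (H₁ p₁ q₁ q₁' K₁ hp₁ hq₁ hK₁ p q' r N _ _ _ _ ?_ ?_ ?_
      hN J W hW F G) (norm_nonneg _)).trans ?_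
    · rw [lin_re, hz1]; field_simp; ring
    · rw [lin_re, hz1]; field_simp; ring
    · rw [lin_re, hz1]; field_simp; ring
    rw [mul_assoc (_ * _)]
    exact hbd z C₁ K₁ _ _ (by rw [hz1]; norm_num) hC₁ (le_max_right _ _) K₁.2 (by positivity)
      (by positivity)

end ThreeLines

/-! ### The localized pieces of a given symbol. -/

section Pieces

variable {n : ℕ}

/-- The operator `(I - Δ)^{-s/2}` moved to the other side of the pairing `∫ f g`. -/
noncomputable def besselPotential (s : ℝ) (G : 𝓢(EuclideanSpace ℝ (Fin n), ℂ)) :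
    𝓢(EuclideanSpace ℝ (Fin n), ℂ) :=
  𝓕 (SchwartzMap.smulLeftCLM ℂ (helmPow 1 (-((s / 2 : ℝ) : ℂ))) (𝓕⁻ G))

theorem fourier_smulLeftCLM_besselPotential (s : ℝ) (G : 𝓢(EuclideanSpace ℝ (Fin n), ℂ)) :
    𝓕 (SchwartzMap.smulLeftCLM ℂ (besselSymbol n s) (𝓕⁻ (besselPotential s G))) = G := by
  rw [besselPotential, FourierTransform.fourierInv_fourier_eq, besselSymbol_eq_helmPow]
  refine Eq.trans ?_ (FourierTransform.fourier_fourierInv_eq (F := 𝓢(EuclideanSpace ℝ (Fin n), ℂ)) G)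
  congr 1
  ext ξ
  rw [SchwartzMap.smulLeftCLM_apply_apply (hasTemperateGrowth_helmPow zero_le_one _),
    SchwartzMap.smulLeftCLM_apply_apply (hasTemperateGrowth_helmPow zero_le_one _), smul_eq_mul,
    smul_eq_mul, ← mul_assoc, ← helmPow_add, add_neg_cancel, helmPow, zero_mul, Complex.exp_zero,
    one_mul]

/-- The strict inequality provides an actual `g` representing `(I - Δ)^{s/2} h`. Testing this
distribution on `besselPotential s G` makes the two powers cancel. -/
theorem exists_integral_besselPotential_of_sobolevENorm_lt {r s N : ℝ}
    {h : EuclideanSpace ℝ (Fin n) → ℂ} (hN : sobolevENorm r s h < ENNReal.ofReal N) :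
    ∃ g : EuclideanSpace ℝ (Fin n) → ℂ, MemLp g (ENNReal.ofReal r) ∧
      eLpNorm g (ENNReal.ofReal r) < ENNReal.ofReal N ∧
      ∀ G : 𝓢(EuclideanSpace ℝ (Fin n), ℂ),
        ∫ ξ, h ξ * G ξ = ∫ ξ, g ξ * besselPotential s G ξ := by
  unfold sobolevENorm at hN
  simp only [iInf_lt_iff] at hN
  obtain ⟨T, g, hT, hg, hTg, hlt⟩ := hN
  refine ⟨g, hg, hlt, fun G ↦ ?_⟩
  have h1 := (hT G).2
  have h2 := (hTg (besselPotential s G)).2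
  rw [besselOp, TemperedDistribution.fourierMultiplierCLM_apply_apply,
    fourier_smulLeftCLM_besselPotential, h1] at h2
  simpa only [mul_comm] using h2

theorem symbolForm_dyadicSum (Ψ : 𝓢(EuclideanSpace ℝ (Fin n), ℂ)) (J : Finset ℤ)
    (w : ℤ → 𝓢(EuclideanSpace ℝ (Fin n), ℂ)) (f g : 𝓢(EuclideanSpace ℝ (Fin n), ℂ)) (s : ℝ) :
    symbolForm (dyadicSum Ψ J fun k ↦ SchwartzMap.fourierMultiplierCLM ℂ
      (helmPow 1 (-((s / 2 : ℝ) : ℂ))) (w k)) f g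
      = ∑ k ∈ J, ((((2 : ℝ) ^ (-k)) ^ n)⁻¹ : ℝ) *
        ∫ ξ, w k ξ * besselPotential s (dyadicKernel Ψ f g k) ξ := by
  have hi : ∀ k, Integrable fun ξ ↦ SchwartzMap.fourierMultiplierCLM ℂ
      (helmPow 1 (-((s / 2 : ℝ) : ℂ))) (w k) ((2 : ℝ) ^ (-k) • ξ)
        * fatBump Ψ ((2 : ℝ) ^ (-k) • ξ) * (𝓕 f ξ * 𝓕⁻ g ξ) := by
    intro k
    have h2 := integrable_symbol_mul (memLp_top_dyadicSum Ψ {k} fun k ↦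
      SchwartzMap.fourierMultiplierCLM ℂ (helmPow 1 (-((s / 2 : ℝ) : ℂ))) (w k))
      (integrable_fourier_mul f g)
    simpa only [dyadicSum, Finset.sum_singleton] using h2
  simp only [symbolForm, dyadicSum, Finset.sum_mul]
  rw [integral_finsetSum _ fun k _ ↦ hi k]
  refine Finset.sum_congr rfl fun k _ ↦ ?_
  rw [integral_dilate_mul_fatBump,
    integral_fourierMultiplierCLM_mul' (hasTemperateGrowth_helmPow zero_le_one _)]
  rfl

/-- Inserting `fatBump` changes nothing, since it is `1` wherever `𝓕 Ψ` is nonzero. This gives the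
pieces of `σ` the same form as those of `symbolForm_dyadicSum`. -/
theorem integral_sum_mul {Ψ : 𝓢(EuclideanSpace ℝ (Fin n), ℂ)} (hΨ : IsDyadicPartition Ψ)
    {σ : EuclideanSpace ℝ (Fin n) → ℂ} (hσ : MemLp σ (⊤ : ℝ≥0∞)) (J : Finset ℤ)
    (f g : 𝓢(EuclideanSpace ℝ (Fin n), ℂ)) :
    ∫ ξ, (∑ k ∈ J, 𝓕 Ψ ((2 : ℝ) ^ (-k) • ξ)) * (σ ξ * (𝓕 f ξ * 𝓕⁻ g ξ))
      = ∑ k ∈ J, ((((2 : ℝ) ^ (-k)) ^ n)⁻¹ : ℝ) *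
        ∫ ξ, σ ((2 : ℝ) ^ k • ξ) * 𝓕 Ψ ξ * dyadicKernel Ψ f g k ξ := by
  have hi : ∀ k : ℤ, Integrable fun ξ ↦
      𝓕 Ψ ((2 : ℝ) ^ (-k) • ξ) * (σ ξ * (𝓕 f ξ * 𝓕⁻ g ξ)) := fun k ↦
    (integrable_symbol_mul hσ (integrable_fourier_mul f g)).bdd_mul
      ((𝓕 Ψ).continuous.comp (continuous_const_smul _)).aestronglyMeasurable
      (.of_forall fun ξ ↦ (𝓕 Ψ).norm_le_seminorm ℝ _)
  simp only [Finset.sum_mul]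
  rw [integral_finsetSum _ fun k _ ↦ hi k]
  refine Finset.sum_congr rfl fun k _ ↦ ?_
  rw [← integral_dilate_mul_fatBump Ψ f g k fun ξ ↦ σ ((2 : ℝ) ^ k • ξ) * 𝓕 Ψ ξ]
  congr 1 with ξ
  rw [smul_smul, ← zpow_add₀ two_ne_zero, add_neg_cancel, zpow_zero, one_smul]
  by_cases h : 𝓕 Ψ ((2 : ℝ) ^ (-k) • ξ) = 0
  · rw [h]
    ring
  · rw [hΨ.fatBump_eq_one h]
    ring

theorem norm_integral_mul_sub_le {r r' ε : ℝ} (hr : r.HolderConjugate r')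
    {v : EuclideanSpace ℝ (Fin n) → ℂ} (hv : MemLp v (ENNReal.ofReal r))
    (w b : 𝓢(EuclideanSpace ℝ (Fin n), ℂ)) (hε : 0 ≤ ε)
    (h : eLpNorm (⇑w - v) (ENNReal.ofReal r) ≤ ENNReal.ofReal ε) :
    ‖(∫ ξ, v ξ * b ξ) - ∫ ξ, w ξ * b ξ‖ ≤ ε * lpNormReal r' b := by
  have hb : MemLp b (ENNReal.ofReal r') := b.memLp _ _
  have hw : MemLp w (ENNReal.ofReal r) := w.memLp _ _
  have := hr.ennrealOfReal
  have i1 : Integrable fun ξ ↦ v ξ * b ξ := hv.integrable_mul hb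
  have i2 : Integrable fun ξ ↦ w ξ * b ξ := hw.integrable_mul hb
  rw [norm_sub_rev, ← integral_sub i2 i1]
  have h4 := norm_integral_mul_le_lpNormReal hr (hw.sub hv) hb
  simp only [Pi.sub_apply, sub_mul] at h4
  exact h4.trans (mul_le_mul_of_nonneg_right (ENNReal.toReal_le_of_le_ofReal hε h)
    (lpNormReal_nonneg _ _))

/-- The strict bound on `∫ ‖v k‖ ^ r` leaves room for approximating bump families of mass at most
`M`. Their errors are paired with finitely many fixed functions `b k`, hence are arbitrarily small.
-/
theorem norm_sum_integral_mul_le_of_forall_bumpFamily {r M B : ℝ} (hr : 1 < r) (J : Finset ℤ)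
    {c : ℤ → ℝ} (hc : ∀ k, 0 ≤ c k) {v : ℤ → EuclideanSpace ℝ (Fin n) → ℂ}
    (hv : ∀ k, MemLp (v k) (ENNReal.ofReal r)) (hvM : ∀ k, ∫ x, ‖v k x‖ ^ r < M)
    (b : ℤ → 𝓢(EuclideanSpace ℝ (Fin n), ℂ))
    (H : ∀ W : ℤ → BumpFamily (EuclideanSpace ℝ (Fin n)), (∀ k ∈ J, (W k).mass r ≤ M) →
      ‖∑ k ∈ J, (c k : ℂ) * ∫ ξ, (W k).comb id ξ * b k ξ‖ ≤ B) :
    ‖∑ k ∈ J, (c k : ℂ) * ∫ ξ, v k ξ * b k ξ‖ ≤ B := by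
  have hr0 : 0 < r := by linarith
  have hrr := Real.HolderConjugate.conjExponent hr
  have hU0 : ∀ k, 0 ≤ c k * lpNormReal r.conjExponent (b k) := fun k ↦
    mul_nonneg (hc k) (lpNormReal_nonneg _ _)
  have hUs := Finset.sum_nonneg fun k (_ : k ∈ J) ↦ hU0 k
  refine le_of_forall_pos_le_add fun δ hδ ↦ ?_
  obtain ⟨ε, hε0, hε⟩ : ∃ ε : ℝ, 0 < ε ∧
      ε * ∑ k ∈ J, c k * lpNormReal r.conjExponent (b k) ≤ δ := by
    refine ⟨δ / (∑ k ∈ J, c k * lpNormReal r.conjExponent (b k) + 1), by positivity, ?_⟩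
    rw [div_mul_eq_mul_div, div_le_iff₀ (by positivity)]
    exact mul_le_mul_of_nonneg_left (by linarith) hδ.le
  have hεk : ∀ k, 0 < min ε (M - ∫ x, ‖v k x‖ ^ r) := fun k ↦ lt_min hε0 (sub_pos.2 (hvM k))
  choose W hW hWm using fun k ↦ exists_bumpFamily_approx hr0 hr.le (hv k) (hv k) (hεk k)
  have h2 := H W fun k _ ↦ (hWm k).trans (by
    have := min_le_right ε (M - ∫ x, ‖v k x‖ ^ r)
    linarith)
  refine (norm_le_norm_add_norm_sub' _ _).trans (add_le_add h2 ?_)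
  rw [← Finset.sum_sub_distrib]
  refine (norm_sum_le_of_le J fun k _ ↦ ?_).trans (((Finset.mul_sum J _ ε).symm).le.trans hε)
  rw [← mul_sub, norm_mul, Complex.norm_real, Real.norm_of_nonneg (hc k), mul_left_comm ε]
  exact mul_le_mul_of_nonneg_left (norm_integral_mul_sub_le hrr (hv k) _ _ hε0.le
    ((hW k).trans (ENNReal.ofReal_le_ofReal (min_le_left _ _)))) (hc k)

theorem sobolevENorm_le_hormanderENorm (Ψ : 𝓢(EuclideanSpace ℝ (Fin n), ℂ)) (r s : ℝ)
    (σ : EuclideanSpace ℝ (Fin n) → ℂ) (k : ℤ) :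
    sobolevENorm r s (fun ξ ↦ σ ((2 : ℝ) ^ k • ξ) * (𝓕 Ψ) ξ) ≤ hormanderENorm Ψ r s σ := by
  refine le_iSup_of_le k ?_
  exact le_refl _

theorem norm_integral_sum_mul_le {Ψ : 𝓢(EuclideanSpace ℝ (Fin n), ℂ)} (hΨ : IsDyadicPartition Ψ)
    {r s N B : ℝ} (hr : 1 < r) {σ : EuclideanSpace ℝ (Fin n) → ℂ} (hσ : MemLp σ (⊤ : ℝ≥0∞))
    (hN : hormanderENorm Ψ r s σ < ENNReal.ofReal N) (J : Finset ℤ)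
    (f g : 𝓢(EuclideanSpace ℝ (Fin n), ℂ))
    (H : ∀ W : ℤ → BumpFamily (EuclideanSpace ℝ (Fin n)), (∀ k ∈ J, (W k).mass r ≤ N ^ r) →
      ‖symbolForm (dyadicSum Ψ J fun k ↦ SchwartzMap.fourierMultiplierCLM ℂ
        (helmPow 1 (-((s / 2 : ℝ) : ℂ))) ((W k).comb id)) f g‖ ≤ B) :
    ‖∫ ξ, (∑ k ∈ J, 𝓕 Ψ ((2 : ℝ) ^ (-k) • ξ)) * (σ ξ * (𝓕 f ξ * 𝓕⁻ g ξ))‖ ≤ B := by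
  have hr0 : 0 < r := by linarith
  have hN0 : 0 < N := by
    rw [← ENNReal.ofReal_pos]
    exact bot_le.trans_lt hN
  have h1 : ∀ k : ℤ, sobolevENorm r s (fun ξ ↦ σ ((2 : ℝ) ^ k • ξ) * (𝓕 Ψ) ξ)
      < ENNReal.ofReal N := fun k ↦
    (sobolevENorm_le_hormanderENorm Ψ r s σ k).trans_lt hN
  choose v hv hvN hvI using fun k ↦ exists_integral_besselPotential_of_sobolevENorm_lt (h1 k)
  have hvr : ∀ k, ∫ x, ‖v k x‖ ^ r < N ^ r := fun k ↦ by
    have h2 := hvN k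
    rw [(hv k).eLpNorm_eq_integral_rpow_norm (by simpa using hr0) ENNReal.ofReal_ne_top,
      ENNReal.toReal_ofReal hr0.le, ENNReal.ofReal_lt_ofReal_iff hN0] at h2
    have h3 := Real.rpow_lt_rpow (by positivity) h2 hr0
    rwa [← Real.rpow_mul (by positivity), inv_mul_cancel₀ hr0.ne', Real.rpow_one] at h3
  rw [integral_sum_mul hΨ hσ]
  simp only [hvI]
  refine norm_sum_integral_mul_le_of_forall_bumpFamily hr J (fun k ↦ by positivity) hv hvr _
    fun W hW ↦ ?_
  rw [← symbolForm_dyadicSum]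
  exact H W hW

end Pieces

/-! ### Removing the approximations. -/

section Limits

variable {n : ℕ}

/-- Two scales active at the same point differ by at most `2`, so at most five are active. -/
theorem IsDyadicPartition.exists_norm_sum_le {Ψ : 𝓢(EuclideanSpace ℝ (Fin n), ℂ)}
    (hΨ : IsDyadicPartition Ψ) : ∃ M : ℝ, ∀ (J : Finset ℤ) (ξ : EuclideanSpace ℝ (Fin n)),
      ‖∑ k ∈ J, 𝓕 Ψ ((2 : ℝ) ^ (-k) • ξ)‖ ≤ M := by
  obtain ⟨M, hM⟩ : ∃ M, ∀ ξ, ‖𝓕 Ψ ξ‖ ≤ M := ⟨_, (𝓕 Ψ).norm_le_seminorm ℝ⟩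
  have hM0 : 0 ≤ M := (norm_nonneg _).trans (hM 0)
  refine ⟨5 * M, fun J ξ ↦ ?_⟩
  rw [← Finset.sum_filter_ne_zero]
  set S := J.filter fun k ↦ 𝓕 Ψ ((2 : ℝ) ^ (-k) • ξ) ≠ 0 with hS
  have key : ∀ k ∈ S, ∀ k' ∈ S, k' - k ≤ 2 := by
    intro k hk k' hk'
    have h1 := (hΨ.support_zpow (Finset.mem_filter.1 hk).2).2
    have h2 := (hΨ.support_zpow (Finset.mem_filter.1 hk').2).1
    refine zpow_le_of_mul_le (x := 2 ^ (-k') * ‖ξ‖) (y := 2) (by linarith) ?_ ?_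
    · rw [← mul_assoc, ← zpow_add₀ two_ne_zero, show k' - k + -k' = -k by ring]
      exact h1
    · norm_num at h2 ⊢
      linarith
  have hcard : S.card ≤ 5 := by
    rcases S.eq_empty_or_nonempty with h | ⟨k₀, hk₀⟩
    · simp [h]
    · refine (Finset.card_le_card (t := Finset.Icc (k₀ - 2) (k₀ + 2)) fun k hk ↦ ?_).trans ?_
      · have := key k hk k₀ hk₀
        have := key k₀ hk₀ k hk
        rw [Finset.mem_Icc]
        omega
      · rw [Int.card_Icc]
        omega
  calc _ ≤ ∑ k ∈ S, M := norm_sum_le_of_le _ fun k _ ↦ hM _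
    _ ≤ 5 * M := by
        rw [Finset.sum_const, nsmul_eq_mul]
        gcongr
        exact_mod_cast hcard

/-- The partial sums of the partition of unity are uniformly bounded and tend to `1` off the origin,
a null set because `n ≥ 1`; dominated convergence applies. -/
theorem norm_symbolForm_le_of_forall_sum (hn : 1 ≤ n) {Ψ : 𝓢(EuclideanSpace ℝ (Fin n), ℂ)}
    (hΨ : IsDyadicPartition Ψ) {σ : EuclideanSpace ℝ (Fin n) → ℂ} (hσ : MemLp σ (⊤ : ℝ≥0∞))
    (f g : 𝓢(EuclideanSpace ℝ (Fin n), ℂ)) {B : ℝ}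
    (H : ∀ J : Finset ℤ,
      ‖∫ ξ, (∑ k ∈ J, 𝓕 Ψ ((2 : ℝ) ^ (-k) • ξ)) * (σ ξ * (𝓕 f ξ * 𝓕⁻ g ξ))‖ ≤ B) :
    ‖symbolForm σ f g‖ ≤ B := by
  obtain ⟨M, hM⟩ := hΨ.exists_norm_sum_le
  have hi := integrable_symbol_mul hσ (integrable_fourier_mul f g)
  have hlim : Filter.Tendsto (fun J : Finset ℤ ↦
      ∫ ξ, (∑ k ∈ J, 𝓕 Ψ ((2 : ℝ) ^ (-k) • ξ)) * (σ ξ * (𝓕 f ξ * 𝓕⁻ g ξ))) Filter.atTop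
      (nhds (symbolForm σ f g)) := by
    refine tendsto_integral_filter_of_dominated_convergence
      (fun ξ ↦ M * ‖σ ξ * (𝓕 f ξ * 𝓕⁻ g ξ)‖) (.of_forall fun J ↦ ?_)
      (.of_forall fun J ↦ .of_forall fun ξ ↦ ?_) (hi.norm.const_mul M) ?_
    · refine AEStronglyMeasurable.mul ?_ hi.1
      exact (continuous_finsetSum _ fun k _ ↦
        (𝓕 Ψ).continuous.comp (continuous_const_smul _)).aestronglyMeasurable
    · rw [norm_mul]
      exact mul_le_mul_of_nonneg_right (hM J ξ) (norm_nonneg _)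
    · have : Nonempty (Fin n) := ⟨⟨0, hn⟩⟩
      have h0 : ∀ᵐ ξ : EuclideanSpace ℝ (Fin n), ξ ≠ 0 := by
        rw [ae_iff]
        simp
      filter_upwards [h0] with ξ hξ
      have h1 : Filter.Tendsto (fun J : Finset ℤ ↦ ∑ k ∈ J, 𝓕 Ψ ((2 : ℝ) ^ (-k) • ξ))
        Filter.atTop (nhds 1) := hΨ.hasSum_one ξ hξ
      simpa only [one_mul] using h1.mul_const (σ ξ * (𝓕 f ξ * 𝓕⁻ g ξ))
  exact le_of_tendsto hlim.norm (.of_forall H)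

theorem norm_fourier_sub_le {f g : 𝓢(EuclideanSpace ℝ (Fin n), ℂ)} {ε : ℝ} (hε : 0 ≤ ε)
    (h : eLpNorm (⇑g - ⇑f) (ENNReal.ofReal 1) ≤ ENNReal.ofReal ε)
    (ξ : EuclideanSpace ℝ (Fin n)) : ‖𝓕 f ξ - 𝓕 g ξ‖ ≤ ε := by
  have e : 𝓕 f ξ - 𝓕 g ξ = 𝓕 (⇑(f - g)) ξ := by
    have h1 := map_sub (FourierTransform.fourierCLE ℂ 𝓢(EuclideanSpace ℝ (Fin n), ℂ)) f g
    simp only [FourierTransform.fourierCLE_apply] at h1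
    rw [← SchwartzMap.fourier_coe, h1]
    rfl
  rw [e]
  refine (VectorFourier.norm_fourierIntegral_le_integral_norm Real.fourierChar volume
    (innerₗ (EuclideanSpace ℝ (Fin n))) (⇑(f - g)) ξ).trans ?_
  rw [ENNReal.ofReal_one, eLpNorm_one_eq_lintegral_enorm] at h
  rw [integral_norm_eq_lintegral_enorm (f - g).continuous.aestronglyMeasurable]
  refine ENNReal.toReal_le_of_le_ofReal hε (le_trans (le_of_eq ?_) h)
  congr 1 with x
  rw [Pi.sub_apply, ← neg_sub (f x), enorm_neg]
  rfl

/-- Approximation in `L^1` makes the Fourier transforms uniformly close, which suffices for the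
form, while the mass tracks the `L^p` norm. Continuity in `L^p` is not needed, so `p` may be below
`1`. -/
theorem norm_symbolForm_le_of_forall_bumpFamily {σ : EuclideanSpace ℝ (Fin n) → ℂ}
    (hσ : MemLp σ (⊤ : ℝ≥0∞)) {p A : ℝ} (hp : 0 < p) (f g : 𝓢(EuclideanSpace ℝ (Fin n), ℂ))
    (H : ∀ F : BumpFamily (EuclideanSpace ℝ (Fin n)),
      ‖symbolForm σ (F.comb id) g‖ ≤ A * F.mass p ^ p⁻¹) (hA : 0 ≤ A) :
    ‖symbolForm σ f g‖ ≤ A * (∫ x, ‖f x‖ ^ p) ^ p⁻¹ := by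
  have hi := integrable_symbol_mul hσ (𝓕⁻ g).integrable
  set c := ∫ ξ, ‖σ ξ * 𝓕⁻ g ξ‖ with hc
  have key : ∀ ε : ℝ, 0 < ε →
      ‖symbolForm σ f g‖ ≤ A * ((∫ x, ‖f x‖ ^ p) + ε) ^ p⁻¹ + ε * c := by
    intro ε hε
    obtain ⟨F, h1, h2⟩ := exists_bumpFamily_approx hp le_rfl (f.memLp (ENNReal.ofReal p) volume)
      (f.memLp (ENNReal.ofReal 1) volume) hε
    refine (norm_le_norm_add_norm_sub' _ (symbolForm σ (F.comb id) g)).trans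
      (add_le_add ((H F).trans ?_) ?_)
    · gcongr
      exact F.mass_nonneg p
    · rw [symbolForm, symbolForm, ← integral_sub
        (integrable_symbol_mul hσ (integrable_fourier_mul f g))
        (integrable_symbol_mul hσ (integrable_fourier_mul _ g)), hc, ← integral_const_mul]
      refine norm_integral_le_of_norm_le (hi.norm.const_mul ε) (.of_forall fun ξ ↦ ?_)
      rw [show σ ξ * (𝓕 f ξ * 𝓕⁻ g ξ) - σ ξ * (𝓕 (F.comb id) ξ * 𝓕⁻ g ξ)
        = (𝓕 f ξ - 𝓕 (F.comb id) ξ) * (σ ξ * 𝓕⁻ g ξ) by ring, norm_mul]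
      exact mul_le_mul_of_nonneg_right (norm_fourier_sub_le hε.le h1 ξ) (norm_nonneg _)
  have hlim : Filter.Tendsto (fun ε : ℝ ↦ A * ((∫ x, ‖f x‖ ^ p) + ε) ^ p⁻¹ + ε * c)
      (nhdsWithin 0 (Set.Ioi 0)) (nhds (A * ((∫ x, ‖f x‖ ^ p) + 0) ^ p⁻¹ + 0 * c)) := by
    refine Filter.Tendsto.mono_left (Continuous.tendsto ?_ 0) nhdsWithin_le_nhds
    refine (continuous_const.mul ((continuous_const.add continuous_id).rpow_const fun _ ↦
      .inr (by positivity))).add (continuous_id.mul continuous_const)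
  rw [add_zero, zero_mul, add_zero] at hlim
  exact ge_of_tendsto hlim (by filter_upwards [self_mem_nhdsWithin] with ε hε using key ε hε)

theorem eLpNorm_multiplierOp_le {σ : EuclideanSpace ℝ (Fin n) → ℂ} (hσ : MemLp σ (⊤ : ℝ≥0∞))
    {p q q' A : ℝ} (hp : 0 < p) (hq : q.HolderConjugate q') (hA : 0 ≤ A)
    (H : ∀ F G : BumpFamily (EuclideanSpace ℝ (Fin n)),
      ‖symbolForm σ (F.comb id) (G.comb id)‖ ≤ A * F.mass p ^ p⁻¹ * G.mass q' ^ q'⁻¹)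
    (f : 𝓢(EuclideanSpace ℝ (Fin n), ℂ)) :
    eLpNorm (multiplierOp σ f) (ENNReal.ofReal q)
      ≤ ENNReal.ofReal A * eLpNorm f (ENNReal.ofReal p) := by
  have e : eLpNorm f (ENNReal.ofReal p) = ENNReal.ofReal ((∫ x, ‖f x‖ ^ p) ^ p⁻¹) := by
    rw [(f.memLp (ENNReal.ofReal p) volume).eLpNorm_eq_integral_rpow_norm (by simpa using hp)
      ENNReal.ofReal_ne_top, ENNReal.toReal_ofReal hp.le]
  rw [e, ← ENNReal.ofReal_mul hA]
  refine eLpNorm_le_of_forall_bumpFamily hq (continuous_multiplierOp hσ f).aestronglyMeasurable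
    (norm_multiplierOp_le σ f) (by positivity) fun G ↦ ?_
  rw [integral_multiplierOp_mul hσ]
  have hG : 0 ≤ G.mass q' ^ q'⁻¹ := Real.rpow_nonneg (G.mass_nonneg _) _
  refine (norm_symbolForm_le_of_forall_bumpFamily hσ hp f (G.comb id)
    (A := A * G.mass q' ^ q'⁻¹) (fun F ↦ (H F G).trans (le_of_eq (by ring)))
    (by positivity)).trans (le_of_eq (by ring))

end Limits

/-! ### Conclusion. -/

theorem theorem2p4 (n : ℕ) (hn : 1 ≤ n) (r₀ r₁ s₀ s₁ : ℝ)
    (hr₀ : 1 < r₀) (hr₁ : 1 < r₁) (hs₀ : 0 < s₀) (hs₁ : 0 < s₁)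
    (hrs₀ : (n : ℝ) < r₀ * s₀) (hrs₁ : (n : ℝ) < r₁ * s₁)
    (Ψ : 𝓢(EuclideanSpace ℝ (Fin n), ℂ)) (hΨ : IsDyadicPartition Ψ) :
    ∃ C : ℝ≥0, ∀ p₀ p₁ q₀ q₁ : ℝ, 0 < p₀ → 0 < p₁ → 1 < q₀ → 1 < q₁ →
      ∀ K₀ K₁ : ℝ≥0,
        MultiplierBound Ψ p₀ q₀ r₀ s₀ K₀ → MultiplierBound Ψ p₁ q₁ r₁ s₁ K₁ →
        ∀ θ p q r s : ℝ, 0 < θ → θ < 1 →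
          1 / p = (1 - θ) / p₀ + θ / p₁ →
          1 / q = (1 - θ) / q₀ + θ / q₁ →
          1 / r = (1 - θ) / r₀ + θ / r₁ →
          s = (1 - θ) * s₀ + θ * s₁ →
          MultiplierBound Ψ p q r s (C * K₀ ^ (1 - θ) * K₁ ^ θ) := by
  obtain ⟨C, hC0, hC⟩ := exists_norm_symbolForm_interp_le hΨ hr₀ hr₁ s₀ s₁
  refine ⟨⟨C, hC0⟩, fun p₀ p₁ q₀ q₁ hp₀ hp₁ hq₀ hq₁ K₀ K₁ hK₀ hK₁ θ p q r s h0 h1 hp hq hr hs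
    σ hσ hfin f hf hfc ↦ ?_⟩
  have h1' : 0 < 1 - θ := by linarith
  have hp0 : 0 < p := one_div_pos.1 (by rw [hp]; positivity)
  have one_lt : ∀ u u₀ u₁ : ℝ, 1 < u₀ → 1 < u₁ → 1 / u = (1 - θ) / u₀ + θ / u₁ → 1 < u := by
    intro u u₀ u₁ hu₀ hu₁ h
    have a0 : 0 < 1 / u := by rw [h]; positivity
    have a1 : 1 / u < 1 := by
      have b0 : (1 - θ) / u₀ < 1 - θ := div_lt_self h1' hu₀
      have b1 : θ / u₁ < θ := div_lt_self h0 hu₁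
      linarith
    have := (one_lt_inv₀ a0).2 a1
    rwa [one_div, inv_inv] at this
  have hr1 := one_lt r r₀ r₁ hr₀ hr₁ hr
  have hq1 := one_lt q q₀ q₁ hq₀ hq₁ hq
  have cq := Real.HolderConjugate.conjExponent hq1
  have cq₀ := Real.HolderConjugate.conjExponent hq₀
  have cq₁ := Real.HolderConjugate.conjExponent hq₁
  -- Conjugate exponents interpolate by the same rule, because `1/q' = 1 - 1/q` is affine in `1/q`.
  have hq' : 1 / q.conjExponent = (1 - θ) / q₀.conjExponent + θ / q₁.conjExponent := by
    have e := cq.inv_add_inv_eq_one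
    have e0 := cq₀.inv_add_inv_eq_one
    have e1 := cq₁.inv_add_inv_eq_one
    simp only [div_eq_mul_inv, one_mul] at hq ⊢
    linear_combination e - hq - (1 - θ) * e0 - θ * e1
  set A : ℝ := C * (K₀ : ℝ) ^ (1 - θ) * (K₁ : ℝ) ^ θ with hA
  have hA0 : 0 ≤ A := by positivity
  have eA : ((⟨C, hC0⟩ * K₀ ^ (1 - θ) * K₁ ^ θ : ℝ≥0) : ℝ≥0∞) = ENNReal.ofReal A := by
    rw [← ENNReal.ofReal_coe_nnreal]
    congr 1
  -- The representation of the pieces needs a strict bound `N` on the Hörmander norm; at the end `N`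
  -- decreases to the norm itself, which may be zero.
  have key : ∀ N : ℝ, hormanderENorm Ψ r s σ < ENNReal.ofReal N →
      eLpNorm (multiplierOp σ f) (ENNReal.ofReal q)
        ≤ ENNReal.ofReal (A * N) * eLpNorm f (ENNReal.ofReal p) := by
    intro N hN
    have hN0 : 0 < N := by
      rw [← ENNReal.ofReal_pos]
      exact bot_le.trans_lt hN
    refine eLpNorm_multiplierOp_le hσ hp0 cq (by positivity) (fun F G ↦ ?_) (hfc.toSchwartzMap hf)
    refine norm_symbolForm_le_of_forall_sum hn hΨ hσ _ _ fun J ↦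
      norm_integral_sum_mul_le hΨ hr1 hσ hN J _ _ fun W hW ↦ ?_
    exact hC p₀ p₁ q₀ q₁ _ _ K₀ K₁ hp₀ hp₁ cq₀ cq₁ hK₀ hK₁ θ p _ r s h0 h1 hp0 cq.symm.pos
      (by linarith) hp hq' hr hs hs₀.le hs₁.le N hN0.le J W hW F G
  set h := (hormanderENorm Ψ r s σ).toReal with hh
  have eh : hormanderENorm Ψ r s σ = ENNReal.ofReal h := (ENNReal.ofReal_toReal hfin.ne).symm
  have hh0 : 0 ≤ h := ENNReal.toReal_nonneg
  have hfL : eLpNorm f (ENNReal.ofReal p) ≠ ⊤ :=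
    ((hfc.toSchwartzMap hf).memLp (ENNReal.ofReal p) volume).eLpNorm_ne_top
  rw [eA, eh, ← ENNReal.ofReal_mul hA0]
  have hlim : Filter.Tendsto (fun N : ℝ ↦ ENNReal.ofReal (A * N) * eLpNorm f (ENNReal.ofReal p))
      (nhdsWithin h (Set.Ioi h)) (nhds (ENNReal.ofReal (A * h) * eLpNorm f (ENNReal.ofReal p))) := by
    refine ENNReal.Tendsto.mul_const (Filter.Tendsto.mono_left ?_ nhdsWithin_le_nhds) (.inr hfL)
    exact (ENNReal.continuous_ofReal.comp (continuous_const_mul A)).tendsto h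
  refine ge_of_tendsto hlim ?_
  filter_upwards [self_mem_nhdsWithin] with N hN
  refine key N ?_
  rw [eh]
  exact (ENNReal.ofReal_lt_ofReal_iff (hh0.trans_lt hN)).2 hN
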